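/- All multigraphs are finite; loops and parallel edges are allowed, a loop contributes $2$ to the degree of its vertex, and a single loop (resp. a pair of parallel edges) is a cycle of length $1$ (resp. $2$). For a multigraph $G$ let $f_2(G)$ be the maximum number of vertices in a (possibly empty) $2$-regular subgraph of $G$. A cut-edge is an edge whose deletion increases the number of components. A multigraph is subcubic if every vertex has degree at most $3$, and cubic if every vertex has degree exactly $3$. It is $2$-edge-connected if it is connected, has at least two vertices and has no cut-edge; it is $2$-connected if it is connected, has at least three vertices, and no deletion of a single vertex disconnects it. A balloon is a multigraph obtained from a $2$-edge-connected cubic multigraph by subdividing one edge (once). Let $\mathcal G$ be the family of multigraphs obtained as follows: (1) start with a $2$-connected cubic bipartite multigraph $H$ with parts $X$ and $Y$; (2) delete one vertex $\hat y\in Y$ such that $H-\hat y$ is $2$-connected; (3) explode any subset (possibly empty) of the vertices in $Y\setminus\{\hat y\}$, one after the other. Here exploding $y$ means taking the disjoint union of the current multigraph with a $2$-connected cubic multigraph $F$, deleting $y$ and a vertex $z$ of $F$, and then adding three edges which, for some bijection between the three edges at $y$ and the three edges at $z$, join the other end of each edge at $y$ to the other end of the corresponding edge at $z$ (so that all remaining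 vertices keep their degrees). Theorem. Let $G$ be a subcubic multigraph with $n$ vertices and $c$ cut-edges, and let $d=3n-2|E(G)|$ be its $1$-deficit. Then $$f_2(G)\ \ge\ n-\max\Bigl\{0,\frac{d+c-1}{2}\Bigr\}.$$ Moreover, when $G$ is connected, equality holds if and only if either $G$ is a cubic multigraph with no cut-edge, or each component of the multigraph obtained from $G$ by deleting all its cut-edges is a single vertex (with or without a loop), a balloon, or a member of $\mathcal G$. -/

import Mathlib

open scoped Graph

namespace Graph

/-- The degree of a vertex of a (finite) multigraph; a loop counts twice. -/
noncomputable def deg {α β : Type*} (G : Graph α β) (v : α) : ℕ :=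
  {e | G.IsNonloopAt e v}.ncard + 2 * {e | G.IsLoopAt e v}.ncard

/-- Every vertex has degree `k`. -/
def IsRegular {α β : Type*} (G : Graph α β) (k : ℕ) : Prop :=
  ∀ v ∈ V(G), G.deg v = k

/-- Every vertex has degree at most `3`. -/
def IsSubcubic {α β : Type*} (G : Graph α β) : Prop :=
  ∀ v ∈ V(G), G.deg v ≤ 3

/-- Connected multigraphs; in particular they have a vertex. -/
def IsConnected {α β : Type*} (G : Graph α β) : Prop :=
  V(G).Nonempty ∧ ∀ x ∈ V(G), ∀ y ∈ V(G), Relation.ReflTransGen G.Adj x y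

/-- `C` is a component of `G`: a maximal connected subgraph. -/
def IsComponentOf {α β : Type*} (C G : Graph α β) : Prop :=
  Maximal (fun K : Graph α β => K ≤ G ∧ K.IsConnected) C

/-- `e` is a cut-edge of `G`: its ends are in different components once `e` is deleted. -/
def IsCutEdge {α β : Type*} (G : Graph α β) (e : β) : Prop :=
  ∃ x y, G.IsLink e x y ∧ ¬ Relation.ReflTransGen (G.deleteEdges {e}).Adj x y

/-- The set of all cut-edges of `G`. -/
def cutEdges {α β : Type*} (G : Graph α β) : Set β := {e | G.IsCutEdge e}

/-- The `1`-deficit `3 |V(G)| - 2 |E(G)|`. -/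
noncomputable def deficit {α β : Type*} (G : Graph α β) : ℤ :=
  3 * (V(G).ncard : ℤ) - 2 * (E(G).ncard : ℤ)

/-- `f₂(G)`: the largest number of vertices of a `2`-regular subgraph of the finite multigraph
`G`. The subgraph need not be induced and may be empty; a loop, and a pair of parallel edges,
form cycles of lengths `1` and `2`. -/
noncomputable def f₂ {α β : Type*} (G : Graph α β) : ℕ :=
  sSup {k | ∃ K : Graph α β, K ≤ G ∧ K.IsRegular 2 ∧ V(K).ncard = k}

/-- `2`-edge-connected: at least two vertices, connected, no cut-edge. -/
def IsTwoEdgeConnected {α β : Type*} (G : Graph α β) : Prop :=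
  V(G).Nontrivial ∧ G.IsConnected ∧ ∀ e, ¬ G.IsCutEdge e

/-- `2`-connected: at least three vertices, connected, and no vertex whose deletion disconnects. -/
def IsTwoConnected {α β : Type*} (G : Graph α β) : Prop :=
  2 < V(G).ncard ∧ G.IsConnected ∧ ∀ v ∈ V(G), (G.deleteVerts {v}).IsConnected

/-- `G` is bipartite with parts `X` and `Y`. -/
def IsBipartition {α β : Type*} (G : Graph α β) (X Y : Set α) : Prop :=
  V(G) = X ∪ Y ∧ Disjoint X Y ∧
    ∀ e x y, G.IsLink e x y → (x ∈ X ∧ y ∈ Y) ∨ (x ∈ Y ∧ y ∈ X)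

/-- `G` and `K` are isomorphic multigraphs. -/
def IsIsomorphic {α β α' β' : Type*} (G : Graph α β) (K : Graph α' β') : Prop :=
  ∃ (f : V(G) ≃ V(K)) (g : E(G) ≃ E(K)), ∀ (e : E(G)) (x y : V(G)),
    G.IsLink (e : β) (x : α) (y : α) ↔ K.IsLink (g e : β') (f x : α') (f y : α')

/-- `B` is obtained from `K` by subdividing one edge `e` with ends `u`, `v`: the edge is replaced
by a new vertex `w` and two new edges `e₁`, `e₂` joining `w` to `u` and to `v`. -/
def IsEdgeSubdivision {α β : Type*} (K B : Graph α β) : Prop :=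
  ∃ (e e₁ e₂ : β) (u v w : α), K.IsLink e u v ∧ w ∉ V(K) ∧ e₁ ∉ E(K) ∧ e₂ ∉ E(K) ∧ e₁ ≠ e₂ ∧
    V(B) = insert w V(K) ∧
    ∀ f x y, B.IsLink f x y ↔
      (K.IsLink f x y ∧ f ≠ e) ∨ (f = e₁ ∧ s(x, y) = s(u, w)) ∨ (f = e₂ ∧ s(x, y) = s(w, v))

/-- A balloon: a multigraph obtained from a (finite) `2`-edge-connected cubic multigraph by
subdividing one edge. (Every finite multigraph is isomorphic to one with labels in `ℕ`.) -/
def IsBalloon {α β : Type*} (G : Graph α β) : Prop :=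
  ∃ K B : Graph ℕ ℕ, V(K).Finite ∧ E(K).Finite ∧ K.IsRegular 3 ∧ K.IsTwoEdgeConnected ∧
    IsEdgeSubdivision K B ∧ G.IsIsomorphic B

/-- `B` is obtained from `A` by exploding the vertex `y` of `A` by means of `F` and its vertex `z`.
Here `A` and `F` are disjoint. The edges at `y` are put in bijection (by `σ`) with the edges at
`z`; the vertices `y` and `z` are deleted from the disjoint union of `A` and `F`, and for each edge
`e` at `y` an edge (again called `e`) is added that joins the other end of `e` to the other end of
`σ e`. -/
def IsExplosion {α β : Type*} (A : Graph α β) (y : α) (F : Graph α β) (z : α)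
    (B : Graph α β) : Prop :=
  y ∈ V(A) ∧ z ∈ V(F) ∧ Disjoint V(A) V(F) ∧ Disjoint E(A) E(F) ∧
  V(B) = (V(A) \ {y}) ∪ (V(F) \ {z}) ∧
  ∃ σ : β → β, Set.BijOn σ {e | A.Inc e y} {e | F.Inc e z} ∧
    ∀ e p q, B.IsLink e p q ↔
      (A.IsLink e p q ∧ p ≠ y ∧ q ≠ y) ∨ (F.IsLink e p q ∧ p ≠ z ∧ q ≠ z) ∨
      (A.IsLink e p y ∧ F.IsLink (σ e) q z) ∨ (A.IsLink e q y ∧ F.IsLink (σ e) p z)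

/-- `ExplosionStage A₀ R₀ A R`: starting from `A₀`, the multigraph `A` arises by exploding some of
the vertices in `R₀`, one after the other and each at most once, always by means of a finite
`2`-connected cubic multigraph; `R` is the set of those vertices of `R₀` not yet exploded. -/
inductive ExplosionStage {α β : Type*} (A₀ : Graph α β) (R₀ : Set α) :
    Graph α β → Set α → Prop
  | start : ExplosionStage A₀ R₀ A₀ R₀
  | explode {A F B : Graph α β} {R : Set α} {y z : α} :
      ExplosionStage A₀ R₀ A R → y ∈ R →
      V(F).Finite → E(F).Finite → F.IsRegular 3 → F.IsTwoConnected →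
      IsExplosion A y F z B → ExplosionStage A₀ R₀ B (R \ {y})

/-- The family `𝒢`: take a (finite) `2`-connected cubic bipartite multigraph `H` with parts `X`
and `Y`, delete a vertex `y₀ ∈ Y` such that `H - y₀` is `2`-connected, and explode some of the
vertices of `Y - y₀`. -/
def IsInFamilyG {α β : Type*} (G : Graph α β) : Prop :=
  ∃ (H : Graph ℕ ℕ) (X Y : Set ℕ) (y₀ : ℕ) (A : Graph ℕ ℕ) (R : Set ℕ),
    V(H).Finite ∧ E(H).Finite ∧ H.IsRegular 3 ∧ H.IsTwoConnected ∧ H.IsBipartition X Y ∧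
    y₀ ∈ Y ∧ (H.deleteVerts {y₀}).IsTwoConnected ∧
    ExplosionStage (H.deleteVerts {y₀}) (Y \ {y₀}) A R ∧ G.IsIsomorphic A

end Graph

/-! # Large `2`-regular subgraphs of subcubic multigraphs

In a subcubic multigraph the `2`-regular subgraphs are given by the edge sets all of whose degrees
are even, that is, by the edge sets without boundary modulo two, and the number of vertices of such
a subgraph is the number of its edges. Cut-edges lie in no such set, so the components of the
multigraph without its cut-edges can be treated separately.

*One component.* Let `M` be a largest edge set without boundary in a multigraph without cut-edges.
Its complement `J` is a smallest edge set with its boundary, and every cut that meets `J` in an odd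
number of edges has odd size, hence at least three edges. Under these conditions `J` contains at
most a third of the edges (`TJoin.three_mul_card_le`). This is proved with Sebő's argument for
bipartite multigraphs: fix an end `x` of an edge of `J` and choose `b` such that a smallest set with
the boundary of `J` changed at `x` and `b` is as small as possible; then every minimum set has
exactly one edge at `b`
(`TJoin.card_star_eq_one`), and minimality survives the contraction of the star of `b`
(`TJoin.wt_nonneg_of_bd_neighbours`), which removes at least three edges but only one of `J`.
Subdividing all edges reduces the general case to the bipartite one. Thus a component with `n`
vertices, `m` edges and deficit `d = 3 n - 2 m` has `n - f₂ ≤ d / 3`, and, these numbers being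
integers, `n - f₂ ≤ (d - 1) / 2` unless `d = 0`.

*Summation.* Deleting the `c` cut-edges raises the deficit by `2 c` and the number of components by
`c`, and components of deficit zero are components of the original multigraph. Summing up gives the
bound. In a connected multigraph either all deficits vanish, and then it is cubic without cut-edges,
or none does, and then equality holds iff it holds in every component (`TJoin.card_sub_card_le`).

*Equality in a component.* From `(d - 1) / 2 = n - f₂ ≤ d / 3` one gets `d = 1` or `d = 3`
(`Graph.two_mul_sub_f₂_eq_iff`). If `d = 1` and there are at least two vertices, then exactly one
vertex has degree two, and suppressing it shows that the component is a balloon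
(`Graph.CutTwo.isBalloon`). If `d = 3`, three vertices have degree two, and there is no spanning
`2`-regular subgraph, so the vertices of degree three have no perfect matching. Tutte's theorem gives
a set `S` with at least `|S| + 2` odd components of the rest; counting the edges between these
components and `X`, the union of `S` and the three vertices of degree two, shows that each component
sends exactly three edges to `X`, that `X` is independent, and that there is nothing else
(`Graph.Skeleton`, `Graph.exists_skeleton`). Contracting these components one by one leads to a
bipartite multigraph that becomes cubic when a vertex is joined to the three vertices of degree two;
read backwards, the contractions are explosions, so that the component belongs to `𝒢`
(`Graph.Skeleton.isInFamilyG`).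

Conversely, members of `𝒢` have deficit three, and they have no spanning `2`-regular subgraph: there
is none with degree two on `X` and even degrees on `Y` without the deleted vertex, as `|X| = |Y|`,
and contracting the exploded parts preserves even degrees (`Graph.Obstructed`). -/

set_option linter.unusedSectionVars false

/-! ### Boundaries of edge sets modulo two -/


namespace TJoin

section Boundary

variable {V ε : Type*} [DecidableEq V] [DecidableEq ε]

/-- The indicator of the vertex `v`, with values in `ZMod 2`. -/
def pt (v : V) : V → ZMod 2 := fun w => if v = w then 1 else 0

/-- The boundary of the edge set `Q` modulo two, where the edge `e` has the ends `p e` and `q e`: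
the indicator of the set of vertices whose degree in `Q` is odd. Loops do not contribute. An edge set
without boundary is called closed in the comments below. -/
def bd (p q : ε → V) (Q : Finset ε) : V → ZMod 2 := ∑ e ∈ Q, (pt (p e) + pt (q e))

variable {p q : ε → V}

@[simp] lemma pt_self (v : V) : pt v v = 1 := by simp [pt]

lemma pt_ne {v w : V} (h : v ≠ w) : pt v w = 0 := by simp [pt, h]

lemma add_self_fun (f : V → ZMod 2) : f + f = 0 := by
  funext v; exact CharTwo.add_self_eq_zero _

lemma zmod2_cases (a : ZMod 2) : a = 0 ∨ a = 1 := by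
  revert a; decide

lemma sum_symmDiff {M : Type*} [AddCommGroup M] (hM : ∀ x : M, x + x = 0) (P Q : Finset ε)
    (f : ε → M) : ∑ e ∈ symmDiff P Q, f e = ∑ e ∈ P, f e + ∑ e ∈ Q, f e := by
  have h1 : symmDiff P Q = (P \ Q) ∪ (Q \ P) := rfl
  have hd : Disjoint (P \ Q) (Q \ P) := by
    rw [Finset.disjoint_left]; intro x; simp; tauto
  rw [h1, Finset.sum_union hd, ← Finset.sum_inter_add_sum_sdiff P Q f,
    ← Finset.sum_inter_add_sum_sdiff Q P f, Finset.inter_comm Q P]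
  have := hM (∑ e ∈ P ∩ Q, f e)
  generalize (∑ e ∈ P ∩ Q, f e) = x at *
  generalize (∑ e ∈ P \ Q, f e) = y at *
  generalize (∑ e ∈ Q \ P, f e) = z at *
  calc y + z = y + z + (x + x) := by rw [this, add_zero]
    _ = _ := by abel

lemma bd_symmDiff (P Q : Finset ε) : bd p q (symmDiff P Q) = bd p q P + bd p q Q :=
  sum_symmDiff add_self_fun P Q _

@[simp] lemma bd_empty : bd p q ∅ = 0 := by simp [bd]

@[simp] lemma bd_singleton (e : ε) : bd p q {e} = pt (p e) + pt (q e) := by simp [bd]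

lemma bd_sdiff {P Q : Finset ε} (h : P ⊆ Q) : bd p q (Q \ P) = bd p q Q + bd p q P := by
  rw [← bd_symmDiff]; congr 1
  ext x; simp [Finset.mem_symmDiff]; intro h1 h2; exact absurd (h h1) h2

lemma bd_apply (Q : Finset ε) (v : V) :
    bd p q Q v = ∑ e ∈ Q, ((if p e = v then 1 else 0) + (if q e = v then 1 else 0)) := by
  simp [bd, Finset.sum_apply, pt]

/-- Summing the boundary of `Q` over a vertex set counts the edges of `Q` leaving that set. -/
lemma sum_bd (Q : Finset ε) (U : Finset V) :
    ∑ v ∈ U, bd p q Q v =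
      ∑ e ∈ Q, ((if p e ∈ U then 1 else 0) + (if q e ∈ U then 1 else 0)) := by
  simp only [bd_apply]
  rw [Finset.sum_comm]
  refine Finset.sum_congr rfl fun e _ => ?_
  rw [Finset.sum_add_distrib]
  simp

/-- Each vertex of odd degree in `R` is joined, by a subset of `R`, to another one. -/
lemma exists_pairing (R : Finset ε) (u : V) (hu : bd p q R u = 1) :
    ∃ u', u' ≠ u ∧ bd p q R u' = 1 ∧ ∃ P ⊆ R, bd p q P = pt u + pt u' := by
  classical
  by_contra hcon
  push Not at hcon
  set W : Set V := {w | ∃ P ⊆ R, bd p q P = pt u + pt w} with hW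
  have huW : u ∈ W := ⟨∅, by simp, by simp [add_self_fun]⟩
  have step : ∀ e ∈ R, ∀ x y, pt (p e) + pt (q e) = pt x + pt y → x ∈ W → y ∈ W := by
    rintro e he x y hxy ⟨P, hP, hb⟩
    refine ⟨symmDiff P {e}, ?_, ?_⟩
    · intro a ha
      rcases Finset.mem_symmDiff.1 ha with h | h
      · exact hP h.1
      · rw [Finset.mem_singleton.1 h.1]; exact he
    · rw [bd_symmDiff, hb, bd_singleton, hxy]
      have := add_self_fun (pt x)
      calc pt u + pt x + (pt x + pt y) = pt u + (pt x + pt x) + pt y := by abel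
        _ = _ := by rw [this, add_zero]
  have hcl : ∀ e ∈ R, (p e ∈ W ↔ q e ∈ W) := fun e he =>
    ⟨step e he _ _ rfl, step e he _ _ (add_comm _ _)⟩
  set U : Finset V := (R.image p ∪ R.image q ∪ {u}).filter (· ∈ W) with hU
  have h1 := sum_bd (p := p) (q := q) R U
  rw [Finset.sum_eq_single u, hu] at h1
  · rw [Finset.sum_eq_zero] at h1
    · exact one_ne_zero h1
    · intro e he
      have hp : p e ∈ U ↔ p e ∈ W := by
        simp only [hU, Finset.mem_filter, and_iff_right_iff_imp]
        intro _; simp only [Finset.mem_union, Finset.mem_image]; left; left; exact ⟨e, he, rfl⟩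
      have hq : q e ∈ U ↔ q e ∈ W := by
        simp only [hU, Finset.mem_filter, and_iff_right_iff_imp]
        intro _; simp only [Finset.mem_union, Finset.mem_image]; left; right; exact ⟨e, he, rfl⟩
      rw [if_congr hp rfl rfl, if_congr hq rfl rfl, if_congr (hcl e he) rfl rfl]
      exact CharTwo.add_self_eq_zero _
  · intro v hv hne
    obtain ⟨P, hP, hb⟩ := (Finset.mem_filter.1 hv).2
    rcases zmod2_cases (bd p q R v) with h | h
    · exact h
    · exact absurd hb (hcon v hne h P hP)
  · intro h
    exact absurd (by simp [hU, huW]) h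

/-- The edge `e` is incident with the vertex `b`. -/
def At (p q : ε → V) (b : V) (e : ε) : Prop := p e = b ∨ q e = b

instance (b : V) : DecidablePred (At p q b) := fun _ => by unfold At; infer_instance

/-- For an edge incident with `b`, its other end. -/
def opp (p q : ε → V) (b : V) (e : ε) : V := if p e = b then q e else p e

lemma pt_add_pt_of_at {b : V} {e : ε} (h : At p q b e) :
    pt (p e) + pt (q e) = pt b + pt (opp p q b e) := by
  unfold opp
  split_ifs with h1
  · rw [h1]
  · rcases h with h | h
    · exact absurd h h1
    · rw [h, add_comm]

lemma bd_apply_loopless {Q : Finset ε} (hl : ∀ e ∈ Q, p e ≠ q e) (b : V) :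
    bd p q Q b = ((Q.filter (At p q b)).card : ZMod 2) := by
  rw [bd_apply, Finset.card_filter, Nat.cast_sum]
  refine Finset.sum_congr rfl fun e he => ?_
  have := hl e he
  unfold At
  by_cases h1 : p e = b <;> by_cases h2 : q e = b <;> simp [h1, h2]
  exact absurd (h1.trans h2.symm) this

/-! ### Weights relative to an edge set -/

/-- The weight of `R` relative to `J`: edges of `J` count `-1`, the others `1`. -/
def wt (J R : Finset ε) : ℤ := ∑ e ∈ R, if e ∈ J then -1 else 1

lemma card_symmDiff_eq (J R : Finset ε) : ((symmDiff J R).card : ℤ) = J.card + wt J R := by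
  have h1 : symmDiff J R = (J \ R) ∪ (R \ J) := rfl
  have hd : Disjoint (J \ R) (R \ J) := by
    rw [Finset.disjoint_left]; intro x; simp; tauto
  have h2 : wt J R = (R \ J).card - (R ∩ J).card := by
    unfold wt
    rw [← Finset.sum_inter_add_sum_sdiff R J]
    rw [Finset.sum_congr rfl (g := fun _ => (-1 : ℤ)), Finset.sum_congr rfl (s₁ := R \ J)
      (g := fun _ => (1 : ℤ))]
    · simp; ring
    · intro e he; simp [(Finset.mem_sdiff.1 he).2]
    · intro e he; simp [(Finset.mem_inter.1 he).2]
  have h3 := Finset.card_sdiff_add_card_inter J R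
  rw [h1, Finset.card_union_of_disjoint hd, h2, Finset.inter_comm R J]
  push_cast
  have : (J.card : ℤ) = (J \ R).card + (J ∩ R).card := by exact_mod_cast h3.symm
  rw [this]; ring

lemma wt_sdiff_add {J P R : Finset ε} (h : P ⊆ R) : wt J (R \ P) + wt J P = wt J R :=
  Finset.sum_sdiff h

lemma wt_emod_two (J R : Finset ε) : (wt J R) % 2 = (R.card : ℤ) % 2 := by
  have : wt J R = R.card - 2 * (∑ e ∈ R, if e ∈ J then (1 : ℤ) else 0) := by
    unfold wt
    rw [Finset.mul_sum, Finset.card_eq_sum_ones, Nat.cast_sum, ← Finset.sum_sub_distrib]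
    refine Finset.sum_congr rfl fun e _ => ?_
    split_ifs <;> simp
  omega

lemma wt_union {J P R : Finset ε} (h : Disjoint P R) : wt J (P ∪ R) = wt J P + wt J R :=
  Finset.sum_union h

lemma wt_pair {J : Finset ε} {e f : ε} (h : e ≠ f) :
    wt J {e, f} = (if e ∈ J then -1 else 1) + (if f ∈ J then -1 else 1) :=
  Finset.sum_pair h

/-- In a bipartite multigraph, edge sets without boundary have even cardinality. -/
lemma even_card_of_bd_eq_zero {C : Finset ε} (κ : V → Bool) (hκ : ∀ e ∈ C, κ (p e) ≠ κ (q e))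
    (hC : bd p q C = 0) : (C.card : ℤ) % 2 = 0 := by
  set U : Finset V := (C.image p ∪ C.image q).filter (fun v => κ v = true) with hU
  have h1 := sum_bd (p := p) (q := q) C U
  rw [hC] at h1
  have h2 : ∑ e ∈ C, ((if p e ∈ U then (1 : ZMod 2) else 0) + (if q e ∈ U then 1 else 0)) =
      ∑ e ∈ C, 1 := by
    refine Finset.sum_congr rfl fun e he => ?_
    have hp : p e ∈ U ↔ κ (p e) = true := by
      simp only [hU, Finset.mem_filter, and_iff_right_iff_imp]
      intro _; simp only [Finset.mem_union, Finset.mem_image]; left; exact ⟨e, he, rfl⟩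
    have hq : q e ∈ U ↔ κ (q e) = true := by
      simp only [hU, Finset.mem_filter, and_iff_right_iff_imp]
      intro _; simp only [Finset.mem_union, Finset.mem_image]; right; exact ⟨e, he, rfl⟩
    have := hκ e he
    rw [if_congr hp rfl rfl, if_congr hq rfl rfl]
    rcases Bool.eq_false_or_eq_true (κ (p e)) with h3 | h3 <;>
      rcases Bool.eq_false_or_eq_true (κ (q e)) with h4 | h4 <;> rw [h3, h4] at this ⊢ <;>
      simp at this ⊢
  rw [h2] at h1
  simp only [Pi.zero_apply, Finset.sum_const_zero, Finset.sum_const, nsmul_eq_mul, mul_one] at h1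
  have := (ZMod.natCast_eq_zero_iff C.card 2).1 h1.symm
  omega

end Boundary

end TJoin

namespace TJoin

/-! ### Minimum edge sets with a given boundary -/

section Minimum

variable {V ε : Type*} [DecidableEq V] [DecidableEq ε] {p q : ε → V}

lemma bd_symmDiff_of_eq_zero {Q C : Finset ε} (h : bd p q C = 0) :
    bd p q (symmDiff Q C) = bd p q Q := by
  rw [bd_symmDiff, h, add_zero]

lemma symmDiff_subset_of_subset {Q C E : Finset ε} (hQ : Q ⊆ E) (hC : C ⊆ E) :
    symmDiff Q C ⊆ E := by
  intro x hx
  rcases Finset.mem_symmDiff.1 hx with h | h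
  · exact hQ h.1
  · exact hC h.1

/-- If `R` has odd degree exactly at the further ends of the edges in `S` and at `x`, and `S` has at
least three elements, then `R` contains a path between two of these further ends: otherwise each
of them could only be paired with `x`. -/
lemma exists_joined_pair {b x : V} {S R : Finset ε} (hS : 2 < S.card)
    (hR : bd p q R = pt x + ∑ e ∈ S, pt (opp p q b e)) :
    ∃ e₁ ∈ S, ∃ e₂ ∈ S, e₁ ≠ e₂ ∧ ∃ P ⊆ R, bd p q P = pt (opp p q b e₁) + pt (opp p q b e₂) := by
  by_contra hcon
  push Not at hcon
  have hinj : ∀ e₁ ∈ S, ∀ e₂ ∈ S, e₁ ≠ e₂ → opp p q b e₁ ≠ opp p q b e₂ := by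
    intro e₁ h₁ e₂ h₂ hne heq
    exact hcon e₁ h₁ e₂ h₂ hne ∅ (by simp) (by rw [heq, add_self_fun, bd_empty])
  have hval : ∀ e ∈ S, opp p q b e ≠ x → bd p q R (opp p q b e) = 1 := by
    intro e he hx
    rw [hR, Pi.add_apply, pt_ne hx.symm, zero_add, Finset.sum_apply, Finset.sum_eq_single e,
      pt_self]
    · intro e' he' hne
      exact pt_ne (hinj e' he' e he hne)
    · intro h; exact absurd he h
  have hpath : ∀ e ∈ S, opp p q b e ≠ x →
      ∃ P ⊆ R, bd p q P = pt (opp p q b e) + pt x := by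
    intro e he hx
    obtain ⟨u', hne, hu', P, hP, hb⟩ := exists_pairing R _ (hval e he hx)
    by_cases hux : u' = x
    · subst hux; exact ⟨P, hP, hb⟩
    · exfalso
      rw [hR, Pi.add_apply, pt_ne (Ne.symm hux), zero_add, Finset.sum_apply] at hu'
      obtain ⟨e', he', hne'⟩ := Finset.exists_ne_zero_of_sum_ne_zero (hu'.trans_ne one_ne_zero)
      have : opp p q b e' = u' := by
        by_contra h; exact hne' (pt_ne h)
      subst this
      refine hcon e he e' he' ?_ P hP hb
      rintro rfl; exact hne rfl
  obtain ⟨a₁, a₂, a₃, h₁, h₂, h₃, h12, h13, h23⟩ := Finset.two_lt_card_iff.1 hS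
  -- at most one of three distinct further ends equals `x`
  have key : ∃ e₁ ∈ S, ∃ e₂ ∈ S, e₁ ≠ e₂ ∧ opp p q b e₁ ≠ x ∧ opp p q b e₂ ≠ x := by
    by_cases hx1 : opp p q b a₁ = x
    · refine ⟨a₂, h₂, a₃, h₃, h23, ?_, ?_⟩
      · rw [← hx1]; exact hinj _ h₂ _ h₁ h12.symm
      · rw [← hx1]; exact hinj _ h₃ _ h₁ h13.symm
    · by_cases hx2 : opp p q b a₂ = x
      · refine ⟨a₁, h₁, a₃, h₃, h13, hx1, ?_⟩
        rw [← hx2]; exact hinj _ h₃ _ h₂ h23.symm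
      · exact ⟨a₁, h₁, a₂, h₂, h12, hx1, hx2⟩
  obtain ⟨e₁, he₁, e₂, he₂, hne, hx₁, hx₂⟩ := key
  obtain ⟨P₁, hP₁, hb₁⟩ := hpath e₁ he₁ hx₁
  obtain ⟨P₂, hP₂, hb₂⟩ := hpath e₂ he₂ hx₂
  refine hcon e₁ he₁ e₂ he₂ hne _ (symmDiff_subset_of_subset hP₁ hP₂) ?_
  rw [bd_symmDiff, hb₁, hb₂]
  have := add_self_fun (pt x)
  calc _ = pt (opp p q b e₁) + pt (opp p q b e₂) + (pt x + pt x) := by abel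
    _ = _ := by rw [this, add_zero]

/-- Sebő's key observation: if `b` is a vertex such that the minimum size of an edge set with
boundary `T + x + b` is as small as possible, then every minimum edge set with boundary `T`
contains exactly one edge at `b`. -/
lemma card_star_eq_one {E : Finset ε} (hl : ∀ e ∈ E, p e ≠ q e) {T : V → ZMod 2} {x b : V}
    (hxb : x ≠ b) {Q : Finset ε} (hQE : Q ⊆ E) (hQ : bd p q Q = T + pt x + pt b)
    (hQmin : ∀ Q' ⊆ E, ∀ b', bd p q Q' = T + pt x + pt b' → Q.card ≤ Q'.card)
    {J : Finset ε} (hJE : J ⊆ E) (hJ : bd p q J = T)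
    (hJmin : ∀ C ⊆ E, bd p q C = 0 → 0 ≤ wt J C) :
    (J.filter (At p q b)).card = 1 ∧ T b = 1 := by
  -- a shortest such edge set avoids `b`: dropping an edge at `b` would move `b` to its other end
  have hno : ∀ Q' ⊆ E, bd p q Q' = T + pt x + pt b → Q'.card ≤ Q.card →
      ∀ e, At p q b e → e ∉ Q' := by
    intro Q' hQ'E hQ' hle e heb heQ
    have h1 : bd p q (Q' \ {e}) = T + pt x + pt (opp p q b e) := by
      rw [bd_sdiff (by simpa using heQ), hQ', bd_singleton, pt_add_pt_of_at heb]
      have := add_self_fun (pt b)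
      calc _ = T + pt x + pt (opp p q b e) + (pt b + pt b) := by abel
        _ = _ := by rw [this, add_zero]
    have h2 := hQmin _ (Finset.sdiff_subset.trans hQ'E) _ h1
    have h3 : (Q' \ {e}).card < Q'.card := by
      apply Finset.card_lt_card
      refine ⟨Finset.sdiff_subset, fun h => ?_⟩
      have := h heQ
      simp at this
    omega
  have hnoQ := hno Q hQE hQ le_rfl
  have hTb : T b = 1 := by
    have h1 : bd p q Q b = 0 := by
      rw [bd_apply_loopless (fun e he => hl e (hQE he))]
      rw [Finset.filter_false_of_mem (fun e he hb => hnoQ e hb he)]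
      simp
    rw [hQ, Pi.add_apply, Pi.add_apply, pt_ne hxb, pt_self, add_zero] at h1
    rcases zmod2_cases (T b) with h | h
    · rw [h] at h1; exact absurd h1 (by decide)
    · exact h
  refine ⟨?_, hTb⟩
  set S := J.filter (At p q b) with hS
  have hodd : (S.card : ZMod 2) = 1 := by
    rw [hS, ← bd_apply_loopless (fun e he => hl e (hJE he)), hJ, hTb]
  by_contra hne
  have hS2 : 2 < S.card := by
    have hpar : S.card % 2 = 1 := by
      by_contra h
      have h0 : (S.card : ZMod 2) = 0 := (ZMod.natCast_eq_zero_iff _ 2).2 (by omega)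
      rw [h0] at hodd; exact absurd hodd (by decide)
    omega
  have hSJ : S ⊆ J := Finset.filter_subset _ _
  have hSat : ∀ e ∈ S, At p q b e := fun e he => (Finset.mem_filter.1 he).2
  set D := symmDiff J Q with hD
  have hSD : S ⊆ D := fun e he =>
    Finset.mem_symmDiff.2 (Or.inl ⟨hSJ he, hnoQ e (hSat e he)⟩)
  have hDE : D ⊆ E := symmDiff_subset_of_subset hJE hQE
  have hDb : bd p q D = pt x + pt b := by
    rw [hD, bd_symmDiff, hJ, hQ]
    have := add_self_fun T
    calc _ = pt x + pt b + (T + T) := by abel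
      _ = _ := by rw [this, add_zero]
  have hRb : bd p q (D \ S) = pt x + ∑ e ∈ S, pt (opp p q b e) := by
    rw [bd_sdiff hSD, hDb]
    have h1 : bd p q S = pt b + ∑ e ∈ S, pt (opp p q b e) := by
      rw [bd, Finset.sum_congr rfl (fun e he => pt_add_pt_of_at (hSat e he)),
        Finset.sum_add_distrib]
      congr 1
      rw [Finset.sum_const]
      funext v
      rw [Pi.smul_apply, nsmul_eq_mul, hodd, one_mul]
    rw [h1]
    have := add_self_fun (pt b)
    calc _ = pt x + (∑ e ∈ S, pt (opp p q b e)) + (pt b + pt b) := by abel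
      _ = _ := by rw [this, add_zero]
  obtain ⟨e₁, he₁, e₂, he₂, hne12, P, hP, hPb⟩ := exists_joined_pair hS2 hRb
  -- the closed edge set `C ⊆ J ∆ Q` turns `Q` into an equally short set that meets `b`
  set C := P ∪ {e₁, e₂} with hC
  have hdisj : Disjoint P {e₁, e₂} := by
    rw [Finset.disjoint_left]
    intro e heP he
    have h1 := (Finset.mem_sdiff.1 (hP heP)).2
    rcases Finset.mem_insert.1 he with rfl | h
    · exact h1 he₁
    · rw [Finset.mem_singleton.1 h] at h1; exact h1 he₂
  have hpair : bd p q {e₁, e₂} = pt (opp p q b e₁) + pt (opp p q b e₂) := by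
    rw [bd, Finset.sum_pair hne12, pt_add_pt_of_at (hSat _ he₁), pt_add_pt_of_at (hSat _ he₂)]
    have := add_self_fun (pt b)
    calc _ = pt (opp p q b e₁) + pt (opp p q b e₂) + (pt b + pt b) := by abel
      _ = _ := by rw [this, add_zero]
  have hCb : bd p q C = 0 := by
    rw [hC, bd, Finset.sum_union hdisj]
    change bd p q P + bd p q {e₁, e₂} = 0
    rw [hPb, hpair, add_self_fun]
  have hCD : C ⊆ D := by
    intro e he
    rcases Finset.mem_union.1 he with h | h
    · exact (Finset.mem_sdiff.1 (hP h)).1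
    · rcases Finset.mem_insert.1 h with rfl | h
      · exact hSD he₁
      · rw [Finset.mem_singleton.1 h]; exact hSD he₂
  have hw := hJmin C (hCD.trans hDE) hCb
  have hwQ : wt Q C = - wt J C := by
    unfold wt
    rw [← Finset.sum_neg_distrib]
    refine Finset.sum_congr rfl fun e he => ?_
    rcases Finset.mem_symmDiff.1 (hCD he) with h | h
    · simp [h.1, h.2]
    · simp [h.1, h.2]
  have hcard := card_symmDiff_eq Q C
  refine hno (symmDiff Q C) (symmDiff_subset_of_subset hQE (hCD.trans hDE))
    (by rw [bd_symmDiff_of_eq_zero hCb, hQ]) (by omega) e₁ (hSat _ he₁) ?_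
  refine Finset.mem_symmDiff.2 (Or.inr ⟨?_, hnoQ _ (hSat _ he₁)⟩)
  simp [hC]

open scoped Classical in
/-- The edges of `E` with exactly one end in `U`. -/
noncomputable def cut (p q : ε → V) (E : Finset ε) (U : V → Prop) : Finset ε :=
  E.filter (fun e => ¬ (U (p e) ↔ U (q e)))

/-- If `b` is as in `card_star_eq_one`, then a minimum edge set `J` with boundary `T` stays minimum
after contraction of the star of `b`: edge sets avoiding `b` whose boundary lives on the neighbours
of `b` have nonnegative weight. -/
lemma wt_nonneg_of_bd_neighbours {E : Finset ε} {κ : V → Bool} (hκ : ∀ e ∈ E, κ (p e) ≠ κ (q e))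
    {J : Finset ε} (hJE : J ⊆ E) (hJmin : ∀ C ⊆ E, bd p q C = 0 → 0 ≤ wt J C) {b : V}
    (hstar : ∀ J' ⊆ E, bd p q J' = bd p q J → J'.card ≤ J.card →
      (J'.filter (At p q b)).card = 1)
    (n : ℕ) : ∀ C ⊆ E, C.card ≤ n → (∀ e ∈ C, ¬ At p q b e) →
      (∀ v, bd p q C v = 1 → ∃ e ∈ E, At p q b e ∧ opp p q b e = v) → 0 ≤ wt J C := by
  obtain ⟨e₀, he₀⟩ := Finset.card_eq_one.1 (hstar J hJE rfl le_rfl)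
  have he₀' : e₀ ∈ J ∧ At p q b e₀ := by
    rw [← Finset.mem_filter, he₀]; simp
  have huniq : ∀ e ∈ J, At p q b e → e = e₀ := by
    intro e he hb
    have : e ∈ J.filter (At p q b) := Finset.mem_filter.2 ⟨he, hb⟩
    rw [he₀] at this; exact Finset.mem_singleton.1 this
  induction n with
  | zero =>
    intro C _ hc _ _
    rw [Finset.card_eq_zero.1 (Nat.le_zero.1 hc)]; simp [wt]
  | succ n ih =>
    intro C hCE hc hCb hsupp
    by_cases hz : bd p q C = 0
    · exact hJmin C hCE hz
    obtain ⟨u, hu⟩ : ∃ u, bd p q C u = 1 := by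
      by_contra h
      push Not at h
      exact hz (funext fun v => (zmod2_cases _).resolve_right (h v))
    obtain ⟨u', huu', hu', P, hPC, hPb⟩ := exists_pairing C u hu
    have hPne : P.Nonempty := by
      rw [Finset.nonempty_iff_ne_empty]
      rintro rfl
      have := congrFun hPb u
      rw [Pi.add_apply, pt_self, pt_ne huu'] at this
      simp at this
    have hrest : 0 ≤ wt J (C \ P) := by
      apply ih
      · exact Finset.sdiff_subset.trans hCE
      · have h1 := Finset.card_sdiff_add_card_eq_card hPC
        have h2 := hPne.card_pos
        omega
      · exact fun e he => hCb e (Finset.mem_sdiff.1 he).1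
      · intro v hv
        rw [bd_sdiff hPC, hPb, Pi.add_apply, Pi.add_apply] at hv
        by_cases h1 : u = v
        · exact h1 ▸ hsupp u hu
        by_cases h2 : u' = v
        · exact h2 ▸ hsupp u' hu'
        rw [pt_ne h1, pt_ne h2, add_zero, add_zero] at hv
        exact hsupp v hv
    rw [← wt_sdiff_add hPC]
    -- it remains to treat the single path `P`, closed up by two edges at `b`
    suffices h : 0 ≤ wt J P by omega
    have hchoose : ∀ w, bd p q C w = 1 → ∃ e ∈ E, At p q b e ∧ opp p q b e = w ∧
        (w = opp p q b e₀ → e = e₀) ∧ (w ≠ opp p q b e₀ → e ∉ J) := by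
      intro w hw
      by_cases h : w = opp p q b e₀
      · exact ⟨e₀, hJE he₀'.1, he₀'.2, h.symm, fun _ => rfl, fun h' => absurd h h'⟩
      · obtain ⟨e, he, hb, ho⟩ := hsupp w hw
        refine ⟨e, he, hb, ho, fun h' => absurd h' h, fun _ heJ => ?_⟩
        apply h
        rw [← ho, huniq e heJ hb]
    obtain ⟨e₁, he₁E, he₁b, he₁o, he₁0, he₁J⟩ := hchoose u hu
    obtain ⟨e₂, he₂E, he₂b, he₂o, he₂0, he₂J⟩ := hchoose u' hu'
    have hne : e₁ ≠ e₂ := by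
      rintro rfl
      exact huu' (he₂o.symm.trans he₁o)
    have hdisj : Disjoint P {e₁, e₂} := by
      rw [Finset.disjoint_left]
      intro e heP he
      rcases Finset.mem_insert.1 he with rfl | h
      · exact hCb _ (hPC heP) he₁b
      · rw [Finset.mem_singleton.1 h] at heP; exact hCb _ (hPC heP) he₂b
    have hpair : bd p q {e₁, e₂} = pt u + pt u' := by
      rw [bd, Finset.sum_pair hne, pt_add_pt_of_at he₁b, pt_add_pt_of_at he₂b, he₁o, he₂o]
      have := add_self_fun (pt b)
      calc _ = pt u + pt u' + (pt b + pt b) := by abel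
        _ = _ := by rw [this, add_zero]
    have hDb : bd p q (P ∪ {e₁, e₂}) = 0 := by
      rw [bd, Finset.sum_union hdisj]
      change bd p q P + bd p q {e₁, e₂} = 0
      rw [hPb, hpair, add_self_fun]
    have hDE : P ∪ {e₁, e₂} ⊆ E := by
      intro e he
      rcases Finset.mem_union.1 he with h | h
      · exact hCE (hPC h)
      · rcases Finset.mem_insert.1 h with rfl | h
        · exact he₁E
        · rw [Finset.mem_singleton.1 h]; exact he₂E
    have hD0 := hJmin _ hDE hDb
    have hw : wt J (P ∪ {e₁, e₂}) = wt J P + wt J {e₁, e₂} := wt_union hdisj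
    rw [wt_pair hne] at hw
    by_cases h1 : u = opp p q b e₀
    · have h2 : e₂ ∉ J := he₂J (fun h => huu' (h.trans h1.symm))
      rw [if_pos (he₁0 h1 ▸ he₀'.1), if_neg h2] at hw
      omega
    by_cases h2 : u' = opp p q b e₀
    · rw [if_neg (he₁J h1), if_pos (he₂0 h2 ▸ he₀'.1)] at hw
      omega
    rw [if_neg (he₁J h1), if_neg (he₂J h2)] at hw
    have hpar := even_card_of_bd_eq_zero κ (fun e he => hκ e (hDE he)) hDb
    rw [← wt_emod_two J] at hpar
    by_contra hneg
    have hzero : wt J (P ∪ {e₁, e₂}) = 0 := by omega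
    -- otherwise swapping along this closed set gives a minimum set with three edges at `b`
    have hcard := card_symmDiff_eq J (P ∪ {e₁, e₂})
    have h3 := hstar (symmDiff J (P ∪ {e₁, e₂})) (symmDiff_subset_of_subset hJE hDE)
      (bd_symmDiff_of_eq_zero hDb) (by omega)
    obtain ⟨f, hf⟩ := Finset.card_eq_one.1 h3
    have hm1 : e₁ ∈ (symmDiff J (P ∪ {e₁, e₂})).filter (At p q b) :=
      Finset.mem_filter.2 ⟨Finset.mem_symmDiff.2 (Or.inr ⟨by simp, he₁J h1⟩), he₁b⟩
    have hm2 : e₂ ∈ (symmDiff J (P ∪ {e₁, e₂})).filter (At p q b) :=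
      Finset.mem_filter.2 ⟨Finset.mem_symmDiff.2 (Or.inr ⟨by simp, he₂J h2⟩), he₂b⟩
    rw [hf, Finset.mem_singleton] at hm1 hm2
    exact hne (hm1.trans hm2.symm)

end Minimum

end TJoin

namespace TJoin

/-! ### Minimum edge sets are small -/

section Bound

open scoped Classical in
/-- In a bipartite multigraph, with colour classes given by `κ`, a minimum edge set with its boundary
has at most a third of the edges, if every cut meeting it oddly has at least three edges. The
induction contracts the star of a vertex as in `card_star_eq_one`; the hypothesis on cuts passes to
the quotient, because its cuts are cuts of the original multigraph. -/
lemma three_mul_card_le_of_bipartite {V ε : Type*} [DecidableEq V] [DecidableEq ε] (κ : V → Bool)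
    (n : ℕ) :
    ∀ (p q : ε → V) (E : Finset ε), E.card ≤ n → (∀ e ∈ E, κ (p e) ≠ κ (q e)) →
    ∀ J ⊆ E, (∀ C ⊆ E, bd p q C = 0 → 0 ≤ wt J C) →
    (∀ U : V → Prop, Odd (cut p q J U).card → 3 ≤ (cut p q E U).card) →
    3 * J.card ≤ E.card := by
  induction n with
  | zero =>
    intro p q E hE _ J hJE _ _
    have := Finset.card_le_card hJE
    omega
  | succ n ih =>
    intro p q E hE hκ J hJE hJmin hcut
    rcases J.eq_empty_or_nonempty with rfl | ⟨j, hj⟩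
    · simp
    have hl : ∀ e ∈ E, p e ≠ q e := fun e he h => hκ e he (by rw [h])
    set T := bd p q J with hT
    set x := p j with hx
    -- choose `b` and `Q` with boundary `T + x + b` so that `Q` is as small as possible
    have hex : ∃ m, ∃ Q ⊆ E, ∃ b, bd p q Q = T + pt x + pt b ∧ Q.card = m := by
      refine ⟨_, J, hJE, x, ?_, rfl⟩
      rw [add_assoc, add_self_fun, add_zero]
    obtain ⟨Q, hQE, b, hQ, hQc⟩ := Nat.find_spec hex
    have hQmin : ∀ Q' ⊆ E, ∀ b', bd p q Q' = T + pt x + pt b' → Q.card ≤ Q'.card := by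
      intro Q' hQ' b' hb'
      rw [hQc]
      exact Nat.find_min' hex ⟨Q', hQ', b', hb', rfl⟩
    have hJcard : ∀ J' ⊆ E, bd p q J' = T → J.card ≤ J'.card := by
      intro J' hJ' hb
      have h1 := hJmin (symmDiff J J') (symmDiff_subset_of_subset hJE hJ')
        (by rw [bd_symmDiff, hb, ← hT, add_self_fun])
      have h2 := card_symmDiff_eq J (symmDiff J J')
      rw [symmDiff_symmDiff_cancel_left] at h2
      omega
    have hQJ : Q.card < J.card := by
      have h1 := hQmin (J \ {j}) (Finset.sdiff_subset.trans hJE) (q j) (by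
        rw [bd_sdiff (by simpa using hj), bd_singleton, ← hT, add_assoc])
      have h2 : (J \ {j}).card < J.card := by
        apply Finset.card_lt_card
        refine ⟨Finset.sdiff_subset, fun h => ?_⟩
        have := h hj
        simp at this
      omega
    have hxb : x ≠ b := by
      rintro rfl
      rw [add_assoc, add_self_fun, add_zero] at hQ
      have := hJcard Q hQE hQ
      omega
    have hstar : ∀ J' ⊆ E, bd p q J' = bd p q J → J'.card ≤ J.card →
        (J'.filter (At p q b)).card = 1 ∧ T b = 1 := by
      intro J' hJ' hb hc
      refine card_star_eq_one hl hxb hQE hQ hQmin hJ' hb ?_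
      intro C hC hC0
      have h1 := hJcard (symmDiff J' C) (symmDiff_subset_of_subset hJ' hC)
        (by rw [bd_symmDiff_of_eq_zero hC0, hb])
      have h2 := card_symmDiff_eq J' C
      omega
    obtain ⟨e₀, he₀⟩ := Finset.card_eq_one.1 (hstar J hJE rfl le_rfl).1
    have he₀' : e₀ ∈ J ∧ At p q b e₀ := by
      rw [← Finset.mem_filter, he₀]; simp
    -- contract the star of `b`
    set c := opp p q b e₀ with hc
    set g : V → V := fun v => if v = b ∨ ∃ e ∈ E, At p q b e ∧ opp p q b e = v then c else v with hg
    set S := E.filter (At p q b) with hS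
    set E' := E \ S with hE'
    have hE'sub : E' ⊆ E := Finset.sdiff_subset
    have hE'b : ∀ e ∈ E', ¬ At p q b e := by
      intro e he hb
      have := (Finset.mem_sdiff.1 he)
      exact this.2 (Finset.mem_filter.2 ⟨this.1, hb⟩)
    have hcolor : ∀ e ∈ E, At p q b e → κ (opp p q b e) = !κ b := by
      intro e he hb
      have h1 := hκ e he
      unfold opp
      split_ifs with h
      · rw [h] at h1
        exact Bool.eq_not_of_ne h1.symm
      · rcases hb with hb | hb
        · exact absurd hb h
        · rw [hb] at h1; exact Bool.eq_not_of_ne h1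
    have hκg : ∀ v, v ≠ b → κ (g v) = κ v := by
      intro v hv
      simp only [hg]
      split_ifs with h
      · rcases h with h | ⟨e, he, hb, rfl⟩
        · exact absurd h hv
        · rw [hcolor e he hb, hc, hcolor e₀ (hJE he₀'.1) he₀'.2]
      · rfl
    have hJ'sub : J \ S ⊆ E' := Finset.sdiff_subset_sdiff hJE le_rfl
    have hJS : J \ S = J \ {e₀} := by
      rw [← he₀]
      ext e
      simp only [Finset.mem_sdiff, Finset.mem_filter, hS]
      constructor
      · rintro ⟨h1, h2⟩; exact ⟨h1, fun h => h2 ⟨hJE h.1, h.2⟩⟩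
      · rintro ⟨h1, h2⟩; exact ⟨h1, fun h => h2 ⟨h1, h.2⟩⟩
    have hcards : (J \ S).card + 1 = J.card := by
      rw [hJS, Finset.card_sdiff_of_subset (by simpa using he₀'.1), Finset.card_singleton]
      have := Finset.card_pos.2 ⟨_, hj⟩
      omega
    have hcutS : ∀ F ⊆ E, cut p q F (fun v => v = b) = F.filter (At p q b) := by
      intro F hF
      ext e
      simp only [cut, Finset.mem_filter]
      refine and_congr_right fun he => ?_
      have := hl e (hF he)
      unfold At
      by_cases h1 : p e = b <;> by_cases h2 : q e = b <;> simp [h1, h2]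
      exact this (h1.trans h2.symm)
    have hS3 : 3 ≤ S.card := by
      rw [hS, ← hcutS E subset_rfl]
      apply hcut
      rw [hcutS J hJE, he₀]
      simp
    have hE'card : E'.card + S.card = E.card :=
      Finset.card_sdiff_add_card_eq_card (Finset.filter_subset _ _)
    have hmain := ih (fun e => g (p e)) (fun e => g (q e)) E' (by omega) ?_ (J \ S) hJ'sub ?_ ?_
    · omega
    · intro e he
      have h1 := hE'b e he
      unfold At at h1
      push Not at h1
      show κ (g (p e)) ≠ κ (g (q e))
      rw [hκg _ h1.1, hκg _ h1.2]
      exact hκ e (hE'sub he)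
    · intro C hC hC0
      have hCb : ∀ e ∈ C, ¬ At p q b e := fun e he => hE'b e (hC he)
      have hwt : wt (J \ S) C = wt J C := by
        unfold wt
        refine Finset.sum_congr rfl fun e he => ?_
        have : e ∈ J \ S ↔ e ∈ J := by
          simp only [Finset.mem_sdiff, and_iff_left_iff_imp]
          intro _
          exact (Finset.mem_sdiff.1 (hC he)).2
        rw [if_congr this rfl rfl]
      rw [hwt]
      refine wt_nonneg_of_bd_neighbours hκ hJE hJmin (fun J' h1 h2 h3 => (hstar J' h1 h2 h3).1)
        C.card C (hC.trans hE'sub) le_rfl hCb ?_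
      intro v hv
      by_contra hcon
      by_cases hvb : v = b
      · subst hvb
        rw [bd_apply_loopless (fun e he => hl e (hE'sub (hC he))),
          Finset.filter_false_of_mem hCb] at hv
        simp at hv
      -- vertices outside the contracted star keep their degrees
      have h1 := congrFun hC0 v
      rw [bd_apply] at h1 hv
      have h2 : ∀ w, (g w = v ↔ w = v) := by
        intro w
        simp only [hg]
        split_ifs with h
        · constructor
          · rintro rfl
            exact absurd ⟨e₀, hJE he₀'.1, he₀'.2, rfl⟩ hcon
          · rintro rfl
            rcases h with h | h
            · exact absurd h hvb
            · exact absurd h hcon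
        · rfl
      simp only [h2] at h1
      rw [hv] at h1
      exact one_ne_zero h1
    · intro U hU
      have hgb : g b = c := by simp [hg]
      have hgo : ∀ e ∈ E, At p q b e → g (opp p q b e) = c := by
        intro e he hb
        simp only [hg]
        rw [if_pos (Or.inr ⟨e, he, hb, rfl⟩)]
      have hgS : ∀ e ∈ E, At p q b e → g (p e) = c ∧ g (q e) = c := by
        intro e he hb
        have h1 := hgo e he hb
        unfold opp at h1
        split_ifs at h1 with h
        · exact ⟨by rw [h, hgb], h1⟩
        · rcases hb with hb | hb
          · exact absurd hb h
          · exact ⟨h1, by rw [hb, hgb]⟩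
      have hcuteq : ∀ F ⊆ E, cut p q F (fun v => U (g v)) =
          cut (fun e => g (p e)) (fun e => g (q e)) (F \ S) U := by
        intro F hF
        ext e
        simp only [cut, Finset.mem_filter, Finset.mem_sdiff, hS]
        constructor
        · rintro ⟨h1, h2⟩
          refine ⟨⟨h1, fun h3 => h2 ?_⟩, h2⟩
          have := hgS e h3.1 h3.2
          rw [this.1, this.2]
        · rintro ⟨⟨h1, _⟩, h2⟩; exact ⟨h1, h2⟩
      rw [← hcuteq E subset_rfl]
      apply hcut
      rw [hcuteq J hJE]
      exact hU

open scoped Classical in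
/-- A minimum edge set with its boundary has at most a third of the edges, if every cut meeting it
oddly has at least three edges. Subdividing all edges reduces this to the bipartite case. -/
theorem three_mul_card_le {V ε : Type*} [DecidableEq V] [DecidableEq ε] (p q : ε → V)
    (E J : Finset ε) (hJE : J ⊆ E)
    (hJmin : ∀ J' ⊆ E, bd p q J' = bd p q J → J.card ≤ J'.card)
    (hcut : ∀ U : V → Prop, Odd (cut p q J U).card → 3 ≤ (cut p q E U).card) :
    3 * J.card ≤ E.card := by
  let P : ε × Bool → V ⊕ ε := fun a => if a.2 then Sum.inl (p a.1) else Sum.inl (q a.1)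
  let M : ε × Bool → V ⊕ ε := fun a => Sum.inr a.1
  let κ : V ⊕ ε → Bool := Sum.isLeft
  let dbl : Finset ε → Finset (ε × Bool) := fun F => F ×ˢ Finset.univ
  have hcard : ∀ F, (dbl F).card = 2 * F.card := by
    intro F; simp [dbl, Finset.card_product, mul_comm]
  have hbdl : ∀ F v, bd P M (dbl F) (Sum.inl v) = bd p q F v := by
    intro F v
    rw [bd_apply, bd_apply, Finset.sum_product]
    refine Finset.sum_congr rfl fun e _ => ?_
    rw [Fintype.sum_bool]
    simp [P, M]
  have hbdr : ∀ F e, bd P M F (Sum.inr e) =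
      (if (e, true) ∈ F then 1 else 0) + (if (e, false) ∈ F then 1 else 0) := by
    intro F e
    rw [bd_apply]
    have h1 : ∀ a ∈ F, ((if P a = Sum.inr e then (1 : ZMod 2) else 0) +
        if M a = Sum.inr e then 1 else 0) =
        (if (e, true) = a then 1 else 0) + (if (e, false) = a then 1 else 0) := by
      rintro ⟨e', s⟩ _
      have hP : P (e', s) ≠ Sum.inr e := by simp only [P]; split_ifs <;> simp
      rw [if_neg hP]
      by_cases h : e' = e
      · subst h; cases s <;> simp [M]
      · have h' : ¬ e = e' := fun h'' => h h''.symm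
        simp [M, h, h']
    rw [Finset.sum_congr rfl h1, Finset.sum_add_distrib, Finset.sum_ite_eq, Finset.sum_ite_eq]
  have hsub : dbl J ⊆ dbl E := Finset.product_subset_product hJE le_rfl
  have hdblmem : ∀ F (a : ε × Bool), a ∈ dbl F ↔ a.1 ∈ F := by
    intro F a; simp [dbl]
  -- a set of half-edges with the boundary of a set of full edges consists of full edges
  have hfull : ∀ K ⊆ dbl E, (∀ e, bd P M K (Sum.inr e) = 0) → ∃ F ⊆ E, K = dbl F := by
    intro K hK hb
    refine ⟨E.filter (fun e => (e, true) ∈ K), Finset.filter_subset _ _, ?_⟩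
    have h1 : ∀ e, ((e, true) ∈ K ↔ (e, false) ∈ K) := by
      intro e
      have h2 := hb e
      rw [hbdr] at h2
      by_cases ht : (e, true) ∈ K <;> by_cases hf : (e, false) ∈ K <;> simp [ht, hf] at h2 ⊢
    ext ⟨e, s⟩
    rw [hdblmem, Finset.mem_filter]
    constructor
    · intro h
      refine ⟨(hdblmem _ _).1 (hK h), ?_⟩
      cases s
      · exact (h1 e).2 h
      · exact h
    · rintro ⟨_, h⟩
      cases s
      · exact (h1 e).1 h
      · exact h
  have hres := three_mul_card_le_of_bipartite κ _ P M (dbl E) le_rfl ?_ (dbl J) hsub ?_ ?_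
  · rw [hcard, hcard] at hres; omega
  · rintro ⟨e, s⟩ _
    cases s <;> simp [κ, P, M]
  · intro C hC hC0
    obtain ⟨F, hF, rfl⟩ := hfull C hC (fun e => by rw [hC0]; rfl)
    have hF0 : bd p q F = 0 := by
      funext v; rw [← hbdl, hC0]; rfl
    have h1 := hJmin (symmDiff J F) (symmDiff_subset_of_subset hJE hF) (bd_symmDiff_of_eq_zero hF0)
    have h2 := card_symmDiff_eq (dbl J) (dbl F)
    have h3 : symmDiff (dbl J) (dbl F) = dbl (symmDiff J F) := by
      ext a; simp only [Finset.mem_symmDiff, hdblmem]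
    rw [h3, hcard, hcard] at h2
    push_cast at h2
    omega
  · intro U hU
    -- each edge of a cut contributes exactly one half-edge, other edges none or both
    have hcnt : ∀ F : Finset ε, (cut P M (dbl F) U).card =
        ∑ e ∈ F, ((if (U (Sum.inl (p e)) ↔ U (Sum.inr e)) then 0 else 1) +
          (if (U (Sum.inl (q e)) ↔ U (Sum.inr e)) then 0 else 1)) := by
      intro F
      rw [cut, Finset.card_filter, Finset.sum_product]
      refine Finset.sum_congr rfl fun e _ => ?_
      simp [P, M]
    have hcnt' : ∀ F : Finset ε, (cut p q F (fun v => U (Sum.inl v))).card =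
        ∑ e ∈ F, (if (U (Sum.inl (p e)) ↔ U (Sum.inl (q e))) then 0 else 1) := by
      intro F
      rw [cut, Finset.card_filter]
      refine Finset.sum_congr rfl fun e _ => ?_
      simp
    have hle : ∀ F : Finset ε, (cut p q F (fun v => U (Sum.inl v))).card ≤
        (cut P M (dbl F) U).card := by
      intro F
      rw [hcnt, hcnt']
      refine Finset.sum_le_sum fun e _ => ?_
      by_cases h1 : U (Sum.inl (p e)) <;> by_cases h2 : U (Sum.inl (q e)) <;>
        by_cases h3 : U (Sum.inr e) <;> simp [h1, h2, h3]
    have hpar : ∀ F : Finset ε, (cut P M (dbl F) U).card ≡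
        (cut p q F (fun v => U (Sum.inl v))).card [MOD 2] := by
      intro F
      rw [hcnt, hcnt']
      induction F using Finset.induction_on with
      | empty => rfl
      | insert e F he ih =>
        rw [Finset.sum_insert he, Finset.sum_insert he]
        refine Nat.ModEq.add ?_ ih
        by_cases h1 : U (Sum.inl (p e)) <;> by_cases h2 : U (Sum.inl (q e)) <;>
          by_cases h3 : U (Sum.inr e) <;> simp [h1, h2, h3, Nat.ModEq]
    refine le_trans (hcut _ ?_) (hle E)
    have := hpar J
    rw [Nat.odd_iff] at hU ⊢
    unfold Nat.ModEq at this
    omega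

end Bound

end TJoin

namespace TJoin

/-! ### Cuts, degrees and parity -/

section CutParity

variable {V ε : Type*} [DecidableEq V] [DecidableEq ε] {p q : ε → V}

/-- The number of edges of `Q` leaving `W` has the parity of the number of vertices of `W` with odd
degree in `Q`. -/
lemma card_cut_cast (Q : Finset ε) (W : V → Prop) [DecidablePred W] (U : Finset V)
    (hU : ∀ e ∈ Q, p e ∈ U ∧ q e ∈ U) :
    ((cut p q Q W).card : ZMod 2) = ∑ v ∈ U.filter W, bd p q Q v := by
  rw [sum_bd, cut, Finset.card_filter, Nat.cast_sum]
  refine Finset.sum_congr rfl fun e he => ?_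
  have := hU e he
  by_cases h1 : W (p e) <;> by_cases h2 : W (q e) <;> simp [h1, h2, this]
  exact (CharTwo.add_self_eq_zero (1 : ZMod 2)).symm

lemma even_card_cut {Q : Finset ε} (hQ : bd p q Q = 0) (W : V → Prop) :
    Even (cut p q Q W).card := by
  classical
  have h := card_cut_cast (p := p) (q := q) Q W (Q.image p ∪ Q.image q) (fun e he =>
    ⟨Finset.mem_union_left _ (Finset.mem_image_of_mem _ he),
      Finset.mem_union_right _ (Finset.mem_image_of_mem _ he)⟩)
  rw [hQ] at h
  simp only [Pi.zero_apply, Finset.sum_const_zero] at h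
  exact even_iff_two_dvd.2 ((ZMod.natCast_eq_zero_iff _ 2).1 h)

lemma sum_pt (U : Finset V) (x : V) : ∑ v ∈ U, pt x v = if x ∈ U then 1 else 0 := by
  simp [pt]

lemma cut_eq_empty_of_closed {Q : Finset ε} {W : V → Prop} (h : ∀ e ∈ Q, (W (p e) ↔ W (q e))) :
    cut p q Q W = ∅ := by
  classical
  rw [cut, Finset.filter_eq_empty_iff]
  intro e he hn; exact hn (h e he)

/-- A vertex set closed under the edges of `P` contains both or neither of the vertices `x`, `y`
if `P` has boundary `x + y`. -/
lemma mem_iff_of_closed {P : Finset ε} {x y : V} (hP : bd p q P = pt x + pt y) {W : V → Prop}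
    (h : ∀ e ∈ P, (W (p e) ↔ W (q e))) : W x ↔ W y := by
  classical
  have h1 := card_cut_cast (p := p) (q := q) P W (P.image p ∪ P.image q ∪ {x, y}) (fun e he =>
    ⟨Finset.mem_union_left _ (Finset.mem_union_left _ (Finset.mem_image_of_mem _ he)),
      Finset.mem_union_left _ (Finset.mem_union_right _ (Finset.mem_image_of_mem _ he))⟩)
  rw [cut_eq_empty_of_closed h, hP] at h1
  simp only [Pi.add_apply, Finset.sum_add_distrib, sum_pt] at h1
  by_cases hx : W x <;> by_cases hy : W y <;> simp [hx, hy] at h1 ⊢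

/-- If every edge of `E` lies in a closed edge set, then a maximum closed subset of `E` has at
least two thirds of the edges. -/
theorem two_mul_card_le {E M : Finset ε} (hbr : ∀ e ∈ E, ∃ C ⊆ E, bd p q C = 0 ∧ e ∈ C)
    (hME : M ⊆ E) (hM : bd p q M = 0) (hmax : ∀ C ⊆ E, bd p q C = 0 → C.card ≤ M.card) :
    2 * E.card ≤ 3 * M.card := by
  classical
  have hJ : bd p q (E \ M) = bd p q E := by rw [bd_sdiff hME, hM, add_zero]
  have hc := Finset.card_sdiff_add_card_eq_card hME
  have h := three_mul_card_le p q E (E \ M) Finset.sdiff_subset ?_ ?_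
  · omega
  · intro J' hJ' hb
    have h1 := hmax (E \ J') Finset.sdiff_subset (by
      rw [bd_sdiff hJ', hb, hJ, add_self_fun])
    have h2 := Finset.card_sdiff_add_card_eq_card hJ'
    omega
  · intro U hU
    have hsplit : (cut p q E U).card = (cut p q (E \ M) U).card + (cut p q M U).card := by
      unfold cut
      rw [← Finset.card_union_of_disjoint, ← Finset.filter_union,
        Finset.sdiff_union_of_subset hME]
      exact Finset.disjoint_filter_filter Finset.sdiff_disjoint
    have hodd : Odd (cut p q E U).card := by
      rw [hsplit]; exact hU.add_even (even_card_cut hM U)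
    by_contra hlt
    have h1 : (cut p q E U).card = 1 := by
      rcases hodd with ⟨k, hk⟩; omega
    obtain ⟨e, he⟩ := Finset.card_eq_one.1 h1
    have he' : e ∈ cut p q E U := by rw [he]; simp
    obtain ⟨C, hCE, hC0, heC⟩ := hbr e (Finset.mem_filter.1 he').1
    have h2 : cut p q C U = {e} := by
      apply Finset.Subset.antisymm
      · rw [← he]; exact Finset.filter_subset_filter _ hCE
      · rw [Finset.singleton_subset_iff]
        exact Finset.mem_filter.2 ⟨heC, (Finset.mem_filter.1 he').2⟩
    have h3 := even_card_cut (p := p) (q := q) hC0 U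
    rw [h2] at h3
    simp at h3

/-- The number of ends at `v` of edges of `Q`. -/
def dgr (p q : ε → V) (Q : Finset ε) (v : V) : ℕ :=
  ∑ e ∈ Q, ((if p e = v then 1 else 0) + (if q e = v then 1 else 0))

lemma bd_eq_dgr (Q : Finset ε) (v : V) : bd p q Q v = (dgr p q Q v : ZMod 2) := by
  rw [bd_apply, dgr, Nat.cast_sum]
  refine Finset.sum_congr rfl fun e _ => ?_
  push_cast; rfl

lemma bd_eq_zero_iff {Q : Finset ε} : bd p q Q = 0 ↔ ∀ v, Even (dgr p q Q v) := by
  rw [funext_iff]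
  refine forall_congr' fun v => ?_
  rw [bd_eq_dgr, Pi.zero_apply, ZMod.natCast_eq_zero_iff, even_iff_two_dvd]

lemma dgr_mono {Q Q' : Finset ε} (h : Q ⊆ Q') (v : V) : dgr p q Q v ≤ dgr p q Q' v :=
  Finset.sum_le_sum_of_subset h

lemma sum_dgr (Q : Finset ε) (U : Finset V) (hU : ∀ e ∈ Q, p e ∈ U ∧ q e ∈ U) :
    ∑ v ∈ U, dgr p q Q v = 2 * Q.card := by
  unfold dgr
  rw [Finset.sum_comm, Finset.card_eq_sum_ones, Finset.mul_sum]
  refine Finset.sum_congr rfl fun e he => ?_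
  rw [Finset.sum_add_distrib]
  simp [hU e he]

lemma dgr_pos {Q : Finset ε} {e : ε} (he : e ∈ Q) {v : V} (h : p e = v ∨ q e = v) :
    0 < dgr p q Q v := by
  unfold dgr
  refine Finset.sum_pos' (fun _ _ => Nat.zero_le _) ⟨e, he, ?_⟩
  rcases h with h | h <;> simp [h]

lemma dgr_eq_zero {Q : Finset ε} {v : V} (h : ∀ e ∈ Q, p e ≠ v ∧ q e ≠ v) : dgr p q Q v = 0 := by
  unfold dgr
  exact Finset.sum_eq_zero fun e he => by simp [h e he]

end CutParity

end TJoin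

namespace Graph

/-! ### Multigraphs and their edge sets -/

open TJoin

variable {α β : Type*}

/-- `p` and `q` name the two ends of every edge of `G`. -/
def Ends (G : Graph α β) (p q : β → α) : Prop := ∀ e ∈ E(G), G.IsLink e (p e) (q e)

lemma exists_ends [Nonempty α] (G : Graph α β) : ∃ p q : β → α, G.Ends p q := by
  classical
  have h : ∀ e, ∃ x y, e ∈ E(G) → G.IsLink e x y := by
    intro e
    by_cases he : e ∈ E(G)
    · obtain ⟨x, y, h⟩ := exists_isLink_of_mem_edgeSet he
      exact ⟨x, y, fun _ => h⟩
    · exact ⟨Classical.arbitrary α, Classical.arbitrary α, fun h => absurd h he⟩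
  choose p q h using h
  exact ⟨p, q, h⟩

variable {G K : Graph α β} {p q : β → α}

lemma Ends.mono (h : G.Ends p q) (hK : K ≤ G) : K.Ends p q := fun e he =>
  (hK.isLink_iff he).2 (h e (hK.edgeSet_mono he))

lemma Ends.isLink_iff (h : G.Ends p q) {e : β} {x y : α} :
    G.IsLink e x y ↔ e ∈ E(G) ∧ ((p e = x ∧ q e = y) ∨ (p e = y ∧ q e = x)) := by
  constructor
  · intro hl
    have he := hl.edge_mem
    refine ⟨he, ?_⟩
    rcases (h e he).eq_and_eq_or_eq_and_eq hl with h' | h'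
    · exact Or.inl h'
    · exact Or.inr h'
  · rintro ⟨he, ⟨rfl, rfl⟩ | ⟨rfl, rfl⟩⟩
    · exact h e he
    · exact (h e he).symm

variable [DecidableEq α] [DecidableEq β]

lemma Ends.deg_eq (h : G.Ends p q) {Q : Finset β} (hQ : E(G) = ↑Q) (v : α) :
    G.deg v = dgr p q Q v := by
  have h1 : {e | G.IsNonloopAt e v} =
      ↑(Q.filter fun e => p e ≠ q e ∧ (p e = v ∨ q e = v)) := by
    ext e
    simp only [Set.mem_ofPred_eq, Finset.coe_filter, IsNonloopAt, h.isLink_iff, hQ, Finset.mem_coe]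
    constructor
    · rintro ⟨y, hy, he, ⟨h1, h2⟩ | ⟨h1, h2⟩⟩
      · exact ⟨he, by rw [h1, h2]; exact hy.symm, Or.inl h1⟩
      · exact ⟨he, by rw [h1, h2]; exact hy, Or.inr h2⟩
    · rintro ⟨he, hne, h1 | h1⟩
      · exact ⟨q e, by rw [← h1]; exact hne.symm, he, Or.inl ⟨h1, rfl⟩⟩
      · exact ⟨p e, by rw [← h1]; exact hne, he, Or.inr ⟨rfl, h1⟩⟩
  have h2 : {e | G.IsLoopAt e v} = ↑(Q.filter fun e => p e = v ∧ q e = v) := by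
    ext e
    simp only [Set.mem_ofPred_eq, Finset.coe_filter, IsLoopAt, h.isLink_iff, hQ, Finset.mem_coe]
    tauto
  rw [deg, h1, h2, Set.ncard_coe_finset, Set.ncard_coe_finset, Finset.card_filter,
    Finset.card_filter, Finset.mul_sum, ← Finset.sum_add_distrib, dgr]
  refine Finset.sum_congr rfl fun e _ => ?_
  by_cases h3 : p e = v <;> by_cases h4 : q e = v <;> simp [h3, h4]
  exact fun h => h4 h.symm

/-- The vertex count of a `2`-regular subgraph is the size of its edge set, which has no
boundary. -/
lemma Ends.even_of_isRegular_two (h : K.Ends p q) {Q : Finset β} (hQ : E(K) = ↑Q)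
    (hV : V(K).Finite) (hreg : K.IsRegular 2) : bd p q Q = 0 ∧ V(K).ncard = Q.card := by
  have hmem : ∀ e ∈ Q, p e ∈ V(K) ∧ q e ∈ V(K) := fun e he => by
    have := h e (by rw [hQ]; exact he)
    exact ⟨this.left_mem, this.right_mem⟩
  constructor
  · rw [bd_eq_zero_iff]
    intro v
    by_cases hv : v ∈ V(K)
    · rw [← h.deg_eq hQ, hreg v hv]; exact even_two
    · rw [dgr_eq_zero]
      · exact Even.zero
      · intro e he
        exact ⟨fun h' => hv (h' ▸ (hmem e he).1), fun h' => hv (h' ▸ (hmem e he).2)⟩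
  · have h1 := sum_dgr (p := p) (q := q) Q hV.toFinset (by simpa using hmem)
    rw [Finset.sum_congr rfl (g := fun _ => 2)] at h1
    · rw [Finset.sum_const, smul_eq_mul, ← Set.ncard_eq_toFinset_card _ hV] at h1
      omega
    · intro v hv
      rw [← h.deg_eq hQ]; exact hreg v (by simpa using hv)

/-- In a subcubic multigraph, an edge set without boundary is the edge set of a `2`-regular
subgraph. -/
lemma Ends.exists_isRegular_two (h : G.Ends p q) {E Q : Finset β} (hE : E(G) = ↑E)
    (hG : G.IsSubcubic) (hQE : Q ⊆ E) (hQ : bd p q Q = 0) :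
    ∃ K ≤ G, K.IsRegular 2 ∧ V(K).ncard = Q.card := by
  set X : Set α := {v | ∃ e ∈ Q, G.Inc e v} with hX
  set K := (G.restrict ↑Q).induce X with hK
  have hKG : K ≤ G := by
    refine le_trans (induce_le ?_) (restrict_le (E₀ := (↑Q : Set β)))
    rintro v ⟨e, he, hi⟩
    exact hi.vertex_mem
  have hEK : E(K) = ↑Q := by
    ext e
    simp only [hK, edgeSet_induce, Set.mem_ofPred_eq, Finset.mem_coe]
    constructor
    · rintro ⟨x, y, hl, _⟩
      exact (by simpa [restrict] using hl : e ∈ Q ∧ G.IsLink e x y).1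
    · intro he
      have hl := h e (by rw [hE]; exact hQE he)
      exact ⟨p e, q e, by simpa [restrict] using And.intro he hl,
        ⟨e, he, hl.inc_left⟩, ⟨e, he, hl.inc_right⟩⟩
  have hends : K.Ends p q := h.mono hKG
  have hreg : K.IsRegular 2 := by
    intro v hv
    obtain ⟨e, he, hi⟩ : v ∈ X := hv
    have h1 : K.deg v = dgr p q Q v := hends.deg_eq hEK v
    have h2 : dgr p q Q v ≤ 3 := by
      refine (dgr_mono hQE v).trans ?_
      rw [← h.deg_eq hE]; exact hG v hi.vertex_mem
    have h3 := bd_eq_zero_iff.1 hQ v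
    obtain ⟨y, hl⟩ := hi
    have h4 : 0 < dgr p q Q v := dgr_pos he (by
      rcases (h.isLink_iff.1 hl).2 with h' | h'
      · exact Or.inl h'.1
      · exact Or.inr h'.2)
    rw [h1]
    rcases h3 with ⟨k, hk⟩
    omega
  refine ⟨K, hKG, hreg, ?_⟩
  refine (hends.even_of_isRegular_two hEK ?_ hreg).2
  refine Set.Finite.subset ((Q.image p ∪ Q.image q).finite_toSet) ?_
  rintro v ⟨e, he, y, hl⟩
  rcases (h.isLink_iff.1 hl).2 with h' | h'
  · simp only [Finset.coe_union, Set.mem_union, Finset.coe_image, Set.mem_image]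
    exact Or.inl ⟨e, he, h'.1⟩
  · simp only [Finset.coe_union, Set.mem_union, Finset.coe_image, Set.mem_image]
    exact Or.inr ⟨e, he, h'.2⟩

lemma bddAbove_isRegular_two (hV : V(G).Finite) :
    BddAbove {k | ∃ K : Graph α β, K ≤ G ∧ K.IsRegular 2 ∧ V(K).ncard = k} :=
  ⟨V(G).ncard, by
    rintro k ⟨K, hK, _, rfl⟩
    exact Set.ncard_le_ncard hK.vertexSet_mono hV⟩

/-- In a finite subcubic multigraph, `f₂` is the largest size of an edge set without boundary. -/
lemma Ends.f₂_spec (h : G.Ends p q) {E : Finset β} (hE : E(G) = ↑E) (hV : V(G).Finite)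
    (hG : G.IsSubcubic) :
    (∃ M ⊆ E, bd p q M = 0 ∧ M.card = G.f₂) ∧ ∀ Q ⊆ E, bd p q Q = 0 → Q.card ≤ G.f₂ := by
  constructor
  · have hne : {k | ∃ K : Graph α β, K ≤ G ∧ K.IsRegular 2 ∧ V(K).ncard = k}.Nonempty := by
      obtain ⟨K, h1, h2, h3⟩ := h.exists_isRegular_two hE hG (Finset.empty_subset E) bd_empty
      exact ⟨_, K, h1, h2, h3⟩
    obtain ⟨K, hKG, hreg, hc⟩ := Nat.sSup_mem hne (bddAbove_isRegular_two hV)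
    have hEK : E(K) ⊆ ↑E := by rw [← hE]; exact hKG.edgeSet_mono
    have hfin : E(K).Finite := E.finite_toSet.subset hEK
    have h1 := (h.mono hKG).even_of_isRegular_two (Q := hfin.toFinset) (by simp)
      (hV.subset hKG.vertexSet_mono) hreg
    refine ⟨hfin.toFinset, by simpa using hEK, h1.1, ?_⟩
    rw [← h1.2]; exact hc
  · intro Q hQE hQ
    obtain ⟨K, h1, h2, h3⟩ := h.exists_isRegular_two hE hG hQE hQ
    exact le_csSup (bddAbove_isRegular_two hV) ⟨K, h1, h2, h3⟩

/-- Two vertices are connected in `K` iff some edge set has them as its boundary. -/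
lemma Ends.reflTransGen_iff (h : K.Ends p q) {E : Finset β} (hE : E(K) = ↑E) {x y : α} :
    Relation.ReflTransGen K.Adj x y ↔ ∃ P ⊆ E, bd p q P = pt x + pt y := by
  constructor
  · intro hr
    induction hr with
    | refl => exact ⟨∅, by simp, by rw [bd_empty, add_self_fun]⟩
    | @tail y z _ hadj ih =>
      obtain ⟨P, hP, hb⟩ := ih
      obtain ⟨e, hl⟩ := hadj
      have hl' := h.isLink_iff.1 hl
      have he : e ∈ E := by
        have := hl'.1; rw [hE] at this; exact this
      refine ⟨symmDiff P {e}, symmDiff_subset_of_subset hP (by simpa using he), ?_⟩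
      have h1 : pt (p e) + pt (q e) = pt y + pt z := by
        rcases hl'.2 with ⟨h1, h2⟩ | ⟨h1, h2⟩
        · rw [h1, h2]
        · rw [h1, h2, add_comm]
      rw [bd_symmDiff, bd_singleton, hb, h1]
      have := add_self_fun (pt y)
      calc _ = pt x + pt z + (pt y + pt y) := by abel
        _ = _ := by rw [this, add_zero]
  · rintro ⟨P, hP, hb⟩
    refine (mem_iff_of_closed (W := fun w => Relation.ReflTransGen K.Adj x w) hb ?_).1 .refl
    intro e he
    have hl := h e (by rw [hE]; exact hP he)
    exact ⟨fun h' => h'.tail hl.adj, fun h' => h'.tail hl.symm.adj⟩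

omit [DecidableEq α] in
lemma edgeSet_deleteEdges_coe {E : Finset β} (hE : E(G) = ↑E) (F : Finset β) :
    E(G.deleteEdges ↑F) = ↑(E \ F) := by
  simp [deleteEdges, hE]

/-- An edge is a cut-edge iff it lies in no closed edge set. -/
lemma Ends.isCutEdge_iff (h : G.Ends p q) {E : Finset β} (hE : E(G) = ↑E) {e : β} (he : e ∈ E) :
    G.IsCutEdge e ↔ ¬ ∃ C ⊆ E, bd p q C = 0 ∧ e ∈ C := by
  have hE' : E(G.deleteEdges {e}) = ↑(E \ {e}) := by
    have := edgeSet_deleteEdges_coe hE {e}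
    simpa using this
  have hends : (G.deleteEdges {e}).Ends p q := h.mono deleteEdges_le
  have hl := h e (by rw [hE]; exact he)
  have key : ∀ x y, pt (p e) + pt (q e) = pt x + pt y →
      (Relation.ReflTransGen (G.deleteEdges {e}).Adj x y ↔ ∃ C ⊆ E, bd p q C = 0 ∧ e ∈ C) := by
    intro x y hxy
    rw [hends.reflTransGen_iff hE']
    constructor
    · rintro ⟨P, hP, hb⟩
      refine ⟨symmDiff P {e}, symmDiff_subset_of_subset (hP.trans Finset.sdiff_subset)
        (by simpa using he), ?_, ?_⟩
      · rw [bd_symmDiff, bd_singleton, hb, hxy, add_self_fun]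
      · refine Finset.mem_symmDiff.2 (Or.inr ⟨by simp, fun h' => ?_⟩)
        have := hP h'
        simp at this
    · rintro ⟨C, hC, hC0, heC⟩
      refine ⟨C \ {e}, Finset.sdiff_subset_sdiff hC le_rfl, ?_⟩
      rw [bd_sdiff (by simpa using heC), hC0, zero_add, bd_singleton, hxy]
  constructor
  · rintro ⟨x, y, hxy, hn⟩
    rw [← key x y]
    · exact hn
    · rcases (h.isLink_iff.1 hxy).2 with ⟨h1, h2⟩ | ⟨h1, h2⟩
      · rw [h1, h2]
      · rw [h1, h2, add_comm]
  · intro hn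
    exact ⟨p e, q e, hl, fun h' => hn ((key _ _ rfl).1 h')⟩

end Graph

namespace TJoin

/-! ### Counting connected components -/

section Components

variable {V ε : Type*} [DecidableEq V] [DecidableEq ε] {p q : ε → V}

/-- The vertices `x` and `y` are connected by edges of `E`, expressed through boundaries. -/
def Conn (p q : ε → V) (E : Finset ε) (x y : V) : Prop := ∃ P ⊆ E, bd p q P = pt x + pt y

lemma Conn.refl (E : Finset ε) (x : V) : Conn p q E x x :=
  ⟨∅, by simp, by rw [bd_empty, add_self_fun]⟩

lemma Conn.symm {E : Finset ε} {x y : V} (h : Conn p q E x y) : Conn p q E y x := by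
  obtain ⟨P, hP, hb⟩ := h
  exact ⟨P, hP, by rw [hb, add_comm]⟩

lemma Conn.trans {E : Finset ε} {x y z : V} (h : Conn p q E x y) (h' : Conn p q E y z) :
    Conn p q E x z := by
  obtain ⟨P, hP, hb⟩ := h
  obtain ⟨P', hP', hb'⟩ := h'
  refine ⟨symmDiff P P', symmDiff_subset_of_subset hP hP', ?_⟩
  rw [bd_symmDiff, hb, hb']
  have := add_self_fun (pt y)
  calc _ = pt x + pt z + (pt y + pt y) := by abel
    _ = _ := by rw [this, add_zero]

lemma Conn.mono {E E' : Finset ε} (hE : E ⊆ E') {x y : V} (h : Conn p q E x y) :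
    Conn p q E' x y := by
  obtain ⟨P, hP, hb⟩ := h
  exact ⟨P, hP.trans hE, hb⟩

lemma conn_of_mem {E : Finset ε} {e : ε} (he : e ∈ E) : Conn p q E (p e) (q e) :=
  ⟨{e}, by simpa using he, by simp⟩

/-- The equivalence relation of being connected by edges of `E`. -/
def connSetoid (p q : ε → V) (E : Finset ε) : Setoid V where
  r := Conn p q E
  iseqv := ⟨Conn.refl E, Conn.symm, Conn.trans⟩

/-- A chosen representative of the component of `x`. -/
noncomputable def rep (p q : ε → V) (E : Finset ε) (x : V) : V :=
  (Quotient.mk (connSetoid p q E) x).out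

lemma rep_conn (E : Finset ε) (x : V) : Conn p q E (rep p q E x) x :=
  @Quotient.mk_out _ (connSetoid p q E) x

lemma rep_eq_iff {E : Finset ε} {x y : V} : rep p q E x = rep p q E y ↔ Conn p q E x y := by
  constructor
  · intro h
    exact (rep_conn E x).symm.trans (h ▸ rep_conn E y)
  · intro h
    unfold rep
    congr 1
    exact Quotient.sound (s := connSetoid p q E) h

lemma rep_rep (E : Finset ε) (x : V) : rep p q E (rep p q E x) = rep p q E x :=
  rep_eq_iff.2 (rep_conn E x)

lemma rep_end {E : Finset ε} {e : ε} (he : e ∈ E) : rep p q E (q e) = rep p q E (p e) :=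
  rep_eq_iff.2 (conn_of_mem he).symm

/-- A vertex set closed under the edges of `E` is a union of components. -/
lemma Conn.mem_iff {E : Finset ε} {x y : V} (h : Conn p q E x y) {W : V → Prop}
    (hW : ∀ e ∈ E, (W (p e) ↔ W (q e))) : W x ↔ W y := by
  obtain ⟨P, hP, hb⟩ := h
  exact mem_iff_of_closed hb fun e he => hW e (hP he)

/-- Connections that need the edge `e` use it exactly once. -/
lemma conn_cases_of_erase {E : Finset ε} {e : ε} {a b : V}
    (h : Conn p q E a b) : Conn p q (E \ {e}) a b ∨
      (Conn p q (E \ {e}) a (p e) ∧ Conn p q (E \ {e}) b (q e)) ∨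
      (Conn p q (E \ {e}) a (q e) ∧ Conn p q (E \ {e}) b (p e)) := by
  set E' := E \ {e} with hE'
  set W : V → Prop := fun w => Conn p q E' a w ∨ (Conn p q E' a (p e) ∧ Conn p q E' w (q e)) ∨
      (Conn p q E' a (q e) ∧ Conn p q E' w (p e)) with hW
  have hmem : ∀ f ∈ E, f ≠ e → f ∈ E' := fun f hf hne => by
    rw [hE']; simp [hf, hne]
  have step : ∀ x y, Conn p q E' x y → W x → W y := by
    rintro x y hxy (h1 | ⟨h1, h2⟩ | ⟨h1, h2⟩)
    · exact Or.inl (h1.trans hxy)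
    · exact Or.inr (Or.inl ⟨h1, hxy.symm.trans h2⟩)
    · exact Or.inr (Or.inr ⟨h1, hxy.symm.trans h2⟩)
  refine (h.mem_iff (W := W) ?_).1 (Or.inl (Conn.refl _ _))
  intro f hf
  by_cases hfe : f = e
  · subst hfe
    constructor
    · rintro (h1 | ⟨h1, h2⟩ | ⟨h1, h2⟩)
      · exact Or.inr (Or.inl ⟨h1, Conn.refl _ _⟩)
      · exact Or.inl (h1.trans h2)
      · exact Or.inl h1
    · rintro (h1 | ⟨h1, h2⟩ | ⟨h1, h2⟩)
      · exact Or.inr (Or.inr ⟨h1, Conn.refl _ _⟩)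
      · exact Or.inl h1
      · exact Or.inl (h1.trans h2)
  · exact ⟨step _ _ (conn_of_mem (hmem f hf hfe)), step _ _ (conn_of_mem (hmem f hf hfe)).symm⟩

/-- Deleting an edge whose ends become disconnected raises the number of components by one. -/
lemma card_image_rep_erase {U : Finset V} {E : Finset ε} {e : ε} (he : e ∈ E)
    (hU : p e ∈ U ∧ q e ∈ U) (hn : ¬ Conn p q (E \ {e}) (p e) (q e)) :
    (U.image (rep p q (E \ {e}))).card = (U.image (rep p q E)).card + 1 := by
  set E' := E \ {e} with hE'
  have hsub : E' ⊆ E := Finset.sdiff_subset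
  set b := rep p q E' (q e) with hb
  have hbmem : b ∈ U.image (rep p q E') := Finset.mem_image_of_mem _ hU.2
  have himg : ((U.image (rep p q E')).erase b).image (rep p q E) = U.image (rep p q E) := by
    ext r
    simp only [Finset.mem_image, Finset.mem_erase]
    constructor
    · rintro ⟨_, ⟨_, x, hx, rfl⟩, rfl⟩
      exact ⟨x, hx, rep_eq_iff.2 ((rep_conn E' x).mono hsub).symm⟩
    · rintro ⟨x, hx, rfl⟩
      by_cases hxb : rep p q E' x = b
      · refine ⟨rep p q E' (p e), ⟨?_, p e, hU.1, rfl⟩, ?_⟩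
        · intro h; exact hn (rep_eq_iff.1 h)
        · refine rep_eq_iff.2 (((rep_conn E' (p e)).mono hsub).trans ((conn_of_mem he).trans ?_))
          exact ((rep_eq_iff.1 hxb).mono hsub).symm
      · exact ⟨rep p q E' x, ⟨hxb, x, hx, rfl⟩, rep_eq_iff.2 ((rep_conn E' x).mono hsub)⟩
  have hinj : Set.InjOn (rep p q E) ((U.image (rep p q E')).erase b : Finset V) := by
    intro x hx y hy hxy
    simp only [Finset.coe_erase, Finset.coe_image, Set.mem_sdiff, Set.mem_image,
      Set.mem_singleton_iff] at hx hy
    obtain ⟨⟨x, _, rfl⟩, hxb⟩ := hx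
    obtain ⟨⟨y, _, rfl⟩, hyb⟩ := hy
    rcases conn_cases_of_erase (e := e) (rep_eq_iff.1 hxy) with h | ⟨_, h⟩ | ⟨h, _⟩
    · rw [← rep_rep, rep_eq_iff.2 h, rep_rep]
    · exact absurd (by rw [hb, ← rep_rep, rep_eq_iff.2 h]) hyb
    · exact absurd (by rw [hb, ← rep_rep, rep_eq_iff.2 h]) hxb
  rw [← himg, Finset.card_image_of_injOn hinj, Finset.card_erase_of_mem hbmem]
  have := Finset.card_pos.2 ⟨_, hbmem⟩
  omega

/-- Deleting cut-edges raises the number of components by their number. -/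
lemma card_image_rep_sdiff {U : Finset V} {E : Finset ε} (hU : ∀ e ∈ E, p e ∈ U ∧ q e ∈ U)
    (F : Finset ε) (hF : ∀ e ∈ F, e ∈ E ∧ ¬ ∃ C ⊆ E, bd p q C = 0 ∧ e ∈ C) :
    (U.image (rep p q (E \ F))).card = (U.image (rep p q E)).card + F.card := by
  induction F using Finset.induction_on with
  | empty => simp
  | insert e F heF ih =>
    have h1 := ih fun f hf => hF f (Finset.mem_insert_of_mem hf)
    have he := hF e (Finset.mem_insert_self _ _)
    have h2 : E \ insert e F = (E \ F) \ {e} := by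
      ext; simp; tauto
    have heE : e ∈ E \ F := Finset.mem_sdiff.2 ⟨he.1, heF⟩
    rw [h2, card_image_rep_erase heE (hU e he.1), h1, Finset.card_insert_of_notMem heF, add_assoc]
    rintro ⟨P, hP, hb⟩
    refine he.2 ⟨P ∪ {e}, ?_, ?_, by simp⟩
    · intro f hf
      rcases Finset.mem_union.1 hf with h | h
      · exact (Finset.mem_sdiff.1 (Finset.mem_sdiff.1 (hP h)).1).1
      · rw [Finset.mem_singleton.1 h]; exact he.1
    · have hd : Disjoint P {e} := by
        rw [Finset.disjoint_singleton_right]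
        intro h; have := hP h; simp at this
      rw [bd, Finset.sum_union hd]
      change bd p q P + bd p q {e} = 0
      rw [hb, bd_singleton, add_self_fun]

/-- The part of `Q` in the component with representative `r`. -/
noncomputable def part (p q : ε → V) (E Q : Finset ε) (r : V) : Finset ε :=
  Q.filter fun e => rep p q E (p e) = r

lemma part_subset (E Q : Finset ε) (r : V) : part p q E Q r ⊆ Q := Finset.filter_subset _ _

lemma part_mono (E : Finset ε) {Q Q' : Finset ε} (h : Q ⊆ Q') (r : V) :
    part p q E Q r ⊆ part p q E Q' r := Finset.filter_subset_filter _ h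

lemma bd_part {E Q : Finset ε} (hQ : Q ⊆ E) (r v : V) :
    bd p q (part p q E Q r) v = if rep p q E v = r then bd p q Q v else 0 := by
  rw [bd_apply, part, Finset.sum_filter]
  by_cases h : rep p q E v = r
  · rw [if_pos h, bd_apply]
    refine Finset.sum_congr rfl fun e he => ?_
    by_cases h1 : rep p q E (p e) = r
    · rw [if_pos h1]
    · have hp : p e ≠ v := by rintro rfl; exact h1 h
      have hq : q e ≠ v := by
        rintro rfl; rw [rep_end (hQ he)] at h; exact h1 h
      rw [if_neg h1, if_neg hp, if_neg hq, add_zero]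
  · rw [if_neg h]
    refine Finset.sum_eq_zero fun e he => ?_
    by_cases h1 : rep p q E (p e) = r
    · have hp : p e ≠ v := by rintro rfl; exact h h1
      have hq : q e ≠ v := by
        rintro rfl; rw [rep_end (hQ he)] at h; exact h h1
      rw [if_pos h1, if_neg hp, if_neg hq, add_zero]
    · rw [if_neg h1]

lemma bd_part_eq_zero {E Q : Finset ε} (hQ : Q ⊆ E) (h0 : bd p q Q = 0) (r : V) :
    bd p q (part p q E Q r) = 0 := by
  funext v
  rw [bd_part hQ, h0]
  simp

/-- A maximum closed edge set is maximum in every component. -/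
lemma card_le_card_part {E M : Finset ε} (hM : M ⊆ E) (h0 : bd p q M = 0)
    (hmax : ∀ C ⊆ E, bd p q C = 0 → C.card ≤ M.card) (r : V) :
    ∀ C ⊆ part p q E E r, bd p q C = 0 → C.card ≤ (part p q E M r).card := by
  intro C hC hC0
  have hdisj : Disjoint (M \ part p q E M r) C := by
    rw [Finset.disjoint_left]
    intro e he heC
    have h1 := Finset.mem_sdiff.1 he
    exact h1.2 (Finset.mem_filter.2 ⟨h1.1, (Finset.mem_filter.1 (hC heC)).2⟩)
  have h1 := hmax ((M \ part p q E M r) ∪ C) ?_ ?_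
  · rw [Finset.card_union_of_disjoint hdisj] at h1
    have h2 := Finset.card_sdiff_add_card_eq_card (part_subset (p := p) (q := q) E M r)
    omega
  · exact Finset.union_subset (Finset.sdiff_subset.trans hM) (hC.trans (part_subset _ _ _))
  · rw [bd, Finset.sum_union hdisj]
    change bd p q _ + bd p q C = 0
    rw [bd_sdiff (part_subset _ _ _), h0, bd_part_eq_zero hM h0, hC0]
    simp

lemma sum_card_part {E Q : Finset ε} {U : Finset V} (hU : ∀ e ∈ Q, p e ∈ U) :
    ∑ r ∈ U.image (rep p q E), (part p q E Q r).card = Q.card :=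
  (Finset.card_eq_sum_card_fiberwise fun e he =>
    Finset.mem_image_of_mem _ (hU e he)).symm

lemma dgr_part {E Q : Finset ε} (hQ : Q ⊆ E) {v : V} :
    dgr p q (part p q E Q (rep p q E v)) v = dgr p q Q v := by
  unfold dgr part
  rw [Finset.sum_filter]
  refine Finset.sum_congr rfl fun e he => ?_
  by_cases h1 : rep p q E (p e) = rep p q E v
  · rw [if_pos h1]
  · have hp : p e ≠ v := by rintro rfl; exact h1 rfl
    have hq : q e ≠ v := by
      rintro rfl; rw [rep_end (hQ he)] at h1; exact h1 rfl
    rw [if_neg h1, if_neg hp, if_neg hq, add_zero]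

end Components

/-! ### Summing over the components -/

section Sum

variable {V ε : Type*} [DecidableEq V] [DecidableEq ε]

/-- The vertices in the component with representative `r`. -/
noncomputable def cls (p q : ε → V) (E : Finset ε) (U : Finset V) (r : V) : Finset V :=
  U.filter fun v => rep p q E v = r

/-- The `1`-deficit `3 n - 2 m` of the component with representative `r`. -/
noncomputable def clsDeficit (p q : ε → V) (E : Finset ε) (U : Finset V) (r : V) : ℤ :=
  3 * (cls p q E U r).card - 2 * (part p q E E r).card

variable {p q : ε → V} {U : Finset V} {E : Finset ε}

lemma clsDeficit_eq (hU : ∀ e ∈ E, p e ∈ U ∧ q e ∈ U) (r : V) :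
    clsDeficit p q E U r = ∑ v ∈ cls p q E U r, (3 - (dgr p q E v : ℤ)) := by
  have h1 := sum_dgr (p := p) (q := q) (part p q E E r) (cls p q E U r) (by
    intro e he
    have h := Finset.mem_filter.1 he
    refine ⟨Finset.mem_filter.2 ⟨(hU e h.1).1, h.2⟩, Finset.mem_filter.2 ⟨(hU e h.1).2, ?_⟩⟩
    rw [rep_end h.1]; exact h.2)
  rw [Finset.sum_sub_distrib, clsDeficit, Finset.sum_const, nsmul_eq_mul, mul_comm]
  congr 1
  rw [← Nat.cast_sum, ← Nat.cast_ofNat (R := ℤ) (n := 2), ← Nat.cast_mul, ← h1]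
  congr 1
  refine Finset.sum_congr rfl fun v hv => ?_
  rw [← (Finset.mem_filter.1 hv).2, dgr_part subset_rfl]

lemma clsDeficit_nonneg (hU : ∀ e ∈ E, p e ∈ U ∧ q e ∈ U) (h3 : ∀ v ∈ U, dgr p q E v ≤ 3) (r : V) :
    0 ≤ clsDeficit p q E U r := by
  rw [clsDeficit_eq hU]
  refine Finset.sum_nonneg fun v hv => ?_
  have := h3 v (Finset.mem_filter.1 hv).1
  omega

lemma sum_clsDeficit (hU : ∀ e ∈ E, p e ∈ U ∧ q e ∈ U) :
    ∑ r ∈ U.image (rep p q E), clsDeficit p q E U r = 3 * U.card - 2 * E.card := by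
  unfold clsDeficit
  rw [Finset.sum_sub_distrib, ← Finset.mul_sum, ← Finset.mul_sum, ← Nat.cast_sum, ← Nat.cast_sum,
    sum_card_part fun e he => (hU e he).1]
  congr 3
  exact (Finset.card_eq_sum_card_fiberwise fun e he => Finset.mem_image_of_mem _ he).symm

/-- The components of `E \ F` with deficit zero are components of `E`: their vertices have degree
`3` already, so no edge of `F` is incident with them. -/
lemma card_deficit_zero_lt (hU : ∀ e ∈ E, p e ∈ U ∧ q e ∈ U) (h3 : ∀ v ∈ U, dgr p q E v ≤ 3)
    (F : Finset ε) {r₁ : V} (hr₁ : r₁ ∈ U.image (rep p q (E \ F)))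
    (hd : clsDeficit p q (E \ F) U r₁ ≠ 0) :
    ((U.image (rep p q (E \ F))).filter fun r => clsDeficit p q (E \ F) U r = 0).card <
      (U.image (rep p q E)).card := by
  set E' := E \ F with hE'
  have hsub : E' ⊆ E := Finset.sdiff_subset
  have hU' : ∀ e ∈ E', p e ∈ U ∧ q e ∈ U := fun e he => hU e (hsub he)
  have hfull : ∀ r, clsDeficit p q E' U r = 0 → ∀ v ∈ cls p q E' U r, dgr p q E' v = 3 := by
    intro r hr v hv
    rw [clsDeficit_eq hU', Finset.sum_eq_zero_iff_of_nonneg] at hr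
    · have := hr v hv; omega
    · intro v hv
      have h1 := h3 v (Finset.mem_filter.1 hv).1
      have h2 := dgr_mono (p := p) (q := q) hsub v
      omega
  have hnoF : ∀ r, clsDeficit p q E' U r = 0 → ∀ v ∈ cls p q E' U r, ∀ e ∈ E,
      (p e = v ∨ q e = v) → e ∈ E' := by
    intro r hr v hv e he hev
    by_contra hne
    have h1 := hfull r hr v hv
    have h2 := h3 v (Finset.mem_filter.1 hv).1
    have h4 : dgr p q E v = dgr p q E' v + dgr p q (E \ E') v := by
      unfold dgr; rw [add_comm]; exact (Finset.sum_sdiff hsub).symm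
    have h5 : 0 < dgr p q (E \ E') v := dgr_pos (Finset.mem_sdiff.2 ⟨he, hne⟩) hev
    omega
  -- connected in `E` to a component of deficit zero means lying in it
  have hclosed : ∀ r, clsDeficit p q E' U r = 0 → ∀ x ∈ U, ∀ y ∈ U, rep p q E' x = r →
      Conn p q E x y → rep p q E' y = r := by
    intro r hr x hx y _ hxr hxy
    refine (hxy.mem_iff (W := fun w => rep p q E' w = r) ?_).1 hxr
    intro e he
    constructor
    · intro h
      have := hnoF r hr (p e) (Finset.mem_filter.2 ⟨(hU e he).1, h⟩) e he (Or.inl rfl)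
      rw [rep_end this]; exact h
    · intro h
      have := hnoF r hr (q e) (Finset.mem_filter.2 ⟨(hU e he).2, h⟩) e he (Or.inr rfl)
      rw [← rep_end this]; exact h
  set Z := (U.image (rep p q E')).filter fun r => clsDeficit p q E' U r = 0 with hZ
  obtain ⟨x₁, hx₁, rfl⟩ := Finset.mem_image.1 hr₁
  have hmemZ : ∀ r ∈ Z, ∃ x ∈ U, rep p q E' x = r ∧ clsDeficit p q E' U r = 0 := by
    intro r hr
    obtain ⟨h1, h2⟩ := Finset.mem_filter.1 hr
    obtain ⟨x, hx, hxr⟩ := Finset.mem_image.1 h1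
    exact ⟨x, hx, hxr, h2⟩
  have hrepr : ∀ x, rep p q E (rep p q E' x) = rep p q E x := fun x =>
    rep_eq_iff.2 ((rep_conn E' x).mono hsub)
  have hinj : Set.InjOn (rep p q E) (Z : Set V) := by
    intro r hr s hs hrs
    obtain ⟨x, hx, rfl, hx0⟩ := hmemZ r hr
    obtain ⟨y, hy, rfl, hy0⟩ := hmemZ s hs
    rw [hrepr, hrepr] at hrs
    exact (hclosed _ hx0 x hx y hy rfl (rep_eq_iff.1 hrs)).symm
  rw [← Finset.card_image_of_injOn hinj]
  apply Finset.card_lt_card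
  refine ⟨?_, fun hcon => ?_⟩
  · intro t ht
    obtain ⟨r, hr, rfl⟩ := Finset.mem_image.1 ht
    obtain ⟨x, hx, rfl, _⟩ := hmemZ r hr
    rw [hrepr]
    exact Finset.mem_image_of_mem _ hx
  · obtain ⟨r, hr, hreq⟩ := Finset.mem_image.1 (hcon (Finset.mem_image_of_mem _ hx₁))
    obtain ⟨x, hx, rfl, hx0⟩ := hmemZ r hr
    rw [hrepr] at hreq
    have := hclosed _ hx0 x hx x₁ hx₁ rfl (rep_eq_iff.1 hreq)
    rw [this] at hd
    exact hd hx0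

/-- Summation over the components of `E \ F`, where `F` is the set of cut-edges; `M` is a maximum
closed edge set. Either all these components have deficit zero, and `M` covers all vertices, or the
bound of the theorem holds without the maximum, and in the connected case it is attained iff it is
attained in every component. -/
theorem card_sub_card_le (hU : ∀ e ∈ E, p e ∈ U ∧ q e ∈ U) (h3 : ∀ v ∈ U, dgr p q E v ≤ 3)
    {F : Finset ε} (hF : ∀ e, e ∈ F ↔ e ∈ E ∧ ¬ ∃ C ⊆ E, bd p q C = 0 ∧ e ∈ C)
    {M : Finset ε} (hME : M ⊆ E) (hM : bd p q M = 0)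
    (hmax : ∀ C ⊆ E, bd p q C = 0 → C.card ≤ M.card) :
    (∀ r, 2 * (part p q (E \ F) (E \ F) r).card ≤ 3 * (part p q (E \ F) M r).card) ∧
    (∀ r, ∀ C ⊆ part p q (E \ F) (E \ F) r, bd p q C = 0 →
      C.card ≤ (part p q (E \ F) M r).card) ∧
    (((∀ r ∈ U.image (rep p q (E \ F)), clsDeficit p q (E \ F) U r = 0) ∧ U.card ≤ M.card ∧
        3 * (U.card : ℤ) - 2 * E.card + 2 * F.card = 0) ∨
      (2 * ((U.card : ℤ) - M.card) ≤ 3 * (U.card : ℤ) - 2 * E.card + F.card - 1 ∧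
        ((U.image (rep p q E)).card = 1 →
          (∀ r ∈ U.image (rep p q (E \ F)), 1 ≤ clsDeficit p q (E \ F) U r) ∧
          (2 * ((U.card : ℤ) - M.card) = 3 * (U.card : ℤ) - 2 * E.card + F.card - 1 ↔
            ∀ r ∈ U.image (rep p q (E \ F)),
              2 * (((cls p q (E \ F) U r).card : ℤ) - (part p q (E \ F) M r).card) =
                clsDeficit p q (E \ F) U r - 1)))) := by
  set E' := E \ F with hE'
  have hsub : E' ⊆ E := Finset.sdiff_subset
  have hU' : ∀ e ∈ E', p e ∈ U ∧ q e ∈ U := fun e he => hU e (hsub he)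
  have h3' : ∀ v ∈ U, dgr p q E' v ≤ 3 := fun v hv => (dgr_mono hsub v).trans (h3 v hv)
  have hclosedF : ∀ C ⊆ E, bd p q C = 0 → C ⊆ E' := by
    intro C hC hC0 e he
    refine Finset.mem_sdiff.2 ⟨hC he, fun heF => ?_⟩
    exact ((hF e).1 heF).2 ⟨C, hC, hC0, he⟩
  have hME' := hclosedF M hME hM
  have hmaxp := card_le_card_part hME' hM fun C hC => hmax C (hC.trans hsub)
  have hthird : ∀ r, 2 * (part p q E' E' r).card ≤ 3 * (part p q E' M r).card := by
    intro r
    refine two_mul_card_le ?_ (part_mono E' hME' r) (bd_part_eq_zero hME' hM r) (hmaxp r)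
    intro e he
    have he' := Finset.mem_filter.1 he
    have heE : ∃ C ⊆ E, bd p q C = 0 ∧ e ∈ C := by
      by_contra hcon
      have := (hF e).2 ⟨hsub he'.1, hcon⟩
      exact (Finset.mem_sdiff.1 he'.1).2 this
    obtain ⟨C, hC, hC0, heC⟩ := heE
    have hC' := hclosedF C hC hC0
    exact ⟨part p q E' C r, part_mono E' hC' r, bd_part_eq_zero hC' hC0 r,
      Finset.mem_filter.2 ⟨heC, he'.2⟩⟩
  refine ⟨hthird, hmaxp, ?_⟩
  have hFE : F ⊆ E := fun e he => ((hF e).1 he).1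
  have hcardE : E'.card + F.card = E.card := Finset.card_sdiff_add_card_eq_card hFE
  have hsumd := sum_clsDeficit hU'
  have hcomp := card_image_rep_sdiff hU F fun e he => (hF e).1 he
  rw [← hE'] at hcomp
  set R := U.image (rep p q E') with hR
  set miss : V → ℤ := fun r => ((cls p q E' U r).card : ℤ) - (part p q E' M r).card with hmiss
  have hsummiss : ∑ r ∈ R, miss r = (U.card : ℤ) - M.card := by
    rw [hmiss, Finset.sum_sub_distrib, ← Nat.cast_sum, ← Nat.cast_sum,
      sum_card_part fun e he => (hU' e (hME' he)).1]
    congr 2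
    exact (Finset.card_eq_sum_card_fiberwise fun e he => Finset.mem_image_of_mem _ he).symm
  have hnn := clsDeficit_nonneg hU' h3'
  have hm0 : ∀ r, clsDeficit p q E' U r = 0 → miss r ≤ 0 := by
    intro r hr
    have := hthird r
    simp only [hmiss]; unfold clsDeficit at hr; omega
  -- rounding: an integer at most a third of a positive integer `d` is at most `(d - 1) / 2`
  have hm1 : ∀ r, clsDeficit p q E' U r ≠ 0 → 2 * miss r ≤ clsDeficit p q E' U r - 1 := by
    intro r hr
    have := hthird r
    have h' := hnn r
    simp only [hmiss]; unfold clsDeficit at hr h' ⊢; omega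
  by_cases hall : ∀ r ∈ R, clsDeficit p q E' U r = 0
  · left
    refine ⟨hall, ?_, ?_⟩
    · have : ∑ r ∈ R, miss r ≤ 0 := Finset.sum_nonpos fun r hr => hm0 r (hall r hr)
      omega
    · rw [Finset.sum_eq_zero hall] at hsumd
      omega
  · right
    push Not at hall
    obtain ⟨r₁, hr₁, hd₁⟩ := hall
    have hlt := card_deficit_zero_lt hU h3 F hr₁ hd₁
    rw [← hE', ← hR] at hlt
    set Z := R.filter fun r => clsDeficit p q E' U r = 0 with hZ
    set Y := R.filter fun r => ¬ clsDeficit p q E' U r = 0 with hY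
    have hcardZY : Z.card + Y.card = R.card := Finset.card_filter_add_card_filter_not _
    have hsplit1 : ∑ r ∈ Z, miss r + ∑ r ∈ Y, miss r = ∑ r ∈ R, miss r :=
      Finset.sum_filter_add_sum_filter_not _ _ _
    have hsplit2 : ∑ r ∈ Z, clsDeficit p q E' U r + ∑ r ∈ Y, clsDeficit p q E' U r =
        ∑ r ∈ R, clsDeficit p q E' U r := Finset.sum_filter_add_sum_filter_not _ _ _
    have hZ0 : ∑ r ∈ Z, clsDeficit p q E' U r = 0 :=
      Finset.sum_eq_zero fun r hr => (Finset.mem_filter.1 hr).2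
    have hZm : ∑ r ∈ Z, miss r ≤ 0 :=
      Finset.sum_nonpos fun r hr => hm0 r (Finset.mem_filter.1 hr).2
    have hYm : 2 * ∑ r ∈ Y, miss r ≤ ∑ r ∈ Y, clsDeficit p q E' U r - Y.card := by
      rw [Finset.mul_sum, Finset.card_eq_sum_ones, Nat.cast_sum, ← Finset.sum_sub_distrib]
      refine Finset.sum_le_sum fun r hr => ?_
      have := hm1 r (Finset.mem_filter.1 hr).2
      push_cast; exact this
    refine ⟨by omega, fun hone => ?_⟩
    have hZe : Z = ∅ := Finset.card_eq_zero.1 (by omega)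
    have hpos : ∀ r ∈ R, clsDeficit p q E' U r ≠ 0 := by
      intro r hr h0
      have : r ∈ Z := Finset.mem_filter.2 ⟨hr, h0⟩
      rw [hZe] at this; simp at this
    refine ⟨fun r hr => by have := hpos r hr; have := hnn r; omega, ?_⟩
    have htot : 3 * (U.card : ℤ) - 2 * E.card + F.card - 1 =
        ∑ r ∈ R, (clsDeficit p q E' U r - 1) := by
      rw [Finset.sum_sub_distrib, hsumd, Finset.sum_const, nsmul_eq_mul, mul_one, hcomp, hone]
      push_cast; omega
    have heq := Finset.sum_eq_sum_iff_of_le (s := R) (f := fun r => 2 * miss r)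
      (g := fun r => clsDeficit p q E' U r - 1) fun r hr => hm1 r (hpos r hr)
    rw [htot, ← hsummiss, Finset.mul_sum]
    exact heq

end Sum

end TJoin

namespace Graph

open TJoin

/-! ### Edge cuts of multigraphs -/

section Cuts

variable {α β : Type*} {G K : Graph α β}

/-- The edges of `G` with exactly one end in `S`. -/
def bdry (G : Graph α β) (S : Set α) : Set β := {e | ∃ x ∈ S, ∃ y ∉ S, G.IsLink e x y}

lemma bdry_subset (S : Set α) : G.bdry S ⊆ E(G) := by
  rintro e ⟨x, _, y, _, h⟩; exact h.edge_mem

lemma bdry_compl {S : Set α} : G.bdry (V(G) \ S) = G.bdry S := by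
  ext e
  constructor
  · rintro ⟨x, hx, y, hy, h⟩
    refine ⟨y, ?_, x, hx.2, h.symm⟩
    by_contra hyS
    exact hy ⟨h.right_mem, hyS⟩
  · rintro ⟨x, hx, y, hy, h⟩
    exact ⟨y, ⟨h.right_mem, hy⟩, x, fun h' => h'.2 hx, h.symm⟩

/-- Every nontrivial edge cut has at least two edges. On finite multigraphs with a vertex this means
connected without cut-edges. -/
def CutTwo (G : Graph α β) : Prop :=
  ∀ S ⊆ V(G), S.Nonempty → S ≠ V(G) → 2 ≤ (G.bdry S).ncard

lemma deg_eq_ncard_bdry (hl : ∀ e x, ¬ G.IsLink e x x) (v : α) :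
    G.deg v = (G.bdry {v}).ncard := by
  have h1 : {e | G.IsLoopAt e v} = ∅ := by
    ext e; simpa using hl e v
  have h2 : {e | G.IsNonloopAt e v} = G.bdry {v} := by
    ext e
    constructor
    · rintro ⟨y, hy, h⟩; exact ⟨v, rfl, y, hy, h⟩
    · rintro ⟨x, rfl, y, hy, h⟩; exact ⟨y, hy, h⟩
  rw [deg, h1, h2]; simp

lemma bdry_singleton_of_loopless (hl : ∀ e x, ¬ G.IsLink e x x) (v : α) :
    G.bdry {v} = {e | G.Inc e v} := by
  ext e
  constructor
  · rintro ⟨x, rfl, y, _, h⟩; exact ⟨y, h⟩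
  · rintro ⟨y, h⟩
    exact ⟨v, rfl, y, fun h' => hl e v (by rw [Set.mem_singleton_iff.1 h'] at h; exact h), h⟩

lemma CutTwo.of_isConnected (hE : E(G).Finite) (hc : G.IsConnected) (hb : ∀ e, ¬ G.IsCutEdge e) :
    G.CutTwo := by
  intro S hS hne hneV
  obtain ⟨x, hx⟩ := hne
  obtain ⟨y, hyV, hyS⟩ : ∃ y ∈ V(G), y ∉ S := by
    by_contra hcon
    push Not at hcon
    exact hneV (Set.Subset.antisymm hS hcon)
  have hfin : (G.bdry S).Finite := hE.subset (bdry_subset S)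
  by_contra hlt
  have hreach := hc.2 x (hS hx) y hyV
  have hstay : ∀ K : Graph α β, K.bdry S = ∅ → ∀ a b, a ∈ S → Relation.ReflTransGen K.Adj a b →
      b ∈ S := by
    intro K hK a b ha hr
    induction hr with
    | refl => exact ha
    | tail _ h ih =>
      obtain ⟨e, he⟩ := h
      by_contra hn
      have : e ∈ K.bdry S := ⟨_, ih, _, hn, he⟩
      rw [hK] at this; exact this
  rcases Nat.lt_succ_iff_lt_or_eq.1 (not_le.1 hlt) with h0 | h1
  · have : G.bdry S = ∅ := (Set.ncard_eq_zero hfin).1 (by omega)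
    exact hyS (hstay G this x y hx hreach)
  · obtain ⟨e, he⟩ := Set.ncard_eq_one.1 h1
    have hmem : e ∈ G.bdry S := by rw [he]; rfl
    obtain ⟨a, ha, b, hb', hl⟩ := hmem
    apply hb e
    refine ⟨a, b, hl, fun hr => hb' (hstay _ ?_ a b ha hr)⟩
    ext f
    simp only [Set.mem_empty_iff_false, iff_false]
    rintro ⟨c, hc', d, hd, hl'⟩
    have hfG : f ∈ G.bdry S := ⟨c, hc', d, hd, hl'.mono deleteEdges_le⟩
    rw [he] at hfG
    have := hl'.edge_mem
    rw [Set.mem_singleton_iff.1 hfG] at this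
    simp at this

lemma CutTwo.isConnected (h : G.CutTwo) (hne : V(G).Nonempty) : G.IsConnected := by
  refine ⟨hne, fun x hx y hy => ?_⟩
  by_contra hcon
  set S : Set α := {z | z ∈ V(G) ∧ Relation.ReflTransGen G.Adj x z} with hS
  have h1 := h S (fun z hz => hz.1) ⟨x, hx, .refl⟩ (fun h' => by
    have : y ∈ S := by rw [h']; exact hy
    exact hcon this.2)
  have : G.bdry S = ∅ := by
    ext e
    simp only [Set.mem_empty_iff_false, iff_false]
    rintro ⟨a, ha, b, hb, hl⟩
    exact hb ⟨hl.right_mem, ha.2.tail hl.adj⟩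
  rw [this] at h1
  simp at h1

lemma CutTwo.not_isCutEdge (h : G.CutTwo) (e : β) : ¬ G.IsCutEdge e := by
  rintro ⟨x, y, hl, hn⟩
  set S : Set α := {z | z ∈ V(G) ∧ Relation.ReflTransGen (G.deleteEdges {e}).Adj x z} with hS
  have h1 := h S (fun z hz => hz.1) ⟨x, hl.left_mem, .refl⟩ (fun h' => by
    have : y ∈ S := by rw [h']; exact hl.right_mem
    exact hn this.2)
  have : G.bdry S ⊆ {e} := by
    rintro f ⟨a, ha, b, hb, hf⟩
    by_contra hne
    refine hb ⟨hf.right_mem, ha.2.tail ⟨f, ?_⟩⟩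
    have hne' : f ≠ e := hne
    have hf' : f ∈ E(G.deleteEdges {e}) := by simp [hf.edge_mem, hne']
    exact (deleteEdges_le.isLink_iff hf').2 hf
  have := Set.ncard_le_ncard this (Set.finite_singleton e)
  rw [Set.ncard_singleton] at this
  omega

/-- A subcubic multigraph with at least two vertices, all of whose nontrivial cuts have two edges,
has no loops: a loop leaves room for only one further edge at its vertex. -/
lemma CutTwo.loopless (h : G.CutTwo) (hE : E(G).Finite) (hnt : V(G).Nontrivial)
    (h3 : G.IsSubcubic) : ∀ e x, ¬ G.IsLink e x x := by
  intro e x hl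
  have hx := hl.left_mem
  have h1 := h {x} (by simpa using hx) ⟨x, rfl⟩ (by
    intro h'; rw [← h'] at hnt; simp at hnt)
  have h2 : {f | G.IsNonloopAt f x} = G.bdry {x} := by
    ext f
    constructor
    · rintro ⟨y, hy, h⟩; exact ⟨x, rfl, y, hy, h⟩
    · rintro ⟨x, rfl, y, hy, h⟩; exact ⟨y, hy, h⟩
  have h4 := h3 x hx
  have h5 : 0 < {f | G.IsLoopAt f x}.ncard :=
    (Set.ncard_pos (hE.subset fun f hf => IsLoopAt.edge_mem hf)).2 ⟨e, hl⟩
  rw [deg, h2] at h4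
  omega

lemma CutTwo.two_le_deg (h : G.CutTwo) (hnt : V(G).Nontrivial)
    (hl : ∀ e x, ¬ G.IsLink e x x) {v : α} (hv : v ∈ V(G)) : 2 ≤ G.deg v := by
  rw [deg_eq_ncard_bdry hl]
  refine h {v} (by simpa using hv) ⟨v, rfl⟩ ?_
  intro h'; rw [← h'] at hnt; simp at hnt

lemma deleteVerts_singleton_isLink {e : β} {v x y : α} :
    (G.deleteVerts {v}).IsLink e x y ↔ G.IsLink e x y ∧ x ≠ v ∧ y ≠ v := by
  simp [deleteVerts_isLink]

/-- In a subcubic multigraph, a cut-vertex would be incident with a cut-edge. -/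
lemma CutTwo.isTwoConnected (h : G.CutTwo) (hE : E(G).Finite) (h3 : G.IsSubcubic)
    (hV : 2 < V(G).ncard) : G.IsTwoConnected := by
  have hVf : V(G).Finite := Set.finite_of_ncard_pos (by omega)
  have := hVf.to_subtype
  have hnt : V(G).Nontrivial := Set.one_lt_ncard_iff_nontrivial.1 (by omega)
  have hl := h.loopless hE hnt h3
  refine ⟨hV, h.isConnected hnt.nonempty, fun v hv => ?_⟩
  have hVv : V(G.deleteVerts {v}) = V(G) \ {v} := by simp
  have hne : V(G.deleteVerts {v}).Nonempty := by
    rw [hVv]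
    obtain ⟨x, hx, hxv⟩ := hnt.exists_ne v
    exact ⟨x, hx, hxv⟩
  refine ⟨hne, fun x hx y hy => ?_⟩
  by_contra hcon
  set S : Set α := {z | z ∈ V(G.deleteVerts {v}) ∧
    Relation.ReflTransGen (G.deleteVerts {v}).Adj x z} with hS
  set S' : Set α := (V(G) \ {v}) \ S with hS'
  have hSV : S ⊆ V(G) \ {v} := fun z hz => by rw [← hVv]; exact hz.1
  have hnolink : ∀ e a b, a ∈ S → b ∈ S' → ¬ G.IsLink e a b := by
    intro e a b ha hb hl
    have hl' : (G.deleteVerts {v}).IsLink e a b :=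
      deleteVerts_singleton_isLink.2 ⟨hl, (hSV ha).2, hb.1.2⟩
    exact hb.2 ⟨hl'.right_mem, ha.2.tail hl'.adj⟩
  have hvS : v ∉ S := fun h' => (hSV h').2 rfl
  have hvS' : v ∉ S' := fun h' => h'.1.2 rfl
  have hb1 := h S (fun z hz => (hSV hz).1) ⟨x, hx, .refl⟩ (fun h' => hvS (h' ▸ hv))
  have hb2 := h S' (fun z hz => hz.1.1) ⟨y, hVv ▸ hy, fun h' => hcon h'.2⟩
    (fun h' => hvS' (h' ▸ hv))
  have hsub1 : G.bdry S ⊆ G.bdry {v} := by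
    rintro e ⟨a, ha, b, hb, hl'⟩
    have hbv : b = v := by
      by_contra hbv
      exact hnolink e a b ha ⟨⟨hl'.right_mem, hbv⟩, hb⟩ hl'
    subst hbv
    exact ⟨b, rfl, a, fun h' => hvS (h' ▸ ha), hl'.symm⟩
  have hsub2 : G.bdry S' ⊆ G.bdry {v} := by
    rintro e ⟨a, ha, b, hb, hl'⟩
    have hbv : b = v := by
      by_contra hbv
      have hbS : b ∈ S := by
        by_contra hbS
        exact hb ⟨⟨hl'.right_mem, hbv⟩, hbS⟩
      exact hnolink e b a hbS ha hl'.symm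
    subst hbv
    exact ⟨b, rfl, a, fun h' => hvS' (h' ▸ ha), hl'.symm⟩
  have hdisj : Disjoint (G.bdry S) (G.bdry S') := by
    rw [Set.disjoint_left]
    rintro e ⟨a, ha, b, hb, hl1⟩ ⟨c, hc, d, hd, hl2⟩
    rcases hl1.eq_and_eq_or_eq_and_eq hl2 with ⟨rfl, rfl⟩ | ⟨rfl, rfl⟩
    · exact hc.2 ha
    · exact hnolink e _ _ ha hc hl1
  have hf1 := hE.subset (bdry_subset (G := G) S)
  have hf2 := hE.subset (bdry_subset (G := G) S')
  have h4 := Set.ncard_le_ncard (Set.union_subset hsub1 hsub2) (hE.subset (bdry_subset _))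
  rw [Set.ncard_union_eq hdisj hf1 hf2, ← deg_eq_ncard_bdry hl] at h4
  have := h3 v hv
  omega

/-- A vertex of degree at most three of a `2`-connected multigraph carries no loop. -/
lemma IsTwoConnected.loopless (h : G.IsTwoConnected) (hE : E(G).Finite) (h3 : G.IsSubcubic) :
    ∀ e x, ¬ G.IsLink e x x := by
  have hVf : V(G).Finite := Set.finite_of_ncard_pos (by have := h.1; omega)
  have := hVf.to_subtype
  refine CutTwo.loopless ?_ hE (Set.one_lt_ncard_iff_nontrivial.1 (by have := h.1; omega)) h3
  refine CutTwo.of_isConnected hE h.2.1 ?_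
  rintro e ⟨x, y, hl, hn⟩
  have hxy : x ≠ y := by rintro rfl; exact hn .refl
  obtain ⟨z, hz, hzx, hzy⟩ : ∃ z ∈ V(G), z ≠ x ∧ z ≠ y := by
    by_contra hcon
    push Not at hcon
    have : V(G) ⊆ {x, y} := fun z hz => by
      by_cases h' : z = x
      · exact Or.inl h'
      · exact Or.inr (hcon z hz h')
    have := Set.ncard_le_ncard this (by simp)
    have h2 := Set.ncard_pair hxy
    have := h.1
    omega
  -- after deletion of one end of `e`, the vertex `z` reaches the other one without using `e`
  have hdel : ∀ a b, G.IsLink e a b → ∀ c, Relation.ReflTransGen (G.deleteVerts {a}).Adj z c →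
      Relation.ReflTransGen (G.deleteEdges {e}).Adj z c := by
    intro a b hab c hr
    refine Relation.ReflTransGen.mono (fun s t hst => ?_) _ _ hr
    obtain ⟨f, hf⟩ := hst
    obtain ⟨hf, hs, ht⟩ := deleteVerts_singleton_isLink.1 hf
    refine ⟨f, ?_⟩
    have hfe : f ≠ e := by
      rintro rfl
      rcases hf.eq_and_eq_or_eq_and_eq hab with ⟨rfl, rfl⟩ | ⟨rfl, rfl⟩
      · exact hs rfl
      · exact ht rfl
    have hf' : f ∈ E(G.deleteEdges {e}) := by simp [hf.edge_mem, hfe]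
    exact (deleteEdges_le.isLink_iff hf').2 hf
  have hx' : ∀ a b, a ∈ V(G) → b ∈ V(G) → z ≠ a → b ≠ a →
      Relation.ReflTransGen (G.deleteVerts {a}).Adj z b := by
    intro a b ha hb hza hba
    exact (h.2.2 a ha).2 z (by simp [hz, hza]) b (by simp [hb, hba])
  have r1 := hdel x y hl y (hx' x y hl.left_mem hl.right_mem hzx hxy.symm)
  have r2 := hdel y x hl.symm x (hx' y x hl.right_mem hl.left_mem hzy hxy)
  exact hn ((Relation.ReflTransGen.stdSymm.symm _ _ r2).trans r1)

end Cuts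

/-! ### Quotients of multigraphs -/

section Shrink

variable {α β α' β' : Type*}

/-- The multigraph obtained from `B` by identifying vertices along `φ`, relabelling the edges by
`g`, and deleting the loops that arise. It covers both relabelling and contraction. -/
def shrink (B : Graph α β) (φ : α → α') (g : β → β') (hg : Set.InjOn g E(B)) : Graph α' β' where
  vertexSet := φ '' V(B)
  IsLink e p q := ∃ e', g e' = e ∧ ∃ a b, B.IsLink e' a b ∧ φ a ≠ φ b ∧ φ a = p ∧ φ b = q
  isLink_symm := by
    intro e _
    constructor
    rintro p q ⟨e', he, a, b, hl, hne, ha, hb⟩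
    exact ⟨e', he, b, a, hl.symm, hne.symm, hb, ha⟩
  eq_or_eq_of_isLink_of_isLink := by
    rintro e p q r s ⟨e₁, he₁, a, b, hl, -, rfl, rfl⟩ ⟨e₂, he₂, c, d, hl', -, rfl, rfl⟩
    have : e₁ = e₂ := hg hl.edge_mem hl'.edge_mem (he₁.trans he₂.symm)
    subst this
    rcases hl.left_eq_or_eq hl' with rfl | rfl
    · exact Or.inl rfl
    · exact Or.inr rfl
  left_mem_of_isLink := by
    rintro e p q ⟨e', he, a, b, hl, -, rfl, rfl⟩
    exact ⟨a, hl.left_mem, rfl⟩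

variable {B : Graph α β} {φ : α → α'} {g : β → β'} {hg : Set.InjOn g E(B)}

lemma vertexSet_shrink : V(B.shrink φ g hg) = φ '' V(B) := rfl

lemma edgeSet_shrink_subset : E(B.shrink φ g hg) ⊆ g '' E(B) := by
  intro e he
  obtain ⟨p, q, e', rfl, a, b, hl, _⟩ := exists_isLink_of_mem_edgeSet he
  exact ⟨e', hl.edge_mem, rfl⟩

lemma shrink_loopless (e : β') (x : α') : ¬ (B.shrink φ g hg).IsLink e x x := by
  rintro ⟨e', _, a, b, _, hne, rfl, h⟩
  exact hne h.symm

lemma bdry_shrink (S : Set α') :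
    (B.shrink φ g hg).bdry S = g '' B.bdry {a | a ∈ V(B) ∧ φ a ∈ S} := by
  ext e
  constructor
  · rintro ⟨x, hx, y, hy, e', rfl, a, b, hl, hne, rfl, rfl⟩
    exact ⟨e', ⟨a, ⟨hl.left_mem, hx⟩, b, fun h => hy h.2, hl⟩, rfl⟩
  · rintro ⟨e', ⟨a, ha, b, hb, hl⟩, rfl⟩
    have hb' : φ b ∉ S := fun h => hb ⟨hl.right_mem, h⟩
    exact ⟨φ a, ha.2, φ b, hb', e', rfl, a, b, hl, fun h => hb' (h ▸ ha.2), rfl, rfl⟩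

lemma ncard_bdry_shrink (S : Set α') :
    ((B.shrink φ g hg).bdry S).ncard = (B.bdry {a | a ∈ V(B) ∧ φ a ∈ S}).ncard := by
  rw [bdry_shrink, (hg.mono (bdry_subset _)).ncard_image]

lemma CutTwo.shrink (h : B.CutTwo) : (B.shrink φ g hg).CutTwo := by
  intro S hS hne hneV
  rw [ncard_bdry_shrink]
  refine h _ (fun a ha => ha.1) ?_ ?_
  · obtain ⟨x, hx⟩ := hne
    obtain ⟨a, ha, rfl⟩ := hS hx
    exact ⟨a, ha, hx⟩
  · intro h'
    apply hneV
    refine Set.Subset.antisymm hS ?_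
    rintro _ ⟨a, ha, rfl⟩
    rw [← h'] at ha
    exact ha.2

/-- The degree of a vertex of a quotient is the size of the edge cut around its preimage. -/
lemma deg_shrink {v : α'} {S : Set α} (hS : ∀ a ∈ V(B), φ a = v ↔ a ∈ S) (hSV : S ⊆ V(B)) :
    (B.shrink φ g hg).deg v = (B.bdry S).ncard := by
  rw [deg_eq_ncard_bdry shrink_loopless, ncard_bdry_shrink]
  congr 2
  ext a
  constructor
  · rintro ⟨h1, h2⟩; exact (hS a h1).1 h2
  · intro h; exact ⟨hSV h, (hS a (hSV h)).2 h⟩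

lemma deg_shrink_of_unique (hl : ∀ e x, ¬ B.IsLink e x x) {a : α} (ha : a ∈ V(B))
    (hu : ∀ b ∈ V(B), φ b = φ a → b = a) : (B.shrink φ g hg).deg (φ a) = B.deg a := by
  rw [deg_shrink (S := {a}), deg_eq_ncard_bdry hl]
  · intro b hb
    exact ⟨hu b hb, fun h => by rw [Set.mem_singleton_iff.1 h]⟩
  · simpa using ha

end Shrink

end Graph

namespace Graph

open TJoin

/-! ### The structure forced by Tutte's theorem -/

/-- Tutte's theorem, with the odd components of `Γ - S` presented as vertex sets. -/
lemma exists_odd_sets {W : Type*} [Finite W] (Γ : SimpleGraph W)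
    (h : ¬ ∃ M : Γ.Subgraph, M.IsPerfectMatching) :
    ∃ (S : Set W) (O : Set (Set W)),
      (∀ D ∈ O, Odd D.ncard ∧ Disjoint D S ∧ ∀ x ∈ D, ∀ y, Γ.Adj x y → y ∈ S ∨ y ∈ D) ∧
      (O.PairwiseDisjoint id) ∧ S.ncard < O.ncard ∧
      (Odd O.ncard ↔ Odd (Nat.card W - S.ncard)) := by
  classical
  rw [SimpleGraph.tutte] at h
  push Not at h
  obtain ⟨S, hS⟩ := h
  set H := ((⊤ : Γ.Subgraph).deleteVerts S) with hH
  have hverts : H.verts = Sᶜ := by simp [hH, Set.compl_eq_univ_sdiff]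
  have hmem : ∀ x, x ∈ H.verts ↔ x ∉ S := fun x => by rw [hverts]; rfl
  have hadjH : ∀ x y, x ∉ S → y ∉ S → Γ.Adj x y → H.Adj x y := by
    intro x y hx hy h
    rw [hH, SimpleGraph.Subgraph.deleteVerts_adj]
    exact ⟨trivial, hx, trivial, hy, h⟩
  set f : H.coe.ConnectedComponent → Set W := fun c => Subtype.val '' c.supp with hf
  have hinj : Function.Injective f := by
    intro c c' hcc
    exact SimpleGraph.ConnectedComponent.supp_injective
      (Set.image_injective.2 Subtype.val_injective hcc)
  have hcard : (f '' H.coe.oddComponents).ncard = H.coe.oddComponents.ncard :=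
    Set.ncard_image_of_injective _ hinj
  refine ⟨S, f '' H.coe.oddComponents, ?_, ?_, ?_, ?_⟩
  · rintro _ ⟨c, hc, rfl⟩
    refine ⟨?_, ?_, ?_⟩
    · rw [hf]; simp only
      rw [Set.ncard_image_of_injective _ Subtype.val_injective]; exact hc
    · rw [Set.disjoint_left]
      rintro _ ⟨x, _, rfl⟩ hxS
      exact (hmem _).1 x.2 hxS
    · rintro _ ⟨x, hx, rfl⟩ y hxy
      by_cases hy : y ∈ S
      · exact Or.inl hy
      · right
        have hyH : y ∈ H.verts := (hmem y).2 hy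
        have hadj : H.coe.Adj x ⟨y, hyH⟩ := hadjH _ _ ((hmem _).1 x.2) hy hxy
        refine ⟨⟨y, hyH⟩, ?_, rfl⟩
        exact (SimpleGraph.ConnectedComponent.mem_supp_congr_adj c hadj).1 hx
  · rintro _ ⟨c, hc, rfl⟩ _ ⟨c', hc', rfl⟩ hne
    have hcc : c ≠ c' := fun h => hne (by rw [h])
    rw [Function.onFun, id, id, Set.disjoint_left]
    rintro _ ⟨x, hx, rfl⟩ ⟨x', hx', hxx⟩
    have := Subtype.val_injective hxx
    subst this
    exact hcc (hx.symm.trans hx')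
  · rw [hcard]; exact hS
  · rw [hcard, SimpleGraph.odd_ncard_oddComponents]
    have : Nat.card H.verts = Nat.card W - S.ncard := by
      rw [hverts]
      change Set.ncard _ = _
      rw [Set.ncard_compl]
    rw [this]

variable {α β : Type*} {G : Graph α β}

/-- The vertices of degree `3` of `G`, with the simple graph of adjacencies among them. -/
def cubicPart (G : Graph α β) : SimpleGraph {v // v ∈ V(G) ∧ G.deg v = 3} where
  Adj a b := a ≠ b ∧ G.Adj a b
  symm := ⟨fun _ _ h => ⟨h.1.symm, h.2.symm⟩⟩
  loopless := ⟨fun _ h => h.1 rfl⟩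

/-- If all degrees are two or three and the vertices of degree three have a perfect matching, then
its complement is a spanning `2`-regular subgraph. -/
lemma ncard_le_f₂_of_isPerfectMatching [DecidableEq α] [DecidableEq β] {p q : β → α}
    (hends : G.Ends p q) {E : Finset β} (hE : E(G) = ↑E) (hV : V(G).Finite)
    (hl : ∀ e x, ¬ G.IsLink e x x) (hdeg : ∀ v ∈ V(G), G.deg v = 2 ∨ G.deg v = 3)
    {M : G.cubicPart.Subgraph} (hM : M.IsPerfectMatching) : V(G).ncard ≤ G.f₂ := by
  classical
  have hfinT : Finite {v // v ∈ V(G) ∧ G.deg v = 3} :=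
    (hV.subset fun v (hv : v ∈ V(G) ∧ G.deg v = 3) => hv.1).to_subtype
  have := Fintype.ofFinite {v // v ∈ V(G) ∧ G.deg v = 3}
  rw [SimpleGraph.Subgraph.isPerfectMatching_iff] at hM
  -- choose an edge of `G` for every pair of the matching
  have hchoice : ∀ s : Sym2 {v // v ∈ V(G) ∧ G.deg v = 3}, ∃ f : β, s ∈ M.edgeSet →
      f ∈ E ∧ s(p f, q f) = s.map Subtype.val := by
    intro s
    by_cases hs : s ∈ M.edgeSet
    · induction s with
      | h a b =>
        obtain ⟨-, f, hf⟩ := M.adj_sub (SimpleGraph.Subgraph.mem_edgeSet.1 hs)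
        obtain ⟨hfE, hf⟩ := hends.isLink_iff.1 hf
        refine ⟨f, fun _ => ⟨by rw [hE] at hfE; exact hfE, ?_⟩⟩
        simp only [Sym2.map_mk, Sym2.eq_iff]
        exact hf
    · by_cases hβ : Nonempty β
      · exact ⟨hβ.some, fun h => absurd h hs⟩
      · exfalso
        induction s with
        | h a b =>
          have ha := a.2.2
          have : IsEmpty β := not_nonempty_iff.1 hβ
          have h0 : E = ∅ := Finset.eq_empty_of_isEmpty E
          rw [hends.deg_eq hE, h0] at ha
          simp [dgr] at ha
  choose f hf using hchoice
  set ME : Finset (Sym2 {v // v ∈ V(G) ∧ G.deg v = 3}) :=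
    Finset.univ.filter (· ∈ M.edgeSet) with hME
  have hMEmem : ∀ s, s ∈ ME ↔ s ∈ M.edgeSet := fun s => by simp [hME]
  have hinj : Set.InjOn f (ME : Set (Sym2 _)) := by
    intro s hs t ht hst
    have h1 := (hf s ((hMEmem s).1 hs)).2
    have h2 := (hf t ((hMEmem t).1 ht)).2
    rw [hst, h2] at h1
    exact (Sym2.map.injective Subtype.val_injective h1).symm
  set J : Finset β := ME.image f with hJ
  have hJE : J ⊆ E := by
    intro e he
    obtain ⟨s, hs, rfl⟩ := Finset.mem_image.1 he
    exact (hf s ((hMEmem s).1 hs)).1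
  have hdgrJ : ∀ v, dgr p q J v = (ME.filter fun s => v ∈ s.map Subtype.val).card := by
    intro v
    rw [dgr, hJ, Finset.sum_image hinj, Finset.card_filter]
    refine Finset.sum_congr rfl fun s hs => ?_
    obtain ⟨hsE, hs⟩ := hf s ((hMEmem s).1 hs)
    simp only [← hs, Sym2.mem_iff]
    have hne : p (f s) ≠ q (f s) := by
      intro h
      have := hends (f s) (by rw [hE]; exact hsE)
      rw [← h] at this
      exact hl _ _ this
    by_cases h1 : p (f s) = v
    · by_cases h2 : q (f s) = v
      · exact absurd (h1.trans h2.symm) hne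
      · simp [h1, h2]
    · have h1' : ¬ v = p (f s) := fun h => h1 h.symm
      by_cases h2 : q (f s) = v
      · simp [h1, h2]
      · have h2' : ¬ v = q (f s) := fun h => h2 h.symm
        simp [h1, h2, h1', h2']
  have hdgrQ : ∀ v ∈ V(G), dgr p q (E \ J) v = 2 := by
    intro v hv
    have hsum : dgr p q (E \ J) v + dgr p q J v = dgr p q E v := Finset.sum_sdiff hJE
    rw [← hends.deg_eq hE] at hsum
    rcases hdeg v hv with h2 | h3
    · have h0 : dgr p q J v = 0 := by
        rw [hdgrJ, Finset.card_eq_zero, Finset.filter_eq_empty_iff]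
        intro s _ hvs
        obtain ⟨a, _, rfl⟩ := Sym2.mem_map.1 hvs
        have := a.2.2
        omega
      omega
    · have h1 : dgr p q J v = 1 := by
        obtain ⟨w, hw, huniq⟩ := hM ⟨v, hv, h3⟩
        rw [hdgrJ, Finset.card_eq_one]
        refine ⟨s(⟨v, hv, h3⟩, w), ?_⟩
        ext s
        simp only [Finset.mem_filter, Finset.mem_singleton, hMEmem]
        constructor
        · rintro ⟨hs, hvs⟩
          obtain ⟨a, ha, hav⟩ := Sym2.mem_map.1 hvs
          obtain ⟨b, rfl⟩ := Sym2.mem_iff_exists.1 ha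
          have haa : a = ⟨v, hv, h3⟩ := Subtype.ext hav
          subst haa
          rw [huniq b (SimpleGraph.Subgraph.mem_edgeSet.1 hs)]
        · rintro rfl
          exact ⟨SimpleGraph.Subgraph.mem_edgeSet.2 hw, by simp⟩
      omega
  have hnull : ∀ v ∉ V(G), dgr p q (E \ J) v = 0 := by
    intro v hv
    refine dgr_eq_zero fun e he => ?_
    have hl := hends e (by rw [hE]; exact (Finset.mem_sdiff.1 he).1)
    exact ⟨fun h => hv (h ▸ hl.left_mem), fun h => hv (h ▸ hl.right_mem)⟩
  have hbd : bd p q (E \ J) = 0 := by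
    rw [bd_eq_zero_iff]
    intro v
    by_cases hv : v ∈ V(G)
    · rw [hdgrQ v hv]; exact even_two
    · rw [hnull v hv]; exact Even.zero
  have h3 : G.IsSubcubic := fun v hv => by rcases hdeg v hv with h | h <;> omega
  have hle := (hends.f₂_spec hE hV h3).2 _ Finset.sdiff_subset hbd
  have hcount := sum_dgr (p := p) (q := q) (E \ J) hV.toFinset (by
    intro e he
    have hl := hends e (by rw [hE]; exact (Finset.mem_sdiff.1 he).1)
    simpa using ⟨hl.left_mem, hl.right_mem⟩)
  rw [Finset.sum_congr rfl (g := fun _ => 2) (fun v hv => hdgrQ v (by simpa using hv)),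
    Finset.sum_const, smul_eq_mul, ← Set.ncard_eq_toFinset_card _ hV] at hcount
  omega

/-- The structure of a `2`-edge-connected subcubic multigraph with three vertices of degree two and
no spanning `2`-regular subgraph: the set `X` contains these three vertices, the sets in `𝓓`
partition the other vertices, three edges leave each of them, and each edge lies inside a set in `𝓓`
or joins it to `X`. -/
structure Skeleton (B : Graph α β) (X : Set α) (𝓓 : Set (Set α)) : Prop where
  finite_vertexSet : V(B).Finite
  finite_edgeSet : E(B).Finite
  cutTwo : B.CutTwo
  loopless : ∀ e x, ¬ B.IsLink e x x
  vertexSet_eq : V(B) = X ∪ ⋃₀ 𝓓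
  disjoint_left : ∀ D ∈ 𝓓, Disjoint X D
  pairwiseDisjoint : 𝓓.PairwiseDisjoint id
  nonempty : ∀ D ∈ 𝓓, D.Nonempty
  ncard_bdry : ∀ D ∈ 𝓓, (B.bdry D).ncard = 3
  deg_eq : ∀ D ∈ 𝓓, ∀ v ∈ D, B.deg v = 3
  deg_left : ∀ x ∈ X, B.deg x = 2 ∨ B.deg x = 3
  ncard_two : {x | x ∈ X ∧ B.deg x = 2}.ncard = 3
  link_left : ∀ e x y, B.IsLink e x y → x ∈ X → ∃ D ∈ 𝓓, y ∈ D
  link_right : ∀ e x y, B.IsLink e x y → ∀ D ∈ 𝓓, x ∈ D → y ∈ X ∨ y ∈ D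

lemma deficit_eq_sum [DecidableEq α] [DecidableEq β] {p q : β → α} (hends : G.Ends p q)
    (hV : V(G).Finite) (hE : E(G).Finite) :
    G.deficit = ∑ v ∈ hV.toFinset, (3 - (G.deg v : ℤ)) := by
  have hE' : E(G) = ↑hE.toFinset := by simp
  have h := sum_dgr (p := p) (q := q) hE.toFinset hV.toFinset (by
    intro e he
    have hl := hends e (by simpa using he)
    simpa using ⟨hl.left_mem, hl.right_mem⟩)
  rw [Finset.sum_sub_distrib, Finset.sum_const, nsmul_eq_mul, deficit,
    Set.ncard_eq_toFinset_card _ hV, Set.ncard_eq_toFinset_card _ hE,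
    Finset.sum_congr rfl fun v _ => by rw [hends.deg_eq hE'], ← Nat.cast_sum, h]
  push_cast; ring

lemma coe_cut {p q : β → α} [DecidableEq α] [DecidableEq β] (hends : G.Ends p q) {E : Finset β}
    (hE : E(G) = ↑E) (S : Set α) : (↑(cut p q E (· ∈ S)) : Set β) = G.bdry S := by
  classical
  ext e
  simp only [cut, Finset.coe_filter, Set.mem_ofPred_eq]
  constructor
  · rintro ⟨he, hne⟩
    have hl := hends e (by rw [hE]; exact he)
    by_cases hp : p e ∈ S
    · exact ⟨_, hp, _, fun hq => hne ⟨fun _ => hq, fun _ => hp⟩, hl⟩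
    · refine ⟨_, ?_, _, hp, hl.symm⟩
      by_contra hq
      exact hne ⟨fun h => absurd h hp, fun h => absurd h hq⟩
  · rintro ⟨x, hx, y, hy, hl⟩
    obtain ⟨he, h⟩ := hends.isLink_iff.1 hl
    refine ⟨by rw [hE] at he; exact he, ?_⟩
    rcases h with ⟨rfl, rfl⟩ | ⟨rfl, rfl⟩
    · exact fun h => hy (h.1 hx)
    · exact fun h => hy (h.2 hx)

/-- A set of an odd number of vertices of degree three has an odd edge cut. -/
lemma odd_ncard_bdry (hV : V(G).Finite) (hE : E(G).Finite) {D : Set α} (hD : D ⊆ V(G))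
    (hdeg : ∀ v ∈ D, G.deg v = 3) (hodd : Odd D.ncard) : Odd (G.bdry D).ncard := by
  classical
  obtain ⟨v, hv⟩ : D.Nonempty := by
    rw [Set.nonempty_iff_ne_empty]; rintro rfl; simp at hodd
  have : Nonempty α := ⟨v⟩
  obtain ⟨p, q, hends⟩ := exists_ends G
  have hE' : E(G) = ↑hE.toFinset := by simp
  rw [← coe_cut hends hE', Set.ncard_coe_finset]
  have h := card_cut_cast (p := p) (q := q) hE.toFinset (· ∈ D) hV.toFinset (by
    intro e he
    have hl := hends e (by simpa using he)
    simpa using ⟨hl.left_mem, hl.right_mem⟩)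
  rw [Finset.sum_congr rfl (g := fun _ => (1 : ZMod 2))] at h
  · have hc : ((hV.toFinset.filter (· ∈ D)).card) = D.ncard := by
      rw [← Set.ncard_coe_finset]
      congr 1
      ext x
      simp only [Finset.coe_filter, Set.Finite.mem_toFinset, Set.mem_ofPred_eq]
      exact ⟨fun h => h.2, fun h => ⟨hD h, h⟩⟩
    rw [Finset.sum_const, hc, nsmul_eq_mul, mul_one] at h
    have h2 := (ZMod.natCast_eq_natCast_iff _ _ _).1 h
    rw [Nat.odd_iff] at hodd ⊢
    unfold Nat.ModEq at h2
    omega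
  · intro v hv
    rw [bd_eq_dgr, ← hends.deg_eq hE', hdeg v (Finset.mem_filter.1 hv).2]
    decide

/-- Tutte's condition fails by so much that the three vertices of degree two just make up for it:
every inequality in the count of the edges between the odd components and `X` is an equality. -/
theorem exists_skeleton (hV : V(G).Finite) (hE : E(G).Finite) (hcut : G.CutTwo)
    (hnt : V(G).Nontrivial) (h3 : G.IsSubcubic) (hd : G.deficit = 3)
    (hf : G.f₂ < V(G).ncard) : ∃ X 𝓓, Skeleton G X 𝓓 := by
  classical
  have : Nonempty α := hnt.nonempty.to_type
  obtain ⟨p, q, hends⟩ := exists_ends G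
  have hE' : E(G) = ↑hE.toFinset := by simp
  have hl := hcut.loopless hE hnt h3
  have hdeg : ∀ v ∈ V(G), G.deg v = 2 ∨ G.deg v = 3 := by
    intro v hv
    have h1 := hcut.two_le_deg hnt hl hv
    have h2 := h3 v hv
    omega
  set T : Set α := {v | v ∈ V(G) ∧ G.deg v = 3} with hT
  set U : Set α := {v | v ∈ V(G) ∧ G.deg v = 2} with hU
  have hTV : T ⊆ V(G) := fun v hv => hv.1
  have hUV : U ⊆ V(G) := fun v hv => hv.1
  have hTU : Disjoint T U := by
    rw [Set.disjoint_left]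
    rintro v ⟨_, h1⟩ ⟨_, h2⟩
    omega
  have hVTU : V(G) = T ∪ U := by
    ext v
    constructor
    · intro hv
      rcases hdeg v hv with h | h
      · exact Or.inr ⟨hv, h⟩
      · exact Or.inl ⟨hv, h⟩
    · rintro (h | h) <;> exact h.1
  have hUcard : U.ncard = 3 := by
    rw [deficit_eq_sum hends hV hE] at hd
    have h1 : ∑ v ∈ hV.toFinset, (3 - (G.deg v : ℤ)) =
        ∑ v ∈ hV.toFinset, if G.deg v = 2 then 1 else 0 := by
      refine Finset.sum_congr rfl fun v hv => ?_
      rcases hdeg v (by simpa using hv) with h | h <;> simp [h]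
    rw [h1, Finset.sum_boole] at hd
    have h2 : (↑(hV.toFinset.filter fun v => G.deg v = 2) : Set α) = U := by
      ext v; simp [hU]
    rw [← h2, Set.ncard_coe_finset]
    exact_mod_cast hd
  have hcardV : V(G).ncard = T.ncard + 3 := by
    rw [← hUcard, ← Set.ncard_union_eq hTU (hV.subset hTV) (hV.subset hUV), ← hVTU]
  have hTeven : T.ncard % 2 = 0 := by
    unfold deficit at hd
    omega
  have hfinT : Finite {v // v ∈ V(G) ∧ G.deg v = 3} := (hV.subset hTV).to_subtype
  obtain ⟨S₀, O, hO, hOdisj, hlt, hpar⟩ := exists_odd_sets G.cubicPart (by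
    rintro ⟨M, hM⟩
    have := ncard_le_f₂_of_isPerfectMatching hends hE' hV hl hdeg hM
    omega)
  have hcardW : Nat.card {v // v ∈ V(G) ∧ G.deg v = 3} = T.ncard := rfl
  have hS₀le : S₀.ncard ≤ T.ncard := by
    rw [← hcardW]; exact Set.ncard_le_card S₀
  have hOcard : S₀.ncard + 2 ≤ O.ncard := by
    rw [hcardW, Nat.odd_iff, Nat.odd_iff] at hpar
    omega
  set S : Set α := Subtype.val '' S₀ with hS
  have hScard : S.ncard = S₀.ncard := Set.ncard_image_of_injective _ Subtype.val_injective
  have hST : S ⊆ T := by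
    rintro _ ⟨v, _, rfl⟩; exact v.2
  set X := S ∪ U with hX
  have hXV : X ⊆ V(G) := Set.union_subset (hST.trans hTV) hUV
  set 𝓓 : Set (Set α) := (fun D => Subtype.val '' D) '' O with h𝓓
  have hinjim : Function.Injective
      (fun D : Set {v // v ∈ V(G) ∧ G.deg v = 3} => Subtype.val '' D) :=
    Set.image_injective.2 Subtype.val_injective
  have h𝓓card : 𝓓.ncard = O.ncard := Set.ncard_image_of_injective _ hinjim
  have hOfin : O.Finite := Set.toFinite O
  have h𝓓fin : 𝓓.Finite := hOfin.image _
  have hDT : ∀ D ∈ 𝓓, D ⊆ T := by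
    rintro _ ⟨D, _, rfl⟩ _ ⟨v, _, rfl⟩; exact v.2
  have hDodd : ∀ D ∈ 𝓓, Odd D.ncard := by
    rintro _ ⟨D, hD, rfl⟩
    rw [Set.ncard_image_of_injective _ Subtype.val_injective]
    exact (hO D hD).1
  have hDne : ∀ D ∈ 𝓓, D.Nonempty := by
    intro D hD
    rw [Set.nonempty_iff_ne_empty]; rintro rfl
    simpa using hDodd _ hD
  have hDX : ∀ D ∈ 𝓓, Disjoint X D := by
    intro D hD
    refine Set.disjoint_union_left.2 ⟨?_, (hTU.mono_left (hDT D hD)).symm⟩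
    obtain ⟨D, hD, rfl⟩ := hD
    exact ((Set.disjoint_image_iff Subtype.val_injective).2 (hO D hD).2.1).symm
  have hDdisj : 𝓓.PairwiseDisjoint id := by
    rintro _ ⟨D, hD, rfl⟩ _ ⟨D', hD', rfl⟩ hne
    have hne' : D ≠ D' := fun h => hne (by rw [h])
    exact (Set.disjoint_image_iff Subtype.val_injective).2 (hOdisj hD hD' hne')
  have hDlink : ∀ e x y, G.IsLink e x y → ∀ D ∈ 𝓓, x ∈ D → y ∈ X ∨ y ∈ D := by
    rintro e x y hxy _ ⟨D, hD, rfl⟩ ⟨v, hv, rfl⟩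
    rcases hdeg y hxy.right_mem with h | h
    · exact Or.inl (Or.inr ⟨hxy.right_mem, h⟩)
    · have hadj : G.cubicPart.Adj v ⟨y, hxy.right_mem, h⟩ :=
        ⟨fun h' => by rw [h'] at hxy; exact hl _ _ hxy, e, hxy⟩
      rcases (hO D hD).2.2 v hv _ hadj with h' | h'
      · exact Or.inl (Or.inl ⟨_, h', rfl⟩)
      · exact Or.inr ⟨_, h', rfl⟩
  -- count the edges at `X`
  set bF : Set α → Finset β := fun S => cut p q hE.toFinset (· ∈ S) with hbF
  have hbFcoe : ∀ S, (↑(bF S) : Set β) = G.bdry S := fun S => coe_cut hends hE' S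
  have hbFcard : ∀ S, (bF S).card = (G.bdry S).ncard := fun S => by
    rw [← hbFcoe, Set.ncard_coe_finset]
  have hbFmem : ∀ S e, e ∈ bF S ↔ e ∈ G.bdry S := fun S e => by
    rw [← hbFcoe]; rfl
  have hb3 : ∀ D ∈ 𝓓, 3 ≤ (bF D).card := by
    intro D hD
    rw [hbFcard]
    have h1 := odd_ncard_bdry hV hE ((hDT D hD).trans hTV) (fun v hv => (hDT D hD hv).2)
      (hDodd D hD)
    have h2 := hcut D ((hDT D hD).trans hTV) (hDne D hD) (by
      rintro rfl
      obtain ⟨u, hu⟩ : U.Nonempty := by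
        rw [Set.nonempty_iff_ne_empty]; rintro h; rw [h] at hUcard; simp at hUcard
      exact Set.disjoint_left.1 hTU (hDT _ hD (hUV hu)) hu)
    rw [Nat.odd_iff] at h1
    omega
  set 𝓓F := h𝓓fin.toFinset with h𝓓F
  have h𝓓Fmem : ∀ D, D ∈ 𝓓F ↔ D ∈ 𝓓 := fun D => by simp [h𝓓F]
  set XF := (hV.subset hXV).toFinset with hXF
  have hXFmem : ∀ x, x ∈ XF ↔ x ∈ X := fun x => by simp [hXF]
  have hend : ∀ D ∈ 𝓓, ∀ e ∈ G.bdry D, ∃ x ∈ X, ∃ y ∈ D, G.IsLink e x y := by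
    rintro D hD e ⟨y, hy, x, hx, hxy⟩
    rcases hDlink e y x hxy D hD hy with h | h
    · exact ⟨x, h, y, hy, hxy.symm⟩
    · exact absurd h hx
  have hdisjb : (↑𝓓F : Set (Set α)).PairwiseDisjoint bF := by
    intro D hD D' hD' hne
    have hD := (h𝓓Fmem D).1 hD
    have hD' := (h𝓓Fmem D').1 hD'
    rw [Function.onFun, Finset.disjoint_left]
    intro e he he'
    obtain ⟨x, hx, y, hy, hxy⟩ := hend D hD e ((hbFmem _ _).1 he)
    obtain ⟨x', hx', y', hy', hxy'⟩ := hend D' hD' e ((hbFmem _ _).1 he')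
    rcases hxy.eq_and_eq_or_eq_and_eq hxy' with ⟨rfl, rfl⟩ | ⟨rfl, rfl⟩
    · exact Set.disjoint_left.1 (hDdisj hD hD' hne) hy hy'
    · exact Set.disjoint_left.1 (hDX D hD) hx' hy
  set P := 𝓓F.biUnion bF with hP
  set Q := XF.biUnion (fun x => bF {x}) with hQ
  have hPcard : P.card = ∑ D ∈ 𝓓F, (bF D).card := Finset.card_biUnion hdisjb
  have hPQ : P ⊆ Q := by
    intro e he
    obtain ⟨D, hD, he⟩ := Finset.mem_biUnion.1 he
    have hD := (h𝓓Fmem D).1 hD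
    obtain ⟨x, hx, y, hy, hxy⟩ := hend D hD e ((hbFmem _ _).1 he)
    refine Finset.mem_biUnion.2 ⟨x, (hXFmem x).2 hx, (hbFmem _ _).2 ⟨x, rfl, y, ?_, hxy⟩⟩
    rintro rfl
    exact hl _ _ hxy
  have hQcard : Q.card ≤ 3 * S.ncard + 6 := by
    have h1 : Q.card ≤ ∑ x ∈ XF, (bF {x}).card := Finset.card_biUnion_le
    have h2 : ∀ x ∈ XF, (bF {x}).card = 3 - (if G.deg x = 2 then 1 else 0) := by
      intro x hx
      rw [hbFcard, ← deg_eq_ncard_bdry hl]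
      rcases hdeg x (hXV ((hXFmem x).1 hx)) with h | h <;> simp [h]
    have hSU : Disjoint S U := hTU.mono_left hST
    have hXF' : XF = (hV.subset (hST.trans hTV)).toFinset ∪ (hV.subset hUV).toFinset := by
      ext x; simp [hXF, hX]
    have hdisj : Disjoint (hV.subset (hST.trans hTV)).toFinset (hV.subset hUV).toFinset := by
      rw [Set.Finite.disjoint_toFinset]; exact hSU
    rw [hXF', Finset.sum_union hdisj] at h1
    have h4 : ∑ x ∈ (hV.subset (hST.trans hTV)).toFinset, (bF {x}).card = 3 * S.ncard := by
      rw [Finset.sum_congr rfl (g := fun _ => 3), Finset.sum_const, smul_eq_mul, mul_comm,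
        ← Set.ncard_eq_toFinset_card S (hV.subset (hST.trans hTV))]
      intro x hx
      rw [hbFcard, ← deg_eq_ncard_bdry hl]
      exact (hST (by simpa using hx)).2
    have h5 : ∑ x ∈ (hV.subset hUV).toFinset, (bF {x}).card = 2 * U.ncard := by
      rw [Finset.sum_congr rfl (g := fun _ => 2), Finset.sum_const, smul_eq_mul, mul_comm,
        ← Set.ncard_eq_toFinset_card U (hV.subset hUV)]
      intro x hx
      rw [hbFcard, ← deg_eq_ncard_bdry hl]
      have : x ∈ U := by simpa using hx
      exact this.2
    rw [h4, h5, hUcard] at h1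
    omega
  have h𝓓Fcard : 𝓓F.card = O.ncard := by rw [← h𝓓card, Set.ncard_eq_toFinset_card _ h𝓓fin]
  have hPge : 3 * 𝓓F.card ≤ P.card := by
    rw [hPcard, mul_comm, ← smul_eq_mul, ← Finset.sum_const]
    exact Finset.sum_le_sum fun D hD => hb3 D ((h𝓓Fmem D).1 hD)
  have hPQcard := Finset.card_le_card hPQ
  have hPQeq : P = Q := Finset.eq_of_subset_of_card_le hPQ (by omega)
  have hbeq : ∀ D ∈ 𝓓, (G.bdry D).ncard = 3 := by
    have h1 : ∑ D ∈ 𝓓F, 3 = ∑ D ∈ 𝓓F, (bF D).card := by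
      rw [Finset.sum_const, smul_eq_mul]; omega
    intro D hD
    have h2 := (Finset.sum_eq_sum_iff_of_le
      (fun D hD => hb3 D ((h𝓓Fmem D).1 hD))).1 h1 D ((h𝓓Fmem D).2 hD)
    rw [← hbFcard]; exact h2.symm
  have hXlink : ∀ e x y, G.IsLink e x y → x ∈ X → ∃ D ∈ 𝓓, y ∈ D := by
    intro e x y hxy hx
    have h1 : e ∈ Q := by
      refine Finset.mem_biUnion.2 ⟨x, (hXFmem x).2 hx, (hbFmem _ _).2 ⟨x, rfl, y, ?_, hxy⟩⟩
      rintro rfl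
      exact hl _ _ hxy
    rw [← hPQeq] at h1
    obtain ⟨D, hD, he⟩ := Finset.mem_biUnion.1 h1
    have hD := (h𝓓Fmem D).1 hD
    obtain ⟨x', hx', y', hy', hxy'⟩ := hend D hD e ((hbFmem _ _).1 he)
    refine ⟨D, hD, ?_⟩
    rcases hxy.eq_and_eq_or_eq_and_eq hxy' with ⟨rfl, rfl⟩ | ⟨rfl, rfl⟩
    · exact hy'
    · exact absurd hy' (Set.disjoint_left.1 (hDX D hD) hx)
  have hVeq : V(G) = X ∪ ⋃₀ 𝓓 := by
    refine Set.Subset.antisymm ?_ (Set.union_subset hXV (Set.sUnion_subset fun D hD =>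
      (hDT D hD).trans hTV))
    -- a component of `G - X` of even order would be separated from the rest of `G`
    by_contra hcon
    set Z := V(G) \ (X ∪ ⋃₀ 𝓓) with hZ
    have hZne : Z.Nonempty := by
      obtain ⟨v, hv, hvn⟩ := Set.not_subset.1 hcon
      exact ⟨v, hv, hvn⟩
    have h2 := hcut Z Set.sdiff_subset hZne (by
      intro h
      obtain ⟨u, hu⟩ : U.Nonempty := by
        rw [Set.nonempty_iff_ne_empty]; rintro h; rw [h] at hUcard; simp at hUcard
      have : u ∈ Z := by rw [h]; exact hUV hu
      exact this.2 (Or.inl (Or.inr hu)))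
    have h4 : G.bdry Z = ∅ := by
      ext e
      simp only [Set.mem_empty_iff_false, iff_false]
      rintro ⟨x, hx, y, hy, hxy⟩
      have hyX : y ∈ X ∪ ⋃₀ 𝓓 := by
        by_contra h; exact hy ⟨hxy.right_mem, h⟩
      rcases hyX with h | ⟨D, hD, hyD⟩
      · obtain ⟨D, hD, hxD⟩ := hXlink e y x hxy.symm h
        exact hx.2 (Or.inr ⟨D, hD, hxD⟩)
      · rcases hDlink e y x hxy.symm D hD hyD with h | h
        · exact hx.2 (Or.inl h)
        · exact hx.2 (Or.inr ⟨D, hD, h⟩)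
    rw [h4] at h2
    simp at h2
  refine ⟨X, 𝓓, hV, hE, hcut, hl, hVeq, hDX, hDdisj, hDne, hbeq, fun D hD v hv => (hDT D hD hv).2,
    fun x hx => hdeg x (hXV hx), ?_, hXlink, hDlink⟩
  rw [← hUcard]
  congr 1
  ext x
  constructor
  · rintro ⟨hx, hd⟩; exact ⟨hXV hx, hd⟩
  · intro hx; exact ⟨Or.inr hx, hx.2⟩

end Graph

namespace Graph

open TJoin

/-! ### From the structure to the family `𝒢` -/

section Family

variable {α β α' β' : Type*}

/-- Relabelling a loopless multigraph gives an isomorphic one. -/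
lemma isIsomorphic_shrink {B : Graph α β} {φ : α → α'} {g : β → β'} (hg : Set.InjOn g E(B))
    (hl : ∀ e x, ¬ B.IsLink e x x) (hφ : Set.InjOn φ V(B)) :
    B.IsIsomorphic (B.shrink φ g hg) := by
  have hE : g '' E(B) = E(B.shrink φ g hg) := by
    refine Set.Subset.antisymm ?_ edgeSet_shrink_subset
    rintro _ ⟨e, he, rfl⟩
    obtain ⟨x, y, hxy⟩ := exists_isLink_of_mem_edgeSet he
    have : (B.shrink φ g hg).IsLink (g e) (φ x) (φ y) := by
      refine ⟨e, rfl, x, y, hxy, fun h => ?_, rfl, rfl⟩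
      have := hφ hxy.left_mem hxy.right_mem h
      subst this
      exact hl _ _ hxy
    exact this.edge_mem
  refine ⟨Equiv.Set.imageOfInjOn φ V(B) hφ,
    (Equiv.Set.imageOfInjOn g E(B) hg).trans (Equiv.setCongr hE), ?_⟩
  intro e x y
  change _ ↔ (B.shrink φ g hg).IsLink (g e) (φ x) (φ y)
  constructor
  · intro hxy
    refine ⟨e, rfl, x, y, hxy, fun h => ?_, rfl, rfl⟩
    have := hφ x.2 y.2 h
    rw [this] at hxy
    exact hl _ _ hxy
  · rintro ⟨e', he, a, b, hab, -, ha, hb⟩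
    have h1 := hg hab.edge_mem e.2 he
    have h2 := hφ hab.left_mem x.2 ha
    have h3 := hφ hab.right_mem y.2 hb
    rw [← h1, ← h2, ← h3]
    exact hab

/-- Quotients that are injective up to contracting some sets in `𝓓` preserve the structure. -/
lemma Skeleton.shrink {B : Graph α β} {X : Set α} {𝓓 : Set (Set α)} (h : Skeleton B X 𝓓)
    {φ : α → α'} {g : β → β'} (hg : Set.InjOn g E(B))
    (hφ : ∀ a ∈ V(B), (∀ b ∈ V(B), φ b = φ a → b = a) ∨
      ∃ D ∈ 𝓓, a ∈ D ∧ ∀ b ∈ V(B), (φ b = φ a ↔ b ∈ D)) :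
    Skeleton (B.shrink φ g hg) (φ '' X) ((fun D => φ '' D) '' 𝓓) := by
  have hXV : ∀ x ∈ X, x ∈ V(B) := fun x hx => by rw [h.vertexSet_eq]; exact Or.inl hx
  have hDV : ∀ D ∈ 𝓓, ∀ x ∈ D, x ∈ V(B) := fun D hD x hx => by
    rw [h.vertexSet_eq]; exact Or.inr ⟨D, hD, hx⟩
  have huniq : ∀ D ∈ 𝓓, ∀ D' ∈ 𝓓, ∀ x ∈ D, x ∈ D' → D = D' := by
    intro D hD D' hD' x hx hx'
    by_contra hne
    exact Set.disjoint_left.1 (h.pairwiseDisjoint hD hD' hne) hx hx'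
  have hX1 : ∀ x ∈ X, ∀ b ∈ V(B), φ b = φ x → b = x := by
    intro x hx b hb hbx
    rcases hφ x (hXV x hx) with h1 | ⟨D, hD, hxD, _⟩
    · exact h1 b hb hbx
    · exact absurd hxD (Set.disjoint_left.1 (h.disjoint_left D hD) hx)
  have hD1 : ∀ D ∈ 𝓓, ∀ a ∈ D, ∀ b ∈ V(B), φ b = φ a → b ∈ D := by
    intro D hD a ha b hb hba
    rcases hφ a (hDV D hD a ha) with h1 | ⟨D', hD', haD', h1⟩
    · rw [h1 b hb hba]; exact ha
    · have := huniq D hD D' hD' a ha haD'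
      subst this
      exact (h1 b hb).1 hba
  have hDim : ∀ D ∈ 𝓓, ∀ a ∈ V(B), φ a ∈ φ '' D → a ∈ D := by
    rintro D hD a ha ⟨d, hd, hda⟩
    exact hD1 D hD d hd a ha hda.symm
  have hXim : ∀ a ∈ V(B), φ a ∈ φ '' X → a ∈ X := by
    rintro a ha ⟨x, hx, hxa⟩
    rw [hX1 x hx a ha hxa.symm]; exact hx
  have hdegX : ∀ x ∈ X, (B.shrink φ g hg).deg (φ x) = B.deg x := fun x hx =>
    deg_shrink_of_unique h.loopless (hXV x hx) (hX1 x hx)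
  have hbdryD : ∀ D ∈ 𝓓, B.bdry {a | a ∈ V(B) ∧ φ a ∈ φ '' D} = B.bdry D := by
    intro D hD
    congr 1
    ext a
    exact ⟨fun ha => hDim D hD a ha.1 ha.2, fun ha => ⟨hDV D hD a ha, a, ha, rfl⟩⟩
  refine ⟨h.finite_vertexSet.image φ, (h.finite_edgeSet.image g).subset edgeSet_shrink_subset,
    h.cutTwo.shrink, shrink_loopless, ?_, ?_, ?_, ?_, ?_, ?_, ?_, ?_, ?_, ?_⟩
  · rw [vertexSet_shrink, h.vertexSet_eq, Set.image_union, Set.sUnion_eq_biUnion, Set.image_iUnion₂,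
      Set.sUnion_image]
  · rintro _ ⟨D, hD, rfl⟩
    rw [Set.disjoint_left]
    rintro _ ⟨x, hx, rfl⟩ hxD
    exact Set.disjoint_left.1 (h.disjoint_left D hD) hx (hDim D hD x (hXV x hx) hxD)
  · rintro _ ⟨D, hD, rfl⟩ _ ⟨D', hD', rfl⟩ hne
    rw [Function.onFun, id, id, Set.disjoint_left]
    rintro _ ⟨x, hx, rfl⟩ hxD
    exact hne (by rw [huniq D hD D' hD' x hx (hDim D' hD' x (hDV D hD x hx) hxD)])
  · rintro _ ⟨D, hD, rfl⟩
    exact (h.nonempty D hD).image φ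
  · rintro _ ⟨D, hD, rfl⟩
    rw [ncard_bdry_shrink, hbdryD D hD, h.ncard_bdry D hD]
  · rintro _ ⟨D, hD, rfl⟩ _ ⟨a, ha, rfl⟩
    rcases hφ a (hDV D hD a ha) with h1 | ⟨D', hD', haD', h1⟩
    · rw [deg_shrink_of_unique h.loopless (hDV D hD a ha) h1, h.deg_eq D hD a ha]
    · have := huniq D hD D' hD' a ha haD'
      subst this
      rw [deg_shrink h1 (hDV D hD), h.ncard_bdry D hD]
  · rintro _ ⟨x, hx, rfl⟩
    rw [hdegX x hx]; exact h.deg_left x hx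
  · have : {x | x ∈ φ '' X ∧ (B.shrink φ g hg).deg x = 2} = φ '' {x | x ∈ X ∧ B.deg x = 2} := by
      ext v
      constructor
      · rintro ⟨⟨x, hx, rfl⟩, hd⟩
        rw [hdegX x hx] at hd
        exact ⟨x, ⟨hx, hd⟩, rfl⟩
      · rintro ⟨x, ⟨hx, hd⟩, rfl⟩
        exact ⟨⟨x, hx, rfl⟩, by rw [hdegX x hx]; exact hd⟩
    rw [this, Set.InjOn.ncard_image, h.ncard_two]
    intro x hx y hy hxy
    exact hX1 y hy.1 x (hXV x hx.1) hxy
  · rintro _ _ _ ⟨e, rfl, a, b, hab, -, rfl, rfl⟩ haX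
    obtain ⟨D, hD, hbD⟩ := h.link_left e a b hab (hXim a hab.left_mem haX)
    exact ⟨_, ⟨D, hD, rfl⟩, b, hbD, rfl⟩
  · rintro _ _ _ ⟨e, rfl, a, b, hab, -, rfl, rfl⟩ _ ⟨D, hD, rfl⟩ haD
    rcases h.link_right e a b hab D hD (hDim D hD a hab.left_mem haD) with h' | h'
    · exact Or.inl ⟨b, h', rfl⟩
    · exact Or.inr ⟨b, h', rfl⟩

open scoped Classical in
/-- The map contracting `D` to `y`. -/
noncomputable def contr (D : Set α) (y : α) (a : α) : α := if a ∈ D then y else a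

lemma contr_of_mem {D : Set α} {y a : α} (h : a ∈ D) : contr D y a = y := if_pos h

lemma contr_of_notMem {D : Set α} {y a : α} (h : a ∉ D) : contr D y a = a := if_neg h

lemma contr_eq_iff {D : Set α} {y a b : α} (hab : a ∉ D) (hay : a ≠ y) :
    contr D y b = a ↔ b = a := by
  by_cases hb : b ∈ D
  · rw [contr_of_mem hb]
    exact ⟨fun h => absurd h.symm hay, fun h => absurd (h ▸ hb) hab⟩
  · rw [contr_of_notMem hb]

open scoped Classical in
/-- Contracting `D`, respectively its complement, gives two multigraphs `A` and `F`; exploding the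
contracted vertex of `A` by means of `F` recovers the original multigraph. The edges of the cut
receive new names in `F`. -/
lemma isExplosion_shrink {B : Graph ℕ ℕ} {D : Set ℕ} (hD : D ⊆ V(B)) (hDne : D.Nonempty)
    (hDV : (V(B) \ D).Nonempty) {y z N : ℕ} (hy : y ∉ V(B)) (hz : z ∉ V(B)) (hyz : y ≠ z)
    (hl : ∀ e x, ¬ B.IsLink e x x) (hN : ∀ e ∈ E(B), e < N)
    (hg : Set.InjOn (fun e => if e ∈ B.bdry D then e + N else e) E(B)) :
    IsExplosion (B.shrink (contr D y) id (Set.injOn_id _)) y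
      (B.shrink (contr (V(B) \ D) z) _ hg) z B := by
  set g : ℕ → ℕ := fun e => if e ∈ B.bdry D then e + N else e with hgdef
  set A := B.shrink (contr D y) id (Set.injOn_id _) with hA
  set F := B.shrink (contr (V(B) \ D) z) g hg with hF
  have hne : ∀ a ∈ V(B), a ≠ y ∧ a ≠ z := fun a ha =>
    ⟨fun h => hy (h ▸ ha), fun h => hz (h ▸ ha)⟩
  have c1 : ∀ a, a ∈ D → contr D y a = y := fun a => contr_of_mem
  have c2 : ∀ a, a ∉ D → contr D y a = a := fun a => contr_of_notMem
  have c3 : ∀ a, a ∈ D → contr (V(B) \ D) z a = a := fun a ha => contr_of_notMem fun h => h.2 ha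
  have c4 : ∀ a ∈ V(B), a ∉ D → contr (V(B) \ D) z a = z := fun a ha h => contr_of_mem ⟨ha, h⟩
  have hAy : ∀ e p, A.IsLink e p y ↔ p ∉ D ∧ ∃ b ∈ D, B.IsLink e p b := by
    intro e p
    constructor
    · rintro ⟨e', rfl, a, b, hab, hne', rfl, hb⟩
      have hbD : b ∈ D := by
        by_contra hbD
        rw [c2 b hbD] at hb
        exact (hne b hab.right_mem).1 hb
      have haD : a ∉ D := fun haD => hne' (by rw [c1 a haD, c1 b hbD])
      rw [c2 a haD]
      exact ⟨haD, b, hbD, hab⟩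
    · rintro ⟨hp, b, hb, hpb⟩
      refine ⟨e, rfl, p, b, hpb, ?_, c2 p hp, c1 b hb⟩
      rw [c2 p hp, c1 b hb]
      exact (hne p hpb.left_mem).1
  have hFz : ∀ e p, e ∈ E(B) → (F.IsLink (g e) p z ↔ p ∈ D ∧ ∃ b, b ∉ D ∧ B.IsLink e p b) := by
    intro e p heB
    constructor
    · rintro ⟨e', he', a, b, hab, hne', rfl, hb⟩
      have := hg hab.edge_mem heB he'
      subst this
      have hbD : b ∉ D := by
        intro hbD
        rw [c3 b hbD] at hb
        exact (hne b hab.right_mem).2 hb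
      have haD : a ∈ D := by
        by_contra haD
        exact hne' (by rw [c4 a hab.left_mem haD, c4 b hab.right_mem hbD])
      rw [c3 a haD]
      exact ⟨haD, b, hbD, hab⟩
    · rintro ⟨hp, b, hb, hpb⟩
      refine ⟨e, rfl, p, b, hpb, ?_, c3 p hp, c4 b hpb.right_mem hb⟩
      rw [c3 p hp, c4 b hpb.right_mem hb]
      exact (hne p hpb.left_mem).2
  have hgin : ∀ e a b, B.IsLink e a b → a ∈ D → b ∈ D → g e = e := by
    intro e a b hab ha hb
    apply if_neg
    rintro ⟨x, hx, w, hw, hxw⟩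
    rcases hab.eq_and_eq_or_eq_and_eq hxw with ⟨rfl, rfl⟩ | ⟨rfl, rfl⟩
    · exact hw hb
    · exact hw ha
  have hgcut : ∀ e, e ∈ B.bdry D → g e = e + N := fun e he => if_pos he
  refine ⟨?_, ?_, ?_, ?_, ?_, g, ?_, ?_⟩
  · obtain ⟨d, hd⟩ := hDne
    exact ⟨d, hD hd, c1 d hd⟩
  · obtain ⟨d, hd⟩ := hDV
    exact ⟨d, hd.1, contr_of_mem hd⟩
  · rw [Set.disjoint_left]
    rintro _ ⟨a, ha, rfl⟩ ⟨b, hb, hab⟩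
    by_cases haD : a ∈ D <;> by_cases hbD : b ∈ D
    · rw [c1 a haD, c3 b hbD] at hab; exact (hne b hb).1 hab
    · rw [c1 a haD, c4 b hb hbD] at hab; exact hyz hab.symm
    · rw [c2 a haD, c3 b hbD] at hab; exact haD (hab ▸ hbD)
    · rw [c2 a haD, c4 b hb hbD] at hab; exact (hne a ha).2 hab.symm
  · rw [Set.disjoint_left]
    intro e heA heF
    obtain ⟨-, -, e₁, rfl, a, b, hab, hne1, -, -⟩ := exists_isLink_of_mem_edgeSet heA
    obtain ⟨-, -, e₂, he, c, d, hcd, hne2, -, -⟩ := exists_isLink_of_mem_edgeSet heF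
    simp only [id] at he
    by_cases hcut : e₂ ∈ B.bdry D
    · rw [hgcut e₂ hcut] at he
      have := hN e₁ hab.edge_mem
      omega
    · have : g e₂ = e₂ := if_neg hcut
      rw [this] at he
      subst he
      have hin : a ∈ D ↔ b ∈ D := by
        constructor
        · intro ha; by_contra hb; exact hcut ⟨a, ha, b, hb, hab⟩
        · intro hb; by_contra ha; exact hcut ⟨b, hb, a, ha, hab.symm⟩
      have haD : a ∉ D := fun ha => hne1 (by rw [c1 a ha, c1 b (hin.1 ha)])
      have hbD : b ∉ D := fun hb => haD (hin.2 hb)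
      apply hne2
      rcases hab.eq_and_eq_or_eq_and_eq hcd with ⟨rfl, rfl⟩ | ⟨rfl, rfl⟩
      · rw [c4 _ hab.left_mem haD, c4 _ hab.right_mem hbD]
      · rw [c4 _ hab.left_mem haD, c4 _ hab.right_mem hbD]
  · ext v
    constructor
    · intro hv
      by_cases hvD : v ∈ D
      · exact Or.inr ⟨⟨v, hv, c3 v hvD⟩, (hne v hv).2⟩
      · exact Or.inl ⟨⟨v, hv, c2 v hvD⟩, (hne v hv).1⟩
    · rintro (⟨⟨a, ha, rfl⟩, hay⟩ | ⟨⟨a, ha, rfl⟩, haz⟩)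
      · by_cases haD : a ∈ D
        · exact absurd (c1 a haD) hay
        · rw [c2 a haD]; exact ha
      · by_cases haD : a ∈ D
        · rw [c3 a haD]; exact ha
        · exact absurd (c4 a ha haD) haz
  · refine ⟨?_, ?_, ?_⟩
    · rintro e ⟨p, hp⟩
      obtain ⟨hpD, b, hb, hpb⟩ := (hAy e p).1 hp.symm
      exact ⟨b, ((hFz e b hpb.edge_mem).2 ⟨hb, p, hpD, hpb.symm⟩).symm⟩
    · rintro e ⟨p, hp⟩ e' ⟨p', hp'⟩ hee
      obtain ⟨-, b, -, hpb⟩ := (hAy e p).1 hp.symm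
      obtain ⟨-, b', -, hpb'⟩ := (hAy e' p').1 hp'.symm
      exact hg hpb.edge_mem hpb'.edge_mem hee
    · rintro e ⟨p, hp⟩
      have hp' := hp.symm
      obtain ⟨e', rfl, a, b, hab, -⟩ := hp
      obtain ⟨hpD, c, hc, hpc⟩ := (hFz e' p hab.edge_mem).1 hp'
      exact ⟨e', ⟨c, ((hAy e' c).2 ⟨hc, p, hpD, hpc.symm⟩).symm⟩, rfl⟩
  · intro e p q
    constructor
    · intro hpq
      have hp := hne p hpq.left_mem
      have hq := hne q hpq.right_mem
      by_cases hpD : p ∈ D <;> by_cases hqD : q ∈ D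
      · refine Or.inr (Or.inl ⟨⟨e, hgin e p q hpq hpD hqD, p, q, hpq, ?_, c3 p hpD, c3 q hqD⟩,
          hp.2, hq.2⟩)
        rw [c3 p hpD, c3 q hqD]
        rintro rfl
        exact hl _ _ hpq
      · exact Or.inr (Or.inr (Or.inr ⟨(hAy e q).2 ⟨hqD, p, hpD, hpq.symm⟩,
          (hFz e p hpq.edge_mem).2 ⟨hpD, q, hqD, hpq⟩⟩))
      · exact Or.inr (Or.inr (Or.inl ⟨(hAy e p).2 ⟨hpD, q, hqD, hpq⟩,
          (hFz e q hpq.edge_mem).2 ⟨hqD, p, hpD, hpq.symm⟩⟩))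
      · refine Or.inl ⟨⟨e, rfl, p, q, hpq, ?_, c2 p hpD, c2 q hqD⟩, hp.1, hq.1⟩
        rw [c2 p hpD, c2 q hqD]
        rintro rfl
        exact hl _ _ hpq
    · have key : ∀ p q, A.IsLink e p y → F.IsLink (g e) q z → B.IsLink e p q := by
        intro p q h1 h2
        obtain ⟨hpD, b, hb, hpb⟩ := (hAy e p).1 h1
        obtain ⟨hqD, c, hc, hqc⟩ := (hFz e q hpb.edge_mem).1 h2
        rcases hpb.eq_and_eq_or_eq_and_eq hqc with ⟨rfl, rfl⟩ | ⟨rfl, rfl⟩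
        · exact absurd hqD hpD
        · exact hpb
      rintro (⟨⟨e', rfl, a, b, hab, hne', rfl, rfl⟩, h1, h2⟩ |
        ⟨⟨e', rfl, a, b, hab, hne', rfl, rfl⟩, h1, h2⟩ | ⟨h1, h2⟩ | ⟨h1, h2⟩)
      · have ha : a ∉ D := fun h => h1 (c1 a h)
        have hb : b ∉ D := fun h => h2 (c1 b h)
        rw [c2 a ha, c2 b hb]; exact hab
      · have ha : a ∈ D := by by_contra h; exact h1 (c4 a hab.left_mem h)
        have hb : b ∈ D := by by_contra h; exact h2 (c4 b hab.right_mem h)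
        rw [c3 a ha, c3 b hb, hgin e' a b hab ha hb]; exact hab
      · exact key p q h1 h2
      · exact (key q p h1 h2).symm

end Family

end Graph

namespace Graph

open TJoin

/-! ### Adding a vertex -/

section AddVertex

/-- The multigraph `B` together with a new vertex `y` joined to every vertex `u ∈ U` by a new edge
with the name `N + u`. -/
def addVertex (B : Graph ℕ ℕ) (U : Set ℕ) (y N : ℕ) (hU : U ⊆ V(B)) (hy : y ∉ V(B))
    (hN : ∀ e ∈ E(B), e < N) : Graph ℕ ℕ where
  vertexSet := insert y V(B)
  IsLink e p q := B.IsLink e p q ∨ ∃ u ∈ U, e = N + u ∧ ((p = u ∧ q = y) ∨ (p = y ∧ q = u))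
  isLink_symm := by
    intro e _
    constructor
    rintro p q (h | ⟨u, hu, he, h | h⟩)
    · exact Or.inl h.symm
    · exact Or.inr ⟨u, hu, he, Or.inr ⟨h.2, h.1⟩⟩
    · exact Or.inr ⟨u, hu, he, Or.inl ⟨h.2, h.1⟩⟩
  eq_or_eq_of_isLink_of_isLink := by
    rintro e p q r s (h | ⟨u, hu, he, h⟩) (h' | ⟨u', hu', he', h'⟩)
    · exact h.left_eq_or_eq h'
    · have := hN e h.edge_mem; omega
    · have := hN e h'.edge_mem; omega
    · have : u = u' := by omega
      subst this
      rcases h with ⟨rfl, rfl⟩ | ⟨rfl, rfl⟩ <;> rcases h' with ⟨rfl, rfl⟩ | ⟨rfl, rfl⟩ <;> simp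
  left_mem_of_isLink := by
    rintro e p q (h | ⟨u, hu, he, ⟨rfl, -⟩ | ⟨rfl, -⟩⟩)
    · exact Set.mem_insert_of_mem _ h.left_mem
    · exact Set.mem_insert_of_mem _ (hU hu)
    · exact Set.mem_insert _ _

variable {B : Graph ℕ ℕ} {U : Set ℕ} {y N : ℕ} {hU : U ⊆ V(B)} {hy : y ∉ V(B)}
  {hN : ∀ e ∈ E(B), e < N}

lemma addVertex_isLink {e p q : ℕ} : (B.addVertex U y N hU hy hN).IsLink e p q ↔
    B.IsLink e p q ∨ ∃ u ∈ U, e = N + u ∧ ((p = u ∧ q = y) ∨ (p = y ∧ q = u)) := Iff.rfl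

lemma vertexSet_addVertex : V(B.addVertex U y N hU hy hN) = insert y V(B) := rfl

lemma addVertex_deleteVerts : (B.addVertex U y N hU hy hN).deleteVerts {y} = B := by
  refine Graph.ext ?_ ?_
  · rw [vertexSet_deleteVerts, vertexSet_addVertex]
    ext v
    constructor
    · rintro ⟨h | h, h'⟩
      · exact absurd h h'
      · exact h
    · intro h
      exact ⟨Or.inr h, fun h' => hy (h' ▸ h)⟩
  · intro e p q
    rw [deleteVerts_singleton_isLink, addVertex_isLink]
    constructor
    · rintro ⟨h | ⟨u, hu, he, h | h⟩, hp, hq⟩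
      · exact h
      · exact absurd h.2 hq
      · exact absurd h.1 hp
    · intro h
      exact ⟨Or.inl h, fun h' => hy (h' ▸ h.left_mem), fun h' => hy (h' ▸ h.right_mem)⟩

lemma bdry_addVertex {S : Set ℕ} (hS : S ⊆ V(B)) :
    (B.addVertex U y N hU hy hN).bdry S = B.bdry S ∪ (fun u => N + u) '' (S ∩ U) := by
  have hyS : y ∉ S := fun h => hy (hS h)
  ext e
  constructor
  · rintro ⟨p, hp, q, hq, h | ⟨u, hu, he, ⟨rfl, rfl⟩ | ⟨rfl, rfl⟩⟩⟩
    · exact Or.inl ⟨p, hp, q, hq, h⟩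
    · exact Or.inr ⟨_, ⟨hp, hu⟩, he.symm⟩
    · exact absurd hp hyS
  · rintro (⟨p, hp, q, hq, h⟩ | ⟨u, ⟨hu, hu'⟩, rfl⟩)
    · exact ⟨p, hp, q, hq, Or.inl h⟩
    · exact ⟨u, hu, y, hyS, Or.inr ⟨u, hu', rfl, Or.inl ⟨rfl, rfl⟩⟩⟩

lemma ncard_bdry_addVertex (hE : E(B).Finite) (hV : V(B).Finite) {S : Set ℕ} (hS : S ⊆ V(B)) :
    ((B.addVertex U y N hU hy hN).bdry S).ncard = (B.bdry S).ncard + (S ∩ U).ncard := by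
  rw [bdry_addVertex hS, Set.ncard_union_eq _ (hE.subset (bdry_subset _))
    ((hV.subset (Set.inter_subset_left.trans hS)).image _),
    Set.ncard_image_of_injective _ (add_right_injective N)]
  rw [Set.disjoint_left]
  rintro e he ⟨u, -, rfl⟩
  have : N + u < N := hN _ (bdry_subset _ he)
  omega

lemma addVertex_loopless (hl : ∀ e x, ¬ B.IsLink e x x) (e x : ℕ) :
    ¬ (B.addVertex U y N hU hy hN).IsLink e x x := by
  rintro (h | ⟨u, hu, -, ⟨rfl, rfl⟩ | ⟨rfl, rfl⟩⟩)
  · exact hl _ _ h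
  · exact hy (hU hu)
  · exact hy (hU hu)

lemma bdry_vertexSet {α β : Type*} {B : Graph α β} : B.bdry V(B) = ∅ := by
  ext e
  simp only [Set.mem_empty_iff_false, iff_false]
  rintro ⟨x, _, y, hy, h⟩
  exact hy h.right_mem

lemma ncard_bdry_addVertex_singleton (hE : E(B).Finite) (hV : V(B).Finite) :
    ((B.addVertex U y N hU hy hN).bdry {y}).ncard = U.ncard := by
  have h1 : (B.addVertex U y N hU hy hN).bdry {y} =
      (B.addVertex U y N hU hy hN).bdry V(B) := by
    rw [← bdry_compl]
    congr 1
    rw [vertexSet_addVertex]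
    ext v
    constructor
    · rintro ⟨h | h, h'⟩
      · exact absurd h h'
      · exact h
    · intro h
      exact ⟨Or.inr h, fun h' => hy (h' ▸ h)⟩
  rw [h1, ncard_bdry_addVertex hE hV subset_rfl, bdry_vertexSet, Set.ncard_empty, zero_add,
    Set.inter_eq_self_of_subset_right hU]

lemma CutTwo.addVertex (h : B.CutTwo) (hE : E(B).Finite) (hV : V(B).Finite) (hU2 : 2 ≤ U.ncard) :
    (B.addVertex U y N hU hy hN).CutTwo := by
  have main : ∀ S ⊆ V(B), S.Nonempty → 2 ≤ ((B.addVertex U y N hU hy hN).bdry S).ncard := by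
    intro S hS hne
    rw [ncard_bdry_addVertex hE hV hS]
    by_cases hSV : S = V(B)
    · rw [hSV, Set.inter_eq_self_of_subset_right hU]; omega
    · have := h S hS hne hSV; omega
  intro S hS hne hneV
  by_cases hyS : y ∈ S
  · rw [← bdry_compl]
    refine main _ ?_ ?_
    · rintro v ⟨h1 | h1, h2⟩
      · exact absurd (h1 ▸ hyS) h2
      · exact h1
    · by_contra hcon
      rw [Set.not_nonempty_iff_eq_empty, Set.sdiff_eq_empty] at hcon
      exact hneV (Set.Subset.antisymm hS hcon)
  · refine main S ?_ hne
    intro v hv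
    rcases hS hv with h1 | h1
    · exact absurd (h1 ▸ hv) hyS
    · exact h1

end AddVertex

/-! ### Contracting the structure step by step -/

section Family

lemma Skeleton.isSubcubic {α β : Type*} {B : Graph α β} {X : Set α} {𝓓 : Set (Set α)}
    (h : Skeleton B X 𝓓) : B.IsSubcubic := by
  intro v hv
  rw [h.vertexSet_eq] at hv
  rcases hv with hv | ⟨D, hD, hv⟩
  · rcases h.deg_left v hv with h' | h' <;> omega
  · rw [h.deg_eq D hD v hv]

lemma Skeleton.two_lt_ncard {α β : Type*} {B : Graph α β} {X : Set α} {𝓓 : Set (Set α)}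
    (h : Skeleton B X 𝓓) : 2 < V(B).ncard := by
  have h1 := h.ncard_two
  have h2 : {x | x ∈ X ∧ B.deg x = 2} ⊆ V(B) := by
    rw [h.vertexSet_eq]; exact fun x hx => Or.inl hx.1
  have := Set.ncard_le_ncard h2 h.finite_vertexSet
  omega

/-- A finite set of natural numbers has a strict upper bound, which serves as a new label. -/
lemma exists_fresh {S : Set ℕ} (hS : S.Finite) : ∃ N, ∀ e ∈ S, e < N := by
  obtain ⟨N, hN⟩ := hS.bddAbove
  exact ⟨N + 1, fun e he => Nat.lt_succ_of_le (hN he)⟩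

/-- When all sets of the structure are singletons, adding a vertex joined to the three vertices of
degree two gives a cubic bipartite multigraph. -/
lemma Skeleton.exists_stage_of_singletons {B : Graph ℕ ℕ} {X : Set ℕ} {𝓓 : Set (Set ℕ)}
    (h : Skeleton B X 𝓓) (hs : ∀ D ∈ 𝓓, ∃ v, D = {v}) :
    ∃ (H : Graph ℕ ℕ) (X Y : Set ℕ) (y₀ : ℕ) (R : Set ℕ), V(H).Finite ∧ E(H).Finite ∧
      H.IsRegular 3 ∧ H.IsTwoConnected ∧ H.IsBipartition X Y ∧ y₀ ∈ Y ∧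
      (H.deleteVerts {y₀}).IsTwoConnected ∧
      ExplosionStage (H.deleteVerts {y₀}) (Y \ {y₀}) B R ∧ ∀ v, {v} ∈ 𝓓 → v ∈ R := by
  obtain ⟨N, hN⟩ := exists_fresh h.finite_edgeSet
  obtain ⟨y, hy'⟩ := exists_fresh h.finite_vertexSet
  have hy : y ∉ V(B) := fun hy => lt_irrefl _ (hy' y hy)
  set U : Set ℕ := {x | x ∈ X ∧ B.deg x = 2} with hUdef
  have hXV : X ⊆ V(B) := by rw [h.vertexSet_eq]; exact Set.subset_union_left
  have hU : U ⊆ V(B) := fun x hx => hXV hx.1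
  have hU3 : U.ncard = 3 := h.ncard_two
  set H := B.addVertex U y N hU hy hN with hH
  have hdel : H.deleteVerts {y} = B := addVertex_deleteVerts
  have hl : ∀ e x, ¬ H.IsLink e x x := addVertex_loopless h.loopless
  have hVH : V(H) = insert y V(B) := rfl
  have hVHf : V(H).Finite := h.finite_vertexSet.insert y
  have hEHf : E(H).Finite := by
    refine (h.finite_edgeSet.union ((h.finite_vertexSet.subset hU).image fun u => N + u)).subset ?_
    intro e he
    obtain ⟨p, q, h' | ⟨u, hu, rfl, -⟩⟩ := exists_isLink_of_mem_edgeSet he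
    · exact Or.inl h'.edge_mem
    · exact Or.inr ⟨u, hu, rfl⟩
  have hreg : H.IsRegular 3 := by
    rintro v (rfl | hv)
    · rw [deg_eq_ncard_bdry hl, ncard_bdry_addVertex_singleton h.finite_edgeSet h.finite_vertexSet,
        hU3]
    · rw [deg_eq_ncard_bdry hl, ncard_bdry_addVertex h.finite_edgeSet h.finite_vertexSet
        (by simpa using hv), ← deg_eq_ncard_bdry h.loopless]
      by_cases hvU : v ∈ U
      · rw [Set.inter_eq_self_of_subset_left (by simpa using hvU), Set.ncard_singleton, hvU.2]
      · have : ({v} : Set ℕ) ∩ U = ∅ := by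
          rw [← Set.disjoint_iff_inter_eq_empty]; simpa using hvU
        rw [this, Set.ncard_empty, add_zero]
        rw [h.vertexSet_eq] at hv
        rcases hv with hv | ⟨D, hD, hv⟩
        · rcases h.deg_left v hv with h' | h'
          · exact absurd ⟨hv, h'⟩ hvU
          · exact h'
        · exact h.deg_eq D hD v hv
  have hBV := h.two_lt_ncard
  have hdisj : Disjoint X (⋃₀ 𝓓) := Set.disjoint_sUnion_right.2 h.disjoint_left
  refine ⟨H, X, insert y (⋃₀ 𝓓), y, insert y (⋃₀ 𝓓) \ {y}, hVHf, hEHf, hreg, ?_, ⟨?_, ?_, ?_⟩,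
    Set.mem_insert _ _, ?_, ?_, ?_⟩
  · refine CutTwo.isTwoConnected (h.cutTwo.addVertex h.finite_edgeSet h.finite_vertexSet
      (by omega)) hEHf (fun v hv => (hreg v hv).le) ?_
    rw [hVH, Set.ncard_insert_of_notMem hy h.finite_vertexSet]
    omega
  · rw [hVH, h.vertexSet_eq, Set.union_insert]
  · refine Set.disjoint_insert_right.2 ⟨fun hyX => hy (hXV hyX), hdisj⟩
  · have hB : ∀ e p q, B.IsLink e p q → p ∈ ⋃₀ 𝓓 → q ∈ X := by
      rintro e p q hpq ⟨D, hD, hp⟩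
      rcases h.link_right e p q hpq D hD hp with h' | h'
      · exact h'
      · obtain ⟨v, rfl⟩ := hs D hD
        rw [Set.mem_singleton_iff] at hp h'
        subst hp; subst h'
        exact absurd hpq (h.loopless _ _)
    rintro e p q (hpq | ⟨u, hu, -, ⟨rfl, rfl⟩ | ⟨rfl, rfl⟩⟩)
    · have hp := hpq.left_mem
      rw [h.vertexSet_eq] at hp
      rcases hp with hp | hp
      · obtain ⟨D, hD, hq⟩ := h.link_left e p q hpq hp
        exact Or.inl ⟨hp, Or.inr ⟨D, hD, hq⟩⟩
      · exact Or.inr ⟨Or.inr hp, hB e p q hpq hp⟩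
    · exact Or.inl ⟨hu.1, Or.inl rfl⟩
    · exact Or.inr ⟨Or.inl rfl, hu.1⟩
  · rw [hdel]
    exact h.cutTwo.isTwoConnected h.finite_edgeSet h.isSubcubic hBV
  · rw [hdel]
    exact ExplosionStage.start
  · intro v hv
    refine ⟨Or.inr ⟨_, hv, rfl⟩, fun hvy => hy ?_⟩
    rw [← Set.mem_singleton_iff.1 hvy, h.vertexSet_eq]
    exact Or.inr ⟨_, hv, rfl⟩

open scoped Classical in
/-- Contracting the sets of the structure one by one, and reading this backwards, shows that the
multigraph arises by explosions. -/
theorem Skeleton.exists_stage (n : ℕ) : ∀ {B : Graph ℕ ℕ} {X : Set ℕ} {𝓓 : Set (Set ℕ)},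
    Skeleton B X 𝓓 → V(B).ncard ≤ n →
    ∃ (H : Graph ℕ ℕ) (X Y : Set ℕ) (y₀ : ℕ) (R : Set ℕ), V(H).Finite ∧ E(H).Finite ∧
      H.IsRegular 3 ∧ H.IsTwoConnected ∧ H.IsBipartition X Y ∧ y₀ ∈ Y ∧
      (H.deleteVerts {y₀}).IsTwoConnected ∧
      ExplosionStage (H.deleteVerts {y₀}) (Y \ {y₀}) B R ∧ ∀ v, {v} ∈ 𝓓 → v ∈ R := by
  induction n with
  | zero =>
    intro B X 𝓓 h hn
    have := h.two_lt_ncard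
    omega
  | succ n ih =>
    intro B X 𝓓 h hn
    by_cases hs : ∀ D ∈ 𝓓, ∃ v, D = {v}
    · exact h.exists_stage_of_singletons hs
    push Not at hs
    obtain ⟨D, hD, hDs⟩ := hs
    have hDV : D ⊆ V(B) := by
      rw [h.vertexSet_eq]; exact fun v hv => Or.inr ⟨D, hD, hv⟩
    have hXV : X ⊆ V(B) := by rw [h.vertexSet_eq]; exact Set.subset_union_left
    have hDne := h.nonempty D hD
    have hDfin := h.finite_vertexSet.subset hDV
    have hD2 : 2 ≤ D.ncard := by
      have h1 := (Set.ncard_pos hDfin).2 hDne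
      have h2 : D.ncard ≠ 1 := fun h1 => by
        obtain ⟨v, hv⟩ := Set.ncard_eq_one.1 h1
        exact hDs v hv
      omega
    obtain ⟨N, hN⟩ := exists_fresh h.finite_edgeSet
    obtain ⟨y, hy'⟩ := exists_fresh h.finite_vertexSet
    have hy : y ∉ V(B) := fun hy => lt_irrefl _ (hy' y hy)
    have hz : y + 1 ∉ V(B) := fun hy => by have := hy' _ hy; omega
    have hXne : X.Nonempty := by
      have h1 := h.ncard_two
      rw [Set.nonempty_iff_ne_empty]
      rintro rfl
      simp at h1
    have hcompl : (V(B) \ D).Nonempty := by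
      obtain ⟨x, hx⟩ := hXne
      exact ⟨x, hXV hx, Set.disjoint_left.1 (h.disjoint_left D hD) hx⟩
    have hg : Set.InjOn (fun e => if e ∈ B.bdry D then e + N else e) E(B) := by
      intro e he f hf hef
      have h1 := hN e he
      have h2 := hN f hf
      simp only at hef
      split_ifs at hef <;> omega
    set A := B.shrink (contr D y) id (Set.injOn_id _) with hA
    set F := B.shrink (contr (V(B) \ D) (y + 1)) _ hg with hF
    have hexp : IsExplosion A y F (y + 1) B :=
      isExplosion_shrink hDV hDne hcompl hy hz (by omega) h.loopless hN hg
    have hne : ∀ a ∈ V(B), a ≠ y := fun a ha h' => hy (h' ▸ ha)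
    -- the contraction `A` inherits the structure and has fewer vertices
    have hAsk : Skeleton A (contr D y '' X) ((fun D' => contr D y '' D') '' 𝓓) := by
      refine h.shrink _ fun a ha => ?_
      by_cases haD : a ∈ D
      · refine Or.inr ⟨D, hD, haD, fun b hb => ?_⟩
        rw [contr_of_mem haD]
        constructor
        · intro hby
          by_contra hbD
          rw [contr_of_notMem hbD] at hby
          exact hne b hb hby
        · exact contr_of_mem
      · refine Or.inl fun b hb hba => ?_
        rw [contr_of_notMem haD, contr_eq_iff haD (hne a ha)] at hba
        exact hba
    have hAV : V(A) = insert y (V(B) \ D) := by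
      ext v
      constructor
      · rintro ⟨a, ha, rfl⟩
        by_cases haD : a ∈ D
        · exact Or.inl (contr_of_mem haD)
        · rw [contr_of_notMem haD]; exact Or.inr ⟨ha, haD⟩
      · rintro (rfl | ⟨hv, hvD⟩)
        · obtain ⟨d, hd⟩ := hDne
          exact ⟨d, hDV hd, contr_of_mem hd⟩
        · exact ⟨v, hv, contr_of_notMem hvD⟩
    have hAcard : V(A).ncard ≤ n := by
      have h1 := Set.ncard_sdiff_add_ncard_of_subset hDV h.finite_vertexSet
      rw [hAV, Set.ncard_insert_of_notMem (fun h' => hy h'.1) (h.finite_vertexSet.subset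
        Set.sdiff_subset)]
      omega
    obtain ⟨H, X', Y, y₀, R, h1, h2, h3, h4, h5, h6, h7, hst, hR⟩ := ih hAsk hAcard
    have hyR : y ∈ R := by
      refine hR y ⟨D, hD, ?_⟩
      ext v
      constructor
      · rintro ⟨a, ha, rfl⟩; exact contr_of_mem ha
      · rintro rfl
        obtain ⟨d, hd⟩ := hDne
        exact ⟨d, hd, contr_of_mem hd⟩
    -- the other side `F` of the cut is cubic and `2`-connected
    have hFreg : F.IsRegular 3 := by
      rintro _ ⟨a, ha, rfl⟩
      by_cases haD : a ∈ D
      · rw [deg_shrink_of_unique h.loopless ha, h.deg_eq D hD a haD]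
        intro b hb hba
        have haC : a ∉ V(B) \ D := fun h' => h'.2 haD
        rw [contr_of_notMem haC, contr_eq_iff haC fun h' : a = y + 1 => hz (h' ▸ ha)] at hba
        exact hba
      · rw [deg_shrink (S := V(B) \ D) ?_ Set.sdiff_subset, bdry_compl, h.ncard_bdry D hD]
        intro b hb
        have haC : a ∈ V(B) \ D := ⟨ha, haD⟩
        rw [contr_of_mem haC]
        constructor
        · intro hby
          by_contra hbD
          rw [contr_of_notMem hbD] at hby
          exact hz (hby ▸ hb)
        · exact contr_of_mem
    have hFV : V(F).Finite := h.finite_vertexSet.image _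
    have hFE : E(F).Finite := (h.finite_edgeSet.image _).subset edgeSet_shrink_subset
    have hF2 : F.IsTwoConnected := by
      refine CutTwo.isTwoConnected h.cutTwo.shrink hFE (fun v hv => (hFreg v hv).le) ?_
      have hsub : insert (y + 1) D ⊆ V(F) := by
        rintro v (rfl | hv)
        · obtain ⟨d, hd⟩ := hcompl
          exact ⟨d, hd.1, contr_of_mem hd⟩
        · exact ⟨v, hDV hv, contr_of_notMem fun h' => h'.2 hv⟩
      have := Set.ncard_le_ncard hsub hFV
      rw [Set.ncard_insert_of_notMem (fun h' => hz (hDV h')) hDfin] at this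
      omega
    refine ⟨H, X', Y, y₀, R \ {y}, h1, h2, h3, h4, h5, h6, h7,
      ExplosionStage.explode hst hyR hFV hFE hFreg hF2 hexp, ?_⟩
    intro v hv
    have hvV : v ∈ V(B) := by rw [h.vertexSet_eq]; exact Or.inr ⟨_, hv, rfl⟩
    refine ⟨hR v ⟨{v}, hv, ?_⟩, fun h' => hne v hvV h'⟩
    have hvD : v ∉ D := by
      intro hvD
      have : ({v} : Set ℕ) = D := by
        by_contra hne'
        exact Set.disjoint_left.1 (h.pairwiseDisjoint hv hD hne') rfl hvD
      exact hDs v this.symm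
    simp only [Set.image_singleton, contr_of_notMem hvD]

lemma exists_labels {α β : Type*} {G : Graph α β} (hV : V(G).Finite) (hE : E(G).Finite) :
    ∃ (φ : α → ℕ) (g : β → ℕ), Set.InjOn φ V(G) ∧ Set.InjOn g E(G) := by
  obtain ⟨φ, hφ⟩ := Set.countable_iff_exists_injOn.1 hV.countable
  obtain ⟨g, hg⟩ := Set.countable_iff_exists_injOn.1 hE.countable
  exact ⟨φ, g, hφ, hg⟩

/-- The family `𝒢` is defined with labels in `ℕ`, so the multigraph is relabelled first. -/
theorem Skeleton.isInFamilyG {α β : Type*} {C : Graph α β} {X : Set α} {𝓓 : Set (Set α)}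
    (h : Skeleton C X 𝓓) : C.IsInFamilyG := by
  obtain ⟨φ, g, hφ, hg⟩ := exists_labels h.finite_vertexSet h.finite_edgeSet
  have hsk := h.shrink (φ := φ) hg fun a ha => Or.inl fun b hb hba => hφ hb ha hba
  obtain ⟨H, X', Y, y₀, R, h1, h2, h3, h4, h5, h6, h7, hst, -⟩ := Skeleton.exists_stage _ hsk le_rfl
  exact ⟨H, X', Y, y₀, _, R, h1, h2, h3, h4, h5, h6, h7, hst,
    isIsomorphic_shrink hg h.loopless hφ⟩

end Family

end Graph

namespace Graph

open TJoin

/-! ### Balloons and the deficit -/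

section Isomorphism

variable {α β α' β' : Type*} {G : Graph α β} {K : Graph α' β'}

lemma IsIsomorphic.ncard_vertexSet (h : G.IsIsomorphic K) : V(G).ncard = V(K).ncard := by
  obtain ⟨f, -, -⟩ := h
  exact Nat.card_congr f

lemma IsIsomorphic.deficit_eq (h : G.IsIsomorphic K) : G.deficit = K.deficit := by
  have h1 := h.ncard_vertexSet
  obtain ⟨-, g, -⟩ := h
  have h2 : E(G).ncard = E(K).ncard := Nat.card_congr g
  rw [deficit, deficit, h1, h2]

end Isomorphism

section Deficit

variable {α β : Type*} {G : Graph α β}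

lemma deficit_eq_zero_of_isRegular (hV : V(G).Finite) (hE : E(G).Finite) (h : G.IsRegular 3) :
    G.deficit = 0 := by
  classical
  rcases isEmpty_or_nonempty α with hα | hα
  · have h1 : V(G) = ∅ := Set.eq_empty_of_isEmpty _
    have h2 : E(G) = ∅ := by
      rw [Set.eq_empty_iff_forall_notMem]
      intro e he
      obtain ⟨x, _, _⟩ := exists_isLink_of_mem_edgeSet he
      exact hα.elim x
    rw [deficit, h1, h2]; simp
  · obtain ⟨p, q, hends⟩ := exists_ends G
    rw [deficit_eq_sum hends hV hE]
    refine Finset.sum_eq_zero fun v hv => ?_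
    rw [h v (by simpa using hv)]; rfl

lemma IsEdgeSubdivision.deficit_eq {K B : Graph α β} (hV : V(K).Finite) (hE : E(K).Finite)
    (h : IsEdgeSubdivision K B) : B.deficit = K.deficit + 1 := by
  obtain ⟨e, e₁, e₂, u, v, w, he, hw, h1, h2, h12, hVB, hB⟩ := h
  have hEB : E(B) = insert e₁ (insert e₂ (E(K) \ {e})) := by
    ext f
    constructor
    · intro hf
      obtain ⟨x, y, hxy⟩ := exists_isLink_of_mem_edgeSet hf
      rcases (hB f x y).1 hxy with ⟨h, hne⟩ | ⟨rfl, -⟩ | ⟨rfl, -⟩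
      · exact Or.inr (Or.inr ⟨h.edge_mem, hne⟩)
      · exact Or.inl rfl
      · exact Or.inr (Or.inl rfl)
    · rintro (rfl | rfl | ⟨hf, hne⟩)
      · exact ((hB f u w).2 (Or.inr (Or.inl ⟨rfl, rfl⟩))).edge_mem
      · exact ((hB f w v).2 (Or.inr (Or.inr ⟨rfl, rfl⟩))).edge_mem
      · obtain ⟨x, y, hxy⟩ := exists_isLink_of_mem_edgeSet hf
        exact ((hB f x y).2 (Or.inl ⟨hxy, hne⟩)).edge_mem
  have hfin : (E(K) \ {e}).Finite := hE.subset Set.sdiff_subset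
  have h3 := Set.ncard_sdiff_singleton_add_one he.edge_mem hE
  rw [deficit, deficit, hVB, hEB, Set.ncard_insert_of_notMem hw hV,
    Set.ncard_insert_of_notMem _ (hfin.insert _), Set.ncard_insert_of_notMem _ hfin]
  · push_cast [← h3]; ring
  · exact fun h => h2 h.1
  · rintro (h | h)
    · exact h12 h
    · exact h1 h.1

lemma IsBalloon.deficit_eq_one (h : G.IsBalloon) : G.deficit = 1 := by
  obtain ⟨K, B, hV, hE, hreg, -, hs, hiso⟩ := h
  rw [hiso.deficit_eq, hs.deficit_eq hV hE, deficit_eq_zero_of_isRegular hV hE hreg]; rfl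

/-- Suppressing the unique vertex of degree two gives a cubic multigraph. -/
lemma exists_isEdgeSubdivision {B : Graph ℕ ℕ} (hV : V(B).Finite) (hE : E(B).Finite)
    (hcut : B.CutTwo) (hl : ∀ e x, ¬ B.IsLink e x x) {w : ℕ} (hw : w ∈ V(B))
    (hw2 : B.deg w = 2) (h3 : ∀ v ∈ V(B), v ≠ w → B.deg v = 3) :
    ∃ K : Graph ℕ ℕ, V(K).Finite ∧ E(K).Finite ∧ K.IsRegular 3 ∧ K.IsTwoEdgeConnected ∧
      IsEdgeSubdivision K B := by
  classical
  rw [deg_eq_ncard_bdry hl] at hw2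
  obtain ⟨e₁, e₂, h12, he⟩ := Set.ncard_eq_two.1 hw2
  have hmem : ∀ e ∈ B.bdry {w}, ∃ u, B.IsLink e w u ∧ u ≠ w := by
    rintro e ⟨x, rfl, u, hu, h⟩; exact ⟨u, h, hu⟩
  obtain ⟨u, hwu, huw⟩ := hmem e₁ (by rw [he]; simp)
  obtain ⟨v, hwv, hvw⟩ := hmem e₂ (by rw [he]; simp)
  have hw12 : ∀ f x, B.IsLink f w x → f = e₁ ∨ f = e₂ := by
    intro f x hf
    have : f ∈ B.bdry {w} := ⟨w, rfl, x, fun h => hl f w (by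
      rw [Set.mem_singleton_iff.1 h] at hf; exact hf), hf⟩
    rw [he] at this
    exact this
  have hu3 := h3 u hwu.right_mem huw
  rw [deg_eq_ncard_bdry hl] at hu3
  have hfin : ∀ S, (B.bdry S).Finite := fun S => hE.subset (bdry_subset S)
  have he₁u : e₁ ∈ B.bdry {u} := ⟨u, rfl, w, huw.symm, hwu.symm⟩
  have hSV : ({u, w} : Set ℕ) ⊆ V(B) := by
    rintro x (rfl | rfl)
    · exact hwu.right_mem
    · exact hw
  have hin : ∀ f ∈ B.bdry {u, w}, f ≠ e₁ := by
    rintro f ⟨x, hx, y, hy, hf⟩ rfl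
    rcases hf.eq_and_eq_or_eq_and_eq hwu with ⟨-, rfl⟩ | ⟨-, rfl⟩
    · exact hy (Or.inl rfl)
    · exact hy (Or.inr rfl)
  -- if both edges at `w` led to `u`, the third edge at `u` would be a cut-edge
  have huv : u ≠ v := by
    rintro rfl
    have hsub : B.bdry {u, w} ⊆ B.bdry {u} \ {e₁, e₂} := by
      rintro f hf
      have hf1 := hin f hf
      obtain ⟨x, hx, y, hy, hf⟩ := hf
      have hyu : y ≠ u := fun h => hy (Or.inl h)
      rcases hx with rfl | rfl
      · refine ⟨⟨x, rfl, y, hyu, hf⟩, ?_⟩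
        rintro (rfl | rfl)
        · exact hf1 rfl
        · rcases hf.eq_and_eq_or_eq_and_eq hwv with ⟨rfl, -⟩ | ⟨-, rfl⟩
          · exact huw rfl
          · exact hy (Or.inr rfl)
      · rcases hw12 f y hf with rfl | rfl
        · exact absurd rfl hf1
        · rcases hf.eq_and_eq_or_eq_and_eq hwv with ⟨-, h⟩ | ⟨h, -⟩
          · exact absurd h hyu
          · exact absurd h.symm huw
    have he₂u : e₂ ∈ B.bdry {u} := ⟨u, rfl, w, huw.symm, hwv.symm⟩
    have hpair : ({e₁, e₂} : Set ℕ) ⊆ B.bdry {u} := by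
      rintro f (rfl | rfl)
      · exact he₁u
      · exact he₂u
    have h4 := Set.ncard_sdiff_add_ncard_of_subset hpair (hfin _)
    rw [Set.ncard_pair h12, hu3] at h4
    have h5 := Set.ncard_le_ncard hsub ((hfin _).subset Set.sdiff_subset)
    have hne : ({u, w} : Set ℕ) ≠ V(B) := by
      intro h
      have : B.bdry {u} = B.bdry {w} := by
        rw [← bdry_compl (S := {u}), ← h]
        congr 1
        ext x
        constructor
        · rintro ⟨h | h, h'⟩
          · exact absurd h h'
          · exact h
        · intro h
          exact ⟨Or.inr h, fun h' => huw (h'.symm.trans h)⟩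
      rw [this, hw2] at hu3
      omega
    have := hcut {u, w} hSV ⟨u, Or.inl rfl⟩ hne
    omega
  obtain ⟨N, hN⟩ := exists_fresh hE
  have hN1 : N ≠ e₁ := by have := hN _ hwu.edge_mem; omega
  have hN2 : N ≠ e₂ := by have := hN _ hwv.edge_mem; omega
  set g : ℕ → ℕ := fun e => if e = e₂ then N else e with hg'
  have hg2 : g e₂ = N := by simp [hg']
  have hgo : ∀ e, e ≠ e₂ → g e = e := fun e h => by simp [hg', h]
  have hg : Set.InjOn g E(B) := by
    intro a ha b hb hab
    have h1 := hN a ha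
    have h2 := hN b hb
    by_cases h : a = e₂ <;> by_cases h' : b = e₂
    · rw [h, h']
    · rw [h, hg2, hgo b h'] at hab; omega
    · rw [h', hg2, hgo a h] at hab; omega
    · rwa [hgo a h, hgo b h'] at hab
  have hcw : contr {w} u w = u := contr_of_mem rfl
  have hco : ∀ a, a ≠ w → contr {w} u a = a := fun a h => contr_of_notMem h
  set K := B.shrink (contr {w} u) g hg with hK
  have hVK : ∀ x, x ∈ V(K) ↔ x ∈ V(B) ∧ x ≠ w := by
    intro x
    constructor
    · rintro ⟨a, ha, rfl⟩
      by_cases h : a = w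
      · rw [h, hcw]; exact ⟨hwu.right_mem, huw⟩
      · rw [hco a h]; exact ⟨ha, h⟩
    · rintro ⟨h, h'⟩
      exact ⟨x, h, hco x h'⟩
  -- the edges of the quotient
  have hKold : ∀ f x y, B.IsLink f x y → x ≠ w → y ≠ w → K.IsLink f x y := by
    intro f x y hf hx hy
    have hne : f ≠ e₂ := by
      rintro rfl
      rcases hf.eq_and_eq_or_eq_and_eq hwv with ⟨h, -⟩ | ⟨-, h⟩
      · exact hx h
      · exact hy h
    refine ⟨f, hgo f hne, x, y, hf, ?_, hco x hx, hco y hy⟩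
    rw [hco x hx, hco y hy]
    rintro rfl
    exact hl _ _ hf
  have hKnew : K.IsLink N u v :=
    ⟨e₂, hg2, w, v, hwv, by rw [hcw, hco v hvw]; exact huv, hcw, hco v hvw⟩
  have hKinv : ∀ f x y, K.IsLink f x y → f ≠ N → B.IsLink f x y ∧ x ≠ w ∧ y ≠ w := by
    rintro f x y ⟨e', rfl, a, b, hab, hne, rfl, rfl⟩ hfN
    have he2 : e' ≠ e₂ := by rintro rfl; exact hfN hg2
    have key : ∀ b, B.IsLink e' w b → b = u := by
      intro b hb
      rcases hw12 _ _ hb with rfl | rfl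
      · exact hb.right_unique hwu
      · exact absurd rfl he2
    have ha : a ≠ w := by
      rintro rfl
      have := key b hab
      subst this
      exact hne (by rw [hcw, hco b huw])
    have hb : b ≠ w := by
      rintro rfl
      have := key a hab.symm
      subst this
      exact hne (by rw [hcw, hco a huw])
    rw [hco a ha, hco b hb, hgo e' he2]
    exact ⟨hab, ha, hb⟩
  refine ⟨K, hV.image _, (hE.image g).subset edgeSet_shrink_subset, ?_, ⟨?_, ?_, ?_⟩, ?_⟩
  · intro x hx
    obtain ⟨hx, hxw⟩ := (hVK x).1 hx
    by_cases hxu : x = u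
    · rw [hxu, deg_shrink (S := {u, w}) _ hSV]
      · have : B.bdry {u, w} = insert e₂ (B.bdry {u} \ {e₁}) := by
          ext f
          constructor
          · intro hf
            have hf1 := hin f hf
            obtain ⟨a, ha, b, hb, hf⟩ := hf
            rcases ha with rfl | rfl
            · exact Or.inr ⟨⟨a, rfl, b, fun h => hb (Or.inl h), hf⟩, hf1⟩
            · rcases hw12 f b hf with rfl | rfl
              · exact absurd rfl hf1
              · exact Or.inl rfl
          · rintro (rfl | ⟨⟨a, rfl, b, hb, hf⟩, hf1⟩)
            · refine ⟨w, Or.inr rfl, v, ?_, hwv⟩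
              rintro (h | h)
              · exact huv h.symm
              · exact hvw h
            · refine ⟨a, Or.inl rfl, b, ?_, hf⟩
              rintro (h | rfl)
              · exact hb h
              · rcases hw12 f a hf.symm with rfl | rfl
                · exact hf1 rfl
                · exact huv (hf.symm.right_unique hwv)
        rw [this, Set.ncard_insert_of_notMem _ ((hfin _).subset Set.sdiff_subset)]
        · have := Set.ncard_sdiff_singleton_add_one he₁u (hfin _)
          omega
        · rintro ⟨⟨a, rfl, b, hb, hf⟩, -⟩
          rcases hf.eq_and_eq_or_eq_and_eq hwv with ⟨h, -⟩ | ⟨h, -⟩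
          · exact huw h
          · exact huv h
      · intro a ha
        by_cases haw : a = w
        · rw [haw, hcw]; simp
        · rw [hco a haw]; simp [haw]
    · have h1 := deg_shrink_of_unique (φ := contr {w} u) (hg := hg) hl hx (by
        intro b hb hbx
        rw [hco x hxw] at hbx
        by_cases hbw : b = w
        · rw [hbw, hcw] at hbx; exact absurd hbx.symm hxu
        · rwa [hco b hbw] at hbx)
      rw [hco x hxw] at h1
      rw [h1, h3 x hx hxw]
  · exact ⟨u, (hVK u).2 ⟨hwu.right_mem, huw⟩, v, (hVK v).2 ⟨hwv.right_mem, hvw⟩, huv⟩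
  · exact hcut.shrink.isConnected ⟨u, (hVK u).2 ⟨hwu.right_mem, huw⟩⟩
  · exact hcut.shrink.not_isCutEdge
  · refine ⟨N, e₁, e₂, u, v, w, hKnew, fun h => ((hVK w).1 h).2 rfl, ?_, ?_, h12, ?_, ?_⟩
    · intro h
      obtain ⟨x, y, hxy⟩ := exists_isLink_of_mem_edgeSet h
      obtain ⟨h1, h2, h3⟩ := hKinv _ _ _ hxy hN1.symm
      rcases h1.eq_and_eq_or_eq_and_eq hwu with ⟨h, -⟩ | ⟨-, h⟩
      · exact h2 h
      · exact h3 h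
    · intro h
      obtain ⟨x, y, hxy⟩ := exists_isLink_of_mem_edgeSet h
      obtain ⟨h1, h2, h3⟩ := hKinv _ _ _ hxy hN2.symm
      rcases h1.eq_and_eq_or_eq_and_eq hwv with ⟨h, -⟩ | ⟨-, h⟩
      · exact h2 h
      · exact h3 h
    · ext x
      rw [Set.mem_insert_iff, hVK]
      constructor
      · intro h
        by_cases hx : x = w
        · exact Or.inl hx
        · exact Or.inr ⟨h, hx⟩
      · rintro (rfl | h)
        · exact hw
        · exact h.1
    · intro f x y
      constructor
      · intro hf
        by_cases hx : x = w
        · subst hx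
          rcases hw12 f y hf with rfl | rfl
          · rw [hf.right_unique hwu]
            exact Or.inr (Or.inl ⟨rfl, Sym2.eq_swap⟩)
          · rw [hf.right_unique hwv]
            exact Or.inr (Or.inr ⟨rfl, rfl⟩)
        by_cases hy : y = w
        · subst hy
          rcases hw12 f x hf.symm with rfl | rfl
          · rw [hf.symm.right_unique hwu]
            exact Or.inr (Or.inl ⟨rfl, rfl⟩)
          · rw [hf.symm.right_unique hwv]
            exact Or.inr (Or.inr ⟨rfl, Sym2.eq_swap⟩)
        refine Or.inl ⟨hKold f x y hf hx hy, ?_⟩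
        have := hN f hf.edge_mem
        omega
      · rintro (⟨h, hne⟩ | ⟨rfl, h⟩ | ⟨rfl, h⟩)
        · exact (hKinv f x y h hne).1
        · rcases Sym2.eq_iff.1 h with ⟨rfl, rfl⟩ | ⟨rfl, rfl⟩
          · exact hwu.symm
          · exact hwu
        · rcases Sym2.eq_iff.1 h with ⟨rfl, rfl⟩ | ⟨rfl, rfl⟩
          · exact hwv
          · exact hwv.symm

/-- With deficit one there is exactly one vertex of degree two, and it is suppressed. -/
theorem CutTwo.isBalloon (h : G.CutTwo) (hV : V(G).Finite) (hE : E(G).Finite)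
    (hnt : V(G).Nontrivial) (h3 : G.IsSubcubic) (hd : G.deficit = 1) : G.IsBalloon := by
  classical
  have hl := h.loopless hE hnt h3
  have : Nonempty α := hnt.nonempty.to_type
  obtain ⟨p, q, hends⟩ := exists_ends G
  rw [deficit_eq_sum hends hV hE] at hd
  have hnn : ∀ v ∈ hV.toFinset, 0 ≤ 3 - (G.deg v : ℤ) := by
    intro v hv
    have := h3 v (by simpa using hv)
    omega
  obtain ⟨w, hw, hw1⟩ : ∃ w ∈ hV.toFinset, 3 - (G.deg w : ℤ) ≠ 0 := by
    apply Finset.exists_ne_zero_of_sum_ne_zero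
    rw [hd]; exact one_ne_zero
  have hw0 := hnn w hw
  rw [← Finset.add_sum_erase _ _ hw] at hd
  have hnn' : ∀ v ∈ hV.toFinset.erase w, 0 ≤ 3 - (G.deg v : ℤ) :=
    fun v hv => hnn v (Finset.mem_of_mem_erase hv)
  have h0 := Finset.sum_nonneg hnn'
  have h0' : ∑ v ∈ hV.toFinset.erase w, (3 - (G.deg v : ℤ)) = 0 := by omega
  have hwV : w ∈ V(G) := by simpa using hw
  have hdeg : ∀ v ∈ V(G), v ≠ w → G.deg v = 3 := by
    intro v hv hvw
    have := (Finset.sum_eq_zero_iff_of_nonneg hnn').1 h0' v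
      (Finset.mem_erase.2 ⟨hvw, by simpa using hv⟩)
    omega
  obtain ⟨φ, g, hφ, hg⟩ := exists_labels hV hE
  have hdφ : ∀ a ∈ V(G), (G.shrink φ g hg).deg (φ a) = G.deg a := fun a ha =>
    deg_shrink_of_unique hl ha fun b hb hba => hφ hb ha hba
  obtain ⟨K, h1, h2, h3, h4, h5⟩ := exists_isEdgeSubdivision (B := G.shrink φ g hg)
    (hV.image φ) ((hE.image g).subset edgeSet_shrink_subset) h.shrink shrink_loopless
    (w := φ w) ⟨w, hwV, rfl⟩ (by rw [hdφ w hwV]; omega) (by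
      rintro _ ⟨a, ha, rfl⟩ hne
      rw [hdφ a ha]
      exact hdeg a ha fun h => hne (by rw [h]))
  exact ⟨K, _, h1, h2, h3, h4, h5, isIsomorphic_shrink hg hl hφ⟩

end Deficit

end Graph

namespace Graph

open TJoin

/-! ### Members of `𝒢` have no spanning `2`-regular subgraph -/

section Obstruction

variable {α β α' β' : Type*} {G : Graph α β}

/-- Each edge of `Q` has exactly one end in `S`, so counting by these ends gives the size of `Q`. -/
lemma ncard_eq_sum_bdry {S : Set α} {Q : Set β} (hS : S.Finite) (hQ : Q.Finite)
    (h : Q ⊆ G.bdry S) : Q.ncard = ∑ v ∈ hS.toFinset, (Q ∩ G.bdry {v}).ncard := by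
  classical
  rcases Q.eq_empty_or_nonempty with rfl | ⟨e₀, he₀⟩
  · simp
  obtain ⟨x₀, -⟩ := h he₀
  have hf : ∀ e, ∃ x, e ∈ Q → x ∈ S ∧ ∃ y ∉ S, G.IsLink e x y := by
    intro e
    by_cases he : e ∈ Q
    · obtain ⟨x, hx, y, hy, hl⟩ := h he
      exact ⟨x, fun _ => ⟨hx, y, hy, hl⟩⟩
    · exact ⟨x₀, fun h => absurd h he⟩
  choose f hf using hf
  rw [Set.ncard_eq_toFinset_card Q hQ, Finset.card_eq_sum_card_fiberwise (f := f)
    (t := hS.toFinset)]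
  · refine Finset.sum_congr rfl fun v hv => ?_
    have hvS : v ∈ S := by simpa using hv
    rw [← Set.ncard_coe_finset]
    congr 1
    ext e
    simp only [Finset.coe_filter, Set.Finite.mem_toFinset, Set.mem_ofPred_eq, Set.mem_inter_iff]
    refine and_congr_right fun he => ?_
    obtain ⟨hfe, y, hy, hl⟩ := hf e he
    constructor
    · rintro rfl
      exact ⟨_, rfl, y, fun h' => hy (Set.mem_singleton_iff.1 h' ▸ hfe), hl⟩
    · rintro ⟨x, rfl, z, hz, hl'⟩
      rcases hl.eq_and_eq_or_eq_and_eq hl' with ⟨h1, -⟩ | ⟨-, h1⟩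
      · exact h1
      · exact absurd (h1 ▸ hvS) hy
  · intro e he
    have he' : e ∈ Q := by simpa using he
    simpa using (hf e he').1

/-- If `Q` has even degree at every vertex of `S`, then an even number of its edges leave `S`. -/
lemma even_ncard_inter_bdry (hV : V(G).Finite) (hE : E(G).Finite) {Q : Set β} (hQ : Q ⊆ E(G))
    {S : Set α} (hS : S ⊆ V(G)) (h : ∀ v ∈ S, Even (Q ∩ G.bdry {v}).ncard) :
    Even (Q ∩ G.bdry S).ncard := by
  classical
  rcases isEmpty_or_nonempty α with hα | hα
  · have : G.bdry S = ∅ := by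
      rw [Set.eq_empty_iff_forall_notMem]
      rintro e ⟨x, -⟩
      exact hα.elim x
    rw [this]; simp
  obtain ⟨p, q, hends⟩ := exists_ends G
  have hE' : E(G) = ↑hE.toFinset := by simp
  have hQf := hE.subset hQ
  have hcut : ∀ T : Set α, (cut p q hQf.toFinset (· ∈ T)).card = (Q ∩ G.bdry T).ncard := by
    intro T
    rw [← coe_cut hends hE', ← Set.ncard_coe_finset]
    congr 1
    ext e
    simp only [cut, Finset.coe_filter, Set.mem_ofPred_eq, Set.Finite.mem_toFinset, Set.mem_inter_iff]
    exact ⟨fun h => ⟨h.1, hQ h.1, h.2⟩, fun h => ⟨h.1, h.2.2⟩⟩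
  have hmem : ∀ e ∈ hQf.toFinset, p e ∈ hV.toFinset ∧ q e ∈ hV.toFinset := by
    intro e he
    have hl := hends e (hQ (by simpa using he))
    simpa using ⟨hl.left_mem, hl.right_mem⟩
  have hbd : ∀ v ∈ S, bd p q hQf.toFinset v = 0 := by
    intro v hv
    have h1 := card_cut_cast (p := p) (q := q) hQf.toFinset (· ∈ ({v} : Set α)) hV.toFinset hmem
    have h2 : hV.toFinset.filter (· ∈ ({v} : Set α)) = {v} := by
      ext x
      simp only [Finset.mem_filter, Set.Finite.mem_toFinset, Set.mem_singleton_iff,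
        Finset.mem_singleton]
      exact ⟨fun h => h.2, fun h => ⟨h ▸ hS hv, h⟩⟩
    rw [h2, Finset.sum_singleton, hcut] at h1
    rw [← h1, ZMod.natCast_eq_zero_iff]
    exact even_iff_two_dvd.1 (h v hv)
  have h1 := card_cut_cast (p := p) (q := q) hQf.toFinset (· ∈ S) hV.toFinset hmem
  rw [hcut, Finset.sum_eq_zero fun v hv => hbd v (Finset.mem_filter.1 hv).2,
    ZMod.natCast_eq_zero_iff] at h1
  exact even_iff_two_dvd.2 h1

/-- A finite loopless multigraph of deficit three in which no set of edges with all degrees even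
has degree two at every vertex of `X`. Then there is no spanning `2`-regular subgraph. Unlike the
latter, the condition on `X` is visibly preserved by explosions outside of `X`. -/
structure Obstructed (G : Graph α β) (X : Set α) : Prop where
  finite_vertexSet : V(G).Finite
  finite_edgeSet : E(G).Finite
  loopless : ∀ e x, ¬ G.IsLink e x x
  deficit_eq : G.deficit = 3
  subset : X ⊆ V(G)
  false_of_even : ∀ Q ⊆ E(G), (∀ v ∈ V(G), Even (Q ∩ G.bdry {v}).ncard) →
    (∀ x ∈ X, (Q ∩ G.bdry {x}).ncard = 2) → False

/-- In `H - y₀`, a set of edges that has degree two at all vertices of `X` is too large to have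
degree at most two at the vertices of `Y - y₀`, because `|X| = |Y|`. -/
lemma obstructed_deleteVerts {H : Graph α β} {X Y : Set α} {y₀ : α} (hV : V(H).Finite)
    (hE : E(H).Finite) (hreg : H.IsRegular 3) (hXY : H.IsBipartition X Y) (hy : y₀ ∈ Y) :
    (H.deleteVerts {y₀}).Obstructed X := by
  obtain ⟨hVH, hdisj, hbip⟩ := hXY
  have hl : ∀ e x, ¬ H.IsLink e x x := by
    intro e x h
    rcases hbip e x x h with h | h
    · exact Set.disjoint_left.1 hdisj h.1 h.2
    · exact Set.disjoint_left.1 hdisj h.2 h.1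
  have hXf : X.Finite := hV.subset (hVH ▸ Set.subset_union_left)
  have hYf : Y.Finite := hV.subset (hVH ▸ Set.subset_union_right)
  have hyX : y₀ ∉ X := fun h => Set.disjoint_left.1 hdisj h hy
  have hEX : E(H) ⊆ H.bdry X := by
    intro e he
    obtain ⟨x, y, hxy⟩ := exists_isLink_of_mem_edgeSet he
    rcases hbip e x y hxy with h | h
    · exact ⟨x, h.1, y, fun h' => Set.disjoint_left.1 hdisj h' h.2, hxy⟩
    · exact ⟨y, h.2, x, fun h' => Set.disjoint_left.1 hdisj h' h.1, hxy.symm⟩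
  have hEY : E(H) ⊆ H.bdry Y := by
    intro e he
    obtain ⟨x, y, hxy⟩ := exists_isLink_of_mem_edgeSet he
    rcases hbip e x y hxy with h | h
    · exact ⟨y, h.2, x, fun h' => Set.disjoint_left.1 hdisj h.1 h', hxy.symm⟩
    · exact ⟨x, h.1, y, fun h' => Set.disjoint_left.1 hdisj h.2 h', hxy⟩
  have h3 : ∀ v ∈ V(H), (H.bdry {v}).ncard = 3 := by
    intro v hv
    rw [← deg_eq_ncard_bdry hl, hreg v hv]
  have hcardX := ncard_eq_sum_bdry hXf hE hEX
  have hcardY := ncard_eq_sum_bdry hYf hE hEY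
  have hin : ∀ v, E(H) ∩ H.bdry {v} = H.bdry {v} := fun v =>
    Set.inter_eq_self_of_subset_right (bdry_subset _)
  rw [Finset.sum_congr rfl (g := fun _ => 3), Finset.sum_const, smul_eq_mul,
    ← Set.ncard_eq_toFinset_card X hXf] at hcardX
  swap
  · intro v hv
    rw [hin, h3 v (hVH ▸ Or.inl (by simpa using hv))]
  rw [Finset.sum_congr rfl (g := fun _ => 3), Finset.sum_const, smul_eq_mul,
    ← Set.ncard_eq_toFinset_card Y hYf] at hcardY
  swap
  · intro v hv
    rw [hin, h3 v (hVH ▸ Or.inr (by simpa using hv))]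
  have hyV : y₀ ∈ V(H) := hVH ▸ Or.inr hy
  have hVA : V(H.deleteVerts {y₀}) = V(H) \ {y₀} := by simp
  have hEA : E(H.deleteVerts {y₀}) = E(H) \ H.bdry {y₀} := by
    ext e
    constructor
    · intro he
      obtain ⟨x, y, hxy⟩ := exists_isLink_of_mem_edgeSet he
      obtain ⟨h1, hx, hy'⟩ := deleteVerts_singleton_isLink.1 hxy
      refine ⟨h1.edge_mem, ?_⟩
      rintro ⟨_, rfl, b, hb, h2⟩
      rcases h1.eq_and_eq_or_eq_and_eq h2 with ⟨h, -⟩ | ⟨-, h⟩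
      · exact hx h
      · exact hy' h
    · rintro ⟨he, hn⟩
      obtain ⟨x, y, hxy⟩ := exists_isLink_of_mem_edgeSet he
      refine (deleteVerts_singleton_isLink.2 ⟨hxy, ?_, ?_⟩).edge_mem
      · rintro rfl
        exact hn ⟨x, rfl, y, fun h => hl e x (by
          rw [Set.mem_singleton_iff.1 h] at hxy; exact hxy), hxy⟩
      · rintro rfl
        exact hn ⟨y, rfl, x, fun h => hl e y (by
          rw [Set.mem_singleton_iff.1 h] at hxy; exact hxy), hxy.symm⟩
  have hbA : ∀ S, (H.deleteVerts {y₀}).bdry S ⊆ H.bdry S := by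
    rintro S e ⟨x, hx, y, hy, h⟩
    exact ⟨x, hx, y, hy, (deleteVerts_singleton_isLink.1 h).1⟩
  refine ⟨hVA ▸ hV.subset Set.sdiff_subset, hEA ▸ hE.subset Set.sdiff_subset,
    fun e x h => hl e x (deleteVerts_singleton_isLink.1 h).1, ?_, ?_, ?_⟩
  · have h0 := deficit_eq_zero_of_isRegular hV hE hreg
    have h1 := Set.ncard_sdiff_singleton_add_one hyV hV
    have h2 := Set.ncard_sdiff_add_ncard_of_subset (bdry_subset (G := H) {y₀}) hE
    rw [h3 y₀ hyV] at h2
    rw [deficit] at h0 ⊢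
    rw [hVA, hEA]
    omega
  · rw [hVA, hVH]
    exact fun x hx => ⟨Or.inl hx, fun h => hyX (h ▸ hx)⟩
  · intro Q hQ heven htwo
    have hQE : Q ⊆ E(H) := fun e he => by
      have := hQ he
      rw [hEA] at this
      exact this.1
    have hQf := hE.subset hQE
    have hQX : Q ⊆ (H.deleteVerts {y₀}).bdry X := by
      intro e he
      obtain ⟨x, y, hxy⟩ := exists_isLink_of_mem_edgeSet (hQ he)
      rcases hbip e x y (deleteVerts_singleton_isLink.1 hxy).1 with h | h
      · exact ⟨x, h.1, y, fun h' => Set.disjoint_left.1 hdisj h' h.2, hxy⟩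
      · exact ⟨y, h.2, x, fun h' => Set.disjoint_left.1 hdisj h' h.1, hxy.symm⟩
    have hQY : Q ⊆ (H.deleteVerts {y₀}).bdry (Y \ {y₀}) := by
      intro e he
      obtain ⟨x, y, hxy⟩ := exists_isLink_of_mem_edgeSet (hQ he)
      obtain ⟨h1, hx, hy'⟩ := deleteVerts_singleton_isLink.1 hxy
      rcases hbip e x y h1 with h | h
      · exact ⟨y, ⟨h.2, hy'⟩, x, fun h' => Set.disjoint_left.1 hdisj h.1 h'.1, hxy.symm⟩
      · exact ⟨x, ⟨h.1, hx⟩, y, fun h' => Set.disjoint_left.1 hdisj h.2 h'.1, hxy⟩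
    have hYf' : (Y \ {y₀}).Finite := hYf.subset Set.sdiff_subset
    have hc1 := ncard_eq_sum_bdry hXf hQf hQX
    rw [Finset.sum_congr rfl (g := fun _ => 2) fun v hv => htwo v (by simpa using hv),
      Finset.sum_const, smul_eq_mul, ← Set.ncard_eq_toFinset_card X hXf] at hc1
    have hc2 := ncard_eq_sum_bdry hYf' hQf hQY
    have hle := Finset.sum_le_card_nsmul hYf'.toFinset
      (fun v => (Q ∩ (H.deleteVerts {y₀}).bdry {v}).ncard) 2 (by
        intro v hv
        have hv' : v ∈ Y \ {y₀} := by simpa using hv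
        have h1 := heven v (by rw [hVA, hVH]; exact ⟨Or.inr hv'.1, hv'.2⟩)
        have h2 := Set.ncard_le_ncard (Set.inter_subset_right.trans (hbA {v}) :
          Q ∩ (H.deleteVerts {y₀}).bdry {v} ⊆ H.bdry {v}) (hE.subset (bdry_subset _))
        rw [h3 v (hVH ▸ Or.inr hv'.1)] at h2
        obtain ⟨k, hk⟩ := h1
        omega)
    rw [← hc2, smul_eq_mul, ← Set.ncard_eq_toFinset_card _ hYf'] at hle
    have h4 := Set.ncard_sdiff_singleton_add_one hy hYf
    omega

/-- Among the edges of an even set, an even number leaves the exploded part, so that contracting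
this part again gives an even set. -/
lemma Obstructed.explode {A F B : Graph α β} {X : Set α} {y z : α} (h : A.Obstructed X)
    (hyX : y ∉ X) (hFV : V(F).Finite) (hFE : E(F).Finite) (hF3 : F.IsRegular 3)
    (hF : F.IsTwoConnected) (hB : IsExplosion A y F z B) : B.Obstructed X := by
  obtain ⟨hy, hz, hdV, hdE, hVB, σ, hσ, hlink⟩ := hB
  have hFl : ∀ e x, ¬ F.IsLink e x x := hF.loopless hFE fun v hv => (hF3 v hv).le
  have hAF : ∀ x, x ∈ V(A) → x ∉ V(F) := fun x hx => Set.disjoint_left.1 hdV hx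
  have hzinc : {e | F.Inc e z}.ncard = 3 := by
    rw [← bdry_singleton_of_loopless hFl, ← deg_eq_ncard_bdry hFl, hF3 z hz]
  -- every edge of `A` at `y` continues in `F - z`
  have hcont : ∀ e p, A.IsLink e p y → ∃ q, F.IsLink (σ e) q z ∧ q ≠ z := by
    intro e p hp
    obtain ⟨q, hq⟩ := hσ.mapsTo ⟨p, hp.symm⟩
    exact ⟨q, hq.symm, fun h => hFl (σ e) z (by rw [h] at hq; exact hq)⟩
  have hBV : V(B).Finite := by
    rw [hVB]
    exact (h.finite_vertexSet.subset Set.sdiff_subset).union (hFV.subset Set.sdiff_subset)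
  have hEB : E(B) = E(A) ∪ (E(F) \ {e | F.Inc e z}) := by
    ext e
    constructor
    · intro he
      obtain ⟨p, q, hpq⟩ := exists_isLink_of_mem_edgeSet he
      rcases (hlink e p q).1 hpq with h | ⟨h, hp, hq⟩ | h | h
      · exact Or.inl h.1.edge_mem
      · refine Or.inr ⟨h.edge_mem, ?_⟩
        rintro ⟨r, hr⟩
        rcases h.eq_and_eq_or_eq_and_eq hr with ⟨h', -⟩ | ⟨-, h'⟩
        · exact hp h'
        · exact hq h'
      · exact Or.inl h.1.edge_mem
      · exact Or.inl h.1.edge_mem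
    · rintro (he | ⟨he, hn⟩)
      · obtain ⟨p, q, hpq⟩ := exists_isLink_of_mem_edgeSet he
        by_cases hq : q = y
        · subst hq
          obtain ⟨r, hr, -⟩ := hcont e p hpq
          exact ((hlink e p r).2 (Or.inr (Or.inr (Or.inl ⟨hpq, hr⟩)))).edge_mem
        by_cases hp : p = y
        · subst hp
          obtain ⟨r, hr, -⟩ := hcont e q hpq.symm
          exact ((hlink e q r).2 (Or.inr (Or.inr (Or.inl ⟨hpq.symm, hr⟩)))).edge_mem
        exact ((hlink e p q).2 (Or.inl ⟨hpq, hp, hq⟩)).edge_mem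
      · obtain ⟨p, q, hpq⟩ := exists_isLink_of_mem_edgeSet he
        refine ((hlink e p q).2 (Or.inr (Or.inl ⟨hpq, ?_, ?_⟩))).edge_mem
        · rintro rfl; exact hn ⟨q, hpq⟩
        · rintro rfl; exact hn ⟨p, hpq.symm⟩
  have hBE : E(B).Finite := by
    rw [hEB]
    exact h.finite_edgeSet.union (hFE.subset Set.sdiff_subset)
  refine ⟨hBV, hBE, ?_, ?_, ?_, ?_⟩
  · intro e x hx
    rcases (hlink e x x).1 hx with h' | h' | h' | h'
    · exact h.loopless e x h'.1
    · exact hFl e x h'.1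
    · exact hAF x h'.1.left_mem h'.2.left_mem
    · exact hAF x h'.1.left_mem h'.2.left_mem
  · have h0 := h.deficit_eq
    have h1 := deficit_eq_zero_of_isRegular hFV hFE hF3
    have h2 := Set.ncard_sdiff_singleton_add_one hy h.finite_vertexSet
    have h3 := Set.ncard_sdiff_singleton_add_one hz hFV
    have h4 := Set.ncard_sdiff_add_ncard_of_subset (s := {e | F.Inc e z}) (t := E(F))
      (fun e he => Inc.edge_mem he) hFE
    rw [deficit] at h0 h1 ⊢
    rw [hVB, hEB, Set.ncard_union_eq (hdV.mono Set.sdiff_subset Set.sdiff_subset)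
      (h.finite_vertexSet.subset Set.sdiff_subset) (hFV.subset Set.sdiff_subset),
      Set.ncard_union_eq (hdE.mono_right Set.sdiff_subset) h.finite_edgeSet
      (hFE.subset Set.sdiff_subset)]
    omega
  · rw [hVB]
    exact fun x hx => Or.inl ⟨h.subset hx, fun h' => hyX (h' ▸ hx)⟩
  · intro Q hQ heven htwo
    have hbv : ∀ v ∈ V(A), v ≠ y → B.bdry {v} = A.bdry {v} := by
      intro v hv hvy
      ext e
      constructor
      · rintro ⟨v, rfl, q, hq, hl⟩
        rcases (hlink e v q).1 hl with h' | h' | h' | h'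
        · exact ⟨v, rfl, q, hq, h'.1⟩
        · exact absurd h'.1.left_mem (hAF v hv)
        · exact ⟨v, rfl, y, fun h => hvy h.symm, h'.1⟩
        · exact absurd h'.2.left_mem (hAF v hv)
      · rintro ⟨v, rfl, q, hq, hl⟩
        by_cases hqy : q = y
        · subst hqy
          obtain ⟨r, hr, -⟩ := hcont e v hl
          refine ⟨v, rfl, r, ?_, (hlink e v r).2 (Or.inr (Or.inr (Or.inl ⟨hl, hr⟩)))⟩
          intro h'
          rw [Set.mem_singleton_iff.1 h'] at hr
          exact hAF v hv hr.left_mem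
        · exact ⟨v, rfl, q, hq, (hlink e v q).2 (Or.inl ⟨hl, hvy, hqy⟩)⟩
    have hby : B.bdry (V(F) \ {z}) = A.bdry {y} := by
      ext e
      constructor
      · rintro ⟨p, hp, q, hq, hl⟩
        rcases (hlink e p q).1 hl with h' | h' | h' | h'
        · exact absurd hp.1 (hAF p h'.1.left_mem)
        · exact absurd ⟨h'.1.right_mem, h'.2.2⟩ hq
        · exact absurd hp.1 (hAF p h'.1.left_mem)
        · refine ⟨y, rfl, q, fun hqy => h.loopless e y ?_, h'.1.symm⟩
          have := h'.1
          rwa [Set.mem_singleton_iff.1 hqy] at this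
      · rintro ⟨_, rfl, q, hq, hl⟩
        obtain ⟨r, hr, hrz⟩ := hcont e q hl.symm
        exact ⟨r, ⟨hr.left_mem, hrz⟩, q, fun h' => hAF q hl.right_mem h'.1,
          (hlink e r q).2 (Or.inr (Or.inr (Or.inr ⟨hl.symm, hr⟩)))⟩
    have hinter : ∀ v, Q ∩ E(A) ∩ A.bdry {v} = Q ∩ A.bdry {v} := by
      intro v
      rw [Set.inter_assoc, Set.inter_eq_self_of_subset_right (bdry_subset _)]
    refine h.false_of_even (Q ∩ E(A)) Set.inter_subset_right ?_ ?_
    · intro v hv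
      rw [hinter]
      by_cases hvy : v = y
      · rw [hvy, ← hby]
        refine even_ncard_inter_bdry hBV hBE hQ ?_ ?_
        · rw [hVB]; exact Set.subset_union_right
        · intro u hu
          exact heven u (by rw [hVB]; exact Or.inr hu)
      · rw [← hbv v hv hvy]
        exact heven v (by rw [hVB]; exact Or.inl ⟨hv, hvy⟩)
    · intro x hx
      have hxy : x ≠ y := fun h' => hyX (h' ▸ hx)
      rw [hinter, ← hbv x (h.subset hx) hxy]
      exact htwo x hx

lemma ExplosionStage.obstructed {A₀ A : Graph α β} {R₀ R X : Set α}
    (h : ExplosionStage A₀ R₀ A R) (h0 : A₀.Obstructed X) (hX : Disjoint X R₀) :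
    A.Obstructed X ∧ R ⊆ R₀ := by
  induction h with
  | start => exact ⟨h0, subset_rfl⟩
  | explode _ hy hFV hFE hF3 hF hB ih =>
    exact ⟨ih.1.explode (fun hyX => Set.disjoint_left.1 hX hyX (ih.2 hy)) hFV hFE hF3 hF hB,
      Set.sdiff_subset.trans ih.2⟩

lemma f₂_le_ncard (hV : V(G).Finite) : G.f₂ ≤ V(G).ncard :=
  csSup_le' fun _ ⟨_, hK, _, hk⟩ => hk ▸ Set.ncard_le_ncard hK.vertexSet_mono hV

lemma Obstructed.f₂_lt_ncard {A : Graph α' β'} {X : Set α'} (h : A.Obstructed X)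
    (hiso : G.IsIsomorphic A) (hV : V(G).Finite) : G.f₂ < V(G).ncard := by
  classical
  refine lt_of_le_of_ne (f₂_le_ncard hV) fun heq => ?_
  have hne : {k | ∃ K : Graph α β, K ≤ G ∧ K.IsRegular 2 ∧ V(K).ncard = k}.Nonempty := by
    refine ⟨0, ⊥, bot_le, ?_, ?_⟩
    · intro v hv; simp at hv
    · simp
  obtain ⟨K, hKG, hreg, hc⟩ := Nat.sSup_mem hne (bddAbove_isRegular_two hV)
  have hVK : V(K) = V(G) := Set.eq_of_subset_of_ncard_le hKG.vertexSet_mono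
    (by rw [hc]; exact heq.ge) hV
  obtain ⟨f, g, hfg⟩ := hiso
  have hl : ∀ e x, ¬ G.IsLink e x x := by
    intro e x hex
    exact h.loopless _ _ ((hfg ⟨e, hex.edge_mem⟩ ⟨x, hex.left_mem⟩ ⟨x, hex.left_mem⟩).1 hex)
  have hKl : ∀ e x, ¬ K.IsLink e x x := fun e x hex => hl e x (hex.mono hKG)
  set Q : Set β' := (fun e : E(G) => (g e : β')) '' {e | (e : β) ∈ E(K)} with hQ
  have hgi : Function.Injective fun e : E(G) => (g e : β') :=
    Subtype.val_injective.comp g.injective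
  have hdeg : ∀ v ∈ V(A), (Q ∩ A.bdry {v}).ncard = 2 := by
    intro v hv
    obtain ⟨u, hu⟩ := f.surjective ⟨v, hv⟩
    have huv : (f u : α') = v := by rw [hu]
    have h1 : Q ∩ A.bdry {v} = (fun e : E(G) => (g e : β')) '' {e | (e : β) ∈ K.bdry {(u : α)}} := by
      ext e'
      constructor
      · rintro ⟨⟨e, he, rfl⟩, x, rfl, w, hw, hxw⟩
        obtain ⟨w', hw'⟩ := f.surjective ⟨w, hxw.right_mem⟩
        have hww : (f w' : α') = w := by rw [hw']
        refine ⟨e, ?_, rfl⟩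
        rw [← huv, ← hww] at hxw
        have h2 := (hfg e u w').2 hxw
        have h3 : K.IsLink e u w' := (hKG.isLink_iff he).2 h2
        refine ⟨u, rfl, w', fun h4 => hw ?_, h3⟩
        rw [Set.mem_singleton_iff, ← hww, ← huv, Subtype.ext (Set.mem_singleton_iff.1 h4)]
      · rintro ⟨e, ⟨x, hx, w, hw, hxw⟩, rfl⟩
        rw [Set.mem_singleton_iff] at hx
        subst hx
        have h2 : G.IsLink e u w := hxw.mono hKG
        refine ⟨⟨e, hxw.edge_mem, rfl⟩, f u, huv, f ⟨w, h2.right_mem⟩, ?_,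
          (hfg e u ⟨w, h2.right_mem⟩).1 h2⟩
        intro h3
        have h4 : f ⟨w, h2.right_mem⟩ = f u := Subtype.ext (h3.trans huv.symm)
        have h5 := congrArg Subtype.val (f.injective h4)
        exact hw h5
    have h2 : K.bdry {(u : α)} = Subtype.val '' {e : E(G) | (e : β) ∈ K.bdry {(u : α)}} := by
      ext e
      constructor
      · intro he
        exact ⟨⟨e, hKG.edgeSet_mono (bdry_subset _ he)⟩, he, rfl⟩
      · rintro ⟨e, he, rfl⟩
        exact he
    have h3 := hreg u (by rw [hVK]; exact u.2)
    rw [deg_eq_ncard_bdry hKl, h2, Set.ncard_image_of_injective _ Subtype.val_injective] at h3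
    rw [h1, Set.ncard_image_of_injective _ hgi, h3]
  refine h.false_of_even Q ?_ ?_ ?_
  · rintro _ ⟨e, -, rfl⟩
    exact (g e).2
  · intro v hv
    rw [hdeg v hv]; exact even_two
  · intro x hx
    exact hdeg x (h.subset hx)

theorem IsInFamilyG.deficit_and_f₂ (h : G.IsInFamilyG) (hV : V(G).Finite) :
    G.deficit = 3 ∧ G.f₂ < V(G).ncard := by
  obtain ⟨H, X, Y, y₀, A, R, h1, h2, h3, -, h4, h5, -, h6, hiso⟩ := h
  have hob := (h6.obstructed (obstructed_deleteVerts h1 h2 h3 h4 h5)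
    (h4.2.1.mono_right Set.sdiff_subset)).1
  exact ⟨hiso.deficit_eq.trans hob.deficit_eq, hob.f₂_lt_ncard hiso hV⟩

end Obstruction
end Graph

namespace Graph

open TJoin

/-! ### The equality case for a single component -/

section Component

variable {α β : Type*} {G : Graph α β}

lemma f₂_le_ncard_edgeSet (hV : V(G).Finite) (hE : E(G).Finite) (h3 : G.IsSubcubic)
    (hne : V(G).Nonempty) : G.f₂ ≤ E(G).ncard := by
  classical
  have : Nonempty α := hne.to_type
  obtain ⟨p, q, hends⟩ := exists_ends G
  obtain ⟨M, hM, -, hc⟩ := (hends.f₂_spec (E := hE.toFinset) (by simp) hV h3).1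
  rw [← hc, Set.ncard_eq_toFinset_card _ hE]
  exact Finset.card_le_card hM

/-- For a connected multigraph without cut-edges, `n - f₂` is at most a third of the deficit `d`,
so that it can only equal `(d - 1) / 2` if `d` is one or three. -/
theorem two_mul_sub_f₂_eq_iff (hV : V(G).Finite) (hE : E(G).Finite) (h3 : G.IsSubcubic)
    (hc : G.IsConnected) (hb : ∀ e, ¬ G.IsCutEdge e) (hd : 1 ≤ G.deficit)
    (hf : 2 * E(G).ncard ≤ 3 * G.f₂) :
    2 * ((V(G).ncard : ℤ) - G.f₂) = G.deficit - 1 ↔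
      (∃ v, V(G) = {v}) ∨ G.IsBalloon ∨ G.IsInFamilyG := by
  have := hV.to_subtype
  have hle := f₂_le_ncard hV
  have hdef : G.deficit = 3 * (V(G).ncard : ℤ) - 2 * (E(G).ncard : ℤ) := rfl
  constructor
  · intro h
    rcases Nat.lt_or_ge 1 V(G).ncard with hn | hn
    · right
      have hnt : V(G).Nontrivial := Set.one_lt_ncard_iff_nontrivial.1 hn
      have hcut := CutTwo.of_isConnected hE hc hb
      rcases (by omega : G.deficit = 1 ∨ G.deficit = 3) with hd1 | hd3
      · exact Or.inl (hcut.isBalloon hV hE hnt h3 hd1)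
      · obtain ⟨X, 𝓓, hs⟩ := exists_skeleton hV hE hcut hnt h3 hd3 (by omega)
        exact Or.inr hs.isInFamilyG
    · left
      have := (Set.ncard_pos hV).2 hc.1
      exact Set.ncard_eq_one.1 (by omega)
  · rintro (⟨v, hv⟩ | h | h)
    · have h1 : V(G).ncard = 1 := by rw [hv, Set.ncard_singleton]
      have h2 := f₂_le_ncard_edgeSet hV hE h3 hc.1
      omega
    · have := h.deficit_eq_one
      omega
    · have := h.deficit_and_f₂ hV
      omega

/-- The components are the subgraphs induced by the connectivity classes. -/
lemma isComponentOf_iff {C : Graph α β} : C.IsComponentOf G ↔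
    ∃ x ∈ V(G), C = G.induce {y | y ∈ V(G) ∧ Relation.ReflTransGen G.Adj x y} := by
  have hle : ∀ x, G.induce {y | y ∈ V(G) ∧ Relation.ReflTransGen G.Adj x y} ≤ G :=
    fun x => induce_le fun y hy => hy.1
  have hconn : ∀ x ∈ V(G),
      (G.induce {y | y ∈ V(G) ∧ Relation.ReflTransGen G.Adj x y}).IsConnected := by
    intro x hx
    have hmem : x ∈ {y | y ∈ V(G) ∧ Relation.ReflTransGen G.Adj x y} := ⟨hx, .refl⟩
    have hreach : ∀ y, Relation.ReflTransGen G.Adj x y → Relation.ReflTransGen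
        (G.induce {y | y ∈ V(G) ∧ Relation.ReflTransGen G.Adj x y}).Adj x y := by
      intro y hr
      induction hr with
      | refl => exact .refl
      | @tail y z hr hyz ih =>
        obtain ⟨e, he⟩ := hyz
        exact ih.tail ⟨e, he, ⟨he.left_mem, hr⟩, ⟨he.right_mem, hr.tail ⟨e, he⟩⟩⟩
    refine ⟨⟨x, hmem⟩, fun y hy z hz => ?_⟩
    exact (Relation.ReflTransGen.stdSymm.symm _ _ (hreach y hy.2)).trans (hreach z hz.2)
  have hsub : ∀ K ≤ G, K.IsConnected → ∀ x ∈ V(K),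
      K ≤ G.induce {y | y ∈ V(G) ∧ Relation.ReflTransGen G.Adj x y} := by
    intro K hK hKc x hx
    have hV : V(K) ⊆ {y | y ∈ V(G) ∧ Relation.ReflTransGen G.Adj x y} := fun y hy =>
      ⟨hK.vertexSet_mono hy,
        Relation.ReflTransGen.mono (fun _ _ hst => hst.mono hK) _ _ (hKc.2 x hx y hy)⟩
    exact ⟨hV, fun e y z h => ⟨h.mono hK, hV h.left_mem, hV h.right_mem⟩⟩
  constructor
  · intro h
    obtain ⟨x, hx⟩ := h.prop.2.1
    have hxG := h.prop.1.vertexSet_mono hx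
    have hCle := hsub C h.prop.1 h.prop.2 x hx
    exact ⟨x, hxG, le_antisymm hCle (h.2 ⟨hle x, hconn x hxG⟩ hCle)⟩
  · rintro ⟨x, hx, rfl⟩
    refine ⟨⟨hle x, hconn x hx⟩, fun K hK hle' => hsub K hK.1 hK.2 x ?_⟩
    exact hle'.vertexSet_mono ⟨hx, .refl⟩

end Component

/-! ### Components of the multigraph without its cut-edges -/

section Main

variable {α β : Type*} [DecidableEq α] [DecidableEq β] {G : Graph α β} {p q : β → α}

/-- The subgraph of `G - F` induced by a component, in terms of edge sets. Here `F` is the set of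
cut-edges of `G` and `M` is the edge set of a largest `2`-regular subgraph. -/
lemma Ends.class_spec (hends : G.Ends p q) {U : Finset α} {E F M : Finset β}
    (hU : V(G) = ↑U) (hE : E(G) = ↑E) (h3 : G.IsSubcubic)
    (hF : ∀ e, e ∈ F ↔ e ∈ E ∧ ¬ ∃ C ⊆ E, bd p q C = 0 ∧ e ∈ C)
    (hME : M ⊆ E \ F) (hM : bd p q M = 0) {r : α}
    (hmax : ∀ C ⊆ part p q (E \ F) (E \ F) r, bd p q C = 0 → C.card ≤ (part p q (E \ F) M r).card)
    {C : Graph α β} (hC : C = (G.deleteEdges ↑F).induce ↑(cls p q (E \ F) U r)) :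
    V(C).Finite ∧ E(C).Finite ∧ C.IsSubcubic ∧ (∀ e, ¬ C.IsCutEdge e) ∧
      V(C).ncard = (cls p q (E \ F) U r).card ∧
      E(C).ncard = (part p q (E \ F) (E \ F) r).card ∧ C.f₂ = (part p q (E \ F) M r).card := by
  have hdel := edgeSet_deleteEdges_coe hE F
  have hCG' : C ≤ G.deleteEdges ↑F := by
    rw [hC]
    refine induce_le fun x hx => ?_
    have : x ∈ U := (Finset.mem_filter.1 hx).1
    simpa [hU] using this
  have hends' : (G.deleteEdges ↑F).Ends p q := hends.mono deleteEdges_le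
  have hendsC : C.Ends p q := hends'.mono hCG'
  have hVC : V(C) = ↑(cls p q (E \ F) U r) := by rw [hC]; rfl
  have hEC : E(C) = ↑(part p q (E \ F) (E \ F) r) := by
    rw [hC]
    ext e
    simp only [edgeSet_induce, Set.mem_ofPred_eq, Finset.mem_coe, part, cls, Finset.mem_filter]
    constructor
    · rintro ⟨x, y, hl, hx, hy⟩
      obtain ⟨he, h⟩ := hends'.isLink_iff.1 hl
      rw [hdel] at he
      refine ⟨he, ?_⟩
      rcases h with ⟨rfl, -⟩ | ⟨rfl, -⟩
      · exact hx.2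
      · exact hy.2
    · rintro ⟨he, hr⟩
      have hl := hends' e (by rw [hdel]; exact he)
      have hm : ∀ x ∈ V(G.deleteEdges ↑F), x ∈ U := fun x hx => by simpa [hU] using hx
      exact ⟨p e, q e, hl, ⟨hm _ hl.left_mem, hr⟩, ⟨hm _ hl.right_mem, by rw [rep_end he, hr]⟩⟩
  have hsubE : part p q (E \ F) (E \ F) r ⊆ E := (part_subset _ _ _).trans Finset.sdiff_subset
  have hVf : V(C).Finite := by rw [hVC]; exact Finset.finite_toSet _
  have hC3 : C.IsSubcubic := by
    intro v hv
    rw [hendsC.deg_eq hEC]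
    refine (dgr_mono hsubE v).trans ?_
    rw [← hends.deg_eq hE]
    exact h3 v (hCG'.vertexSet_mono hv)
  refine ⟨hVf, by rw [hEC]; exact Finset.finite_toSet _, hC3, ?_, ?_, ?_, ?_⟩
  · intro e hcut
    have he : e ∈ part p q (E \ F) (E \ F) r := by
      obtain ⟨x, y, hl, -⟩ := hcut
      have := hl.edge_mem
      rwa [hEC] at this
    refine (hendsC.isCutEdge_iff hEC he).1 hcut ?_
    have he' := Finset.mem_filter.1 he
    have heE : ∃ C ⊆ E, bd p q C = 0 ∧ e ∈ C := by
      by_contra hcon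
      exact (Finset.mem_sdiff.1 he'.1).2 ((hF e).2 ⟨hsubE he, hcon⟩)
    obtain ⟨Q, hQ, hQ0, heQ⟩ := heE
    have hQ' : Q ⊆ E \ F := fun f hf => Finset.mem_sdiff.2
      ⟨hQ hf, fun hfF => ((hF f).1 hfF).2 ⟨Q, hQ, hQ0, hf⟩⟩
    exact ⟨part p q (E \ F) Q r, part_mono _ hQ' r, bd_part_eq_zero hQ' hQ0 r,
      Finset.mem_filter.2 ⟨heQ, he'.2⟩⟩
  · rw [hVC, Set.ncard_coe_finset]
  · rw [hEC, Set.ncard_coe_finset]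
  · obtain ⟨⟨Q, hQ, hQ0, hc⟩, h2⟩ := hendsC.f₂_spec hEC hVf hC3
    refine le_antisymm ?_ (h2 _ (part_mono _ hME r) (bd_part_eq_zero hME hM r))
    rw [← hc]
    exact hmax Q hQ hQ0

end Main

end Graph

open Graph TJoin in
theorem theorem4 {α β : Type*} (G : Graph α β) (hV : V(G).Finite) (hE : E(G).Finite)
    (hG : G.IsSubcubic) (n c : ℕ) (d : ℤ) (hn : n = V(G).ncard) (hc : c = G.cutEdges.ncard)
    (hd : d = G.deficit) :
    (G.f₂ : ℝ) ≥ (n : ℝ) - max 0 (((d : ℝ) + (c : ℝ) - 1) / 2) ∧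
    (G.IsConnected →
      ((G.f₂ : ℝ) = (n : ℝ) - max 0 (((d : ℝ) + (c : ℝ) - 1) / 2) ↔
        (G.IsRegular 3 ∧ ∀ e, ¬ G.IsCutEdge e) ∨
        ∀ C : Graph α β, C.IsComponentOf (G.deleteEdges G.cutEdges) →
          (∃ v, V(C) = {v}) ∨ C.IsBalloon ∨ C.IsInFamilyG)) := by
  classical
  rcases isEmpty_or_nonempty α with hα | hα
  · have h0 : V(G) = ∅ := Set.eq_empty_of_isEmpty _
    have hn0 : n = 0 := by rw [hn, h0, Set.ncard_empty]
    refine ⟨?_, fun h => ?_⟩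
    · have h1 : (0 : ℝ) ≤ G.f₂ := Nat.cast_nonneg _
      have h2 := le_max_left (0 : ℝ) (((d : ℝ) + (c : ℝ) - 1) / 2)
      rw [hn0, Nat.cast_zero]
      linarith
    · obtain ⟨x, -⟩ := h.1
      exact hα.elim x
  obtain ⟨p, q, hends⟩ := exists_ends G
  obtain ⟨U, hU⟩ := hV.exists_finset_coe
  obtain ⟨E, hEE⟩ := hE.exists_finset_coe
  replace hU := hU.symm
  replace hEE := hEE.symm
  set F := E.filter fun e => G.IsCutEdge e with hFdef
  have hF : ∀ e, e ∈ F ↔ e ∈ E ∧ ¬ ∃ C ⊆ E, bd p q C = 0 ∧ e ∈ C := by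
    intro e
    rw [hFdef, Finset.mem_filter]
    exact and_congr_right fun he => hends.isCutEdge_iff hEE he
  have hcutF : G.cutEdges = ↑F := by
    ext e
    rw [hFdef, Finset.coe_filter]
    refine ⟨fun h => ⟨?_, h⟩, fun h => h.2⟩
    obtain ⟨x, y, hl, -⟩ := h
    have := hl.edge_mem
    rwa [hEE] at this
  have hmemU : ∀ e ∈ E, p e ∈ U ∧ q e ∈ U := by
    intro e he
    have hl := hends e (by rw [hEE]; exact he)
    have h1 := hl.left_mem
    have h2 := hl.right_mem
    rw [hU] at h1 h2
    exact ⟨h1, h2⟩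
  have h3 : ∀ v ∈ U, dgr p q E v ≤ 3 := by
    intro v hv
    rw [← hends.deg_eq hEE]
    exact hG v (by rw [hU]; exact hv)
  obtain ⟨⟨M, hME, hM, hMc⟩, hmax⟩ := hends.f₂_spec hEE hV hG
  have hnU : n = U.card := by rw [hn, hU, Set.ncard_coe_finset]
  have hcF : c = F.card := by rw [hc, hcutF, Set.ncard_coe_finset]
  have hdU : d = 3 * (U.card : ℤ) - 2 * E.card := by
    rw [hd, deficit, hU, hEE, Set.ncard_coe_finset, Set.ncard_coe_finset]
  have hfle : G.f₂ ≤ n := hn ▸ f₂_le_ncard hV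
  have hd0 : 0 ≤ d := by
    rw [hd, deficit_eq_sum hends hV hE]
    refine Finset.sum_nonneg fun v hv => ?_
    have := hG v (by simpa using hv)
    omega
  obtain ⟨hthird, hmaxp, hcases⟩ := card_sub_card_le hmemU h3 hF hME hM
    (fun C hC hC0 => hMc ▸ hmax C hC hC0)
  rw [← hdU, ← hnU, ← hcF, hMc] at hcases
  rcases hcases with ⟨-, h1, h2⟩ | ⟨h1, h2⟩
  · have hd0' : d = 0 := by omega
    have hc0 : c = 0 := by omega
    have hfn : G.f₂ = n := le_antisymm hfle h1
    have hmx : max (0 : ℝ) (((d : ℝ) + (c : ℝ) - 1) / 2) = 0 := by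
      rw [hd0', hc0]; norm_num
    rw [hmx, hfn]
    refine ⟨by simp, fun _ => ⟨fun _ => Or.inl ⟨?_, ?_⟩, fun _ => by simp⟩⟩
    · rw [hd0', deficit_eq_sum hends hV hE] at hd
      intro v hv
      have := (Finset.sum_eq_zero_iff_of_nonneg (fun v hv => by
        have := hG v (by simpa using hv)
        omega)).1 hd.symm v (by simpa using hv)
      omega
    · intro e he
      have h4 : F = ∅ := Finset.card_eq_zero.1 (by omega)
      have h5 : e ∈ G.cutEdges := he
      rw [hcutF, h4] at h5
      simp at h5
  · have hnn : 0 ≤ d + c - 1 := by omega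
    have hmx : max (0 : ℝ) (((d : ℝ) + (c : ℝ) - 1) / 2) = ((d : ℝ) + (c : ℝ) - 1) / 2 := by
      refine max_eq_right ?_
      have : (0 : ℝ) ≤ (d : ℝ) + (c : ℝ) - 1 := by exact_mod_cast hnn
      linarith
    rw [hmx]
    refine ⟨?_, fun hconn => ?_⟩
    · have : (2 : ℝ) * ((n : ℝ) - G.f₂) ≤ (d : ℝ) + (c : ℝ) - 1 := by exact_mod_cast h1
      linarith
    have hone : (U.image (rep p q E)).card = 1 := by
      obtain ⟨x, hx⟩ := hconn.1
      refine Finset.card_eq_one.2 ⟨rep p q E x, ?_⟩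
      ext r
      rw [Finset.mem_image, Finset.mem_singleton]
      constructor
      · rintro ⟨y, hy, rfl⟩
        exact rep_eq_iff.2 ((hends.reflTransGen_iff hEE).1
          (hconn.2 y (by rw [hU]; exact hy) x hx))
      · rintro rfl
        rw [hU] at hx
        exact ⟨x, hx, rfl⟩
    obtain ⟨hdef, heq⟩ := h2 hone
    have hleft : (G.f₂ : ℝ) = (n : ℝ) - ((d : ℝ) + (c : ℝ) - 1) / 2 ↔
        2 * ((n : ℤ) - G.f₂) = d + c - 1 := by
      constructor
      · intro h
        have : (2 : ℝ) * ((n : ℝ) - G.f₂) = (d : ℝ) + (c : ℝ) - 1 := by linarith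
        exact_mod_cast this
      · intro h
        have : (2 : ℝ) * ((n : ℝ) - G.f₂) = (d : ℝ) + (c : ℝ) - 1 := by exact_mod_cast h
        linarith
    have hno : ¬ (G.IsRegular 3 ∧ ∀ e, ¬ G.IsCutEdge e) := by
      rintro ⟨hreg, hcut⟩
      have h5 := deficit_eq_zero_of_isRegular hV hE hreg
      have h6 : G.cutEdges = ∅ := Set.eq_empty_of_forall_notMem hcut
      rw [h6, Set.ncard_empty] at hc
      omega
    rw [hleft, heq, or_iff_right hno, hcutF]
    -- the components of `G` without its cut-edges correspond to the representatives
    have hMF : M ⊆ E \ F := fun f hf => Finset.mem_sdiff.2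
      ⟨hME hf, fun hfF => ((hF f).1 hfF).2 ⟨M, hME, hM, hf⟩⟩
    have hdel := edgeSet_deleteEdges_coe hEE F
    have hends' : (G.deleteEdges ↑F).Ends p q := hends.mono deleteEdges_le
    have hVdel : V(G.deleteEdges ↑F) = ↑U := by rw [← hU]; simp
    have hcls : ∀ x, {y | y ∈ V(G.deleteEdges ↑F) ∧
        Relation.ReflTransGen (G.deleteEdges ↑F).Adj x y} =
        ↑(cls p q (E \ F) U (rep p q (E \ F) x)) := by
      intro x
      ext y
      rw [Set.mem_ofPred_eq, hVdel, hends'.reflTransGen_iff hdel, cls, Finset.coe_filter,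
        Set.mem_ofPred_eq, rep_eq_iff, Finset.mem_coe]
      exact and_congr_right fun _ => ⟨Conn.symm, Conn.symm⟩
    have key : ∀ x ∈ U, ∀ C : Graph α β,
        C = (G.deleteEdges ↑F).induce ↑(cls p q (E \ F) U (rep p q (E \ F) x)) →
        (2 * (((cls p q (E \ F) U (rep p q (E \ F) x)).card : ℤ) -
          (part p q (E \ F) M (rep p q (E \ F) x)).card) =
          clsDeficit p q (E \ F) U (rep p q (E \ F) x) - 1 ↔
        (∃ v, V(C) = {v}) ∨ C.IsBalloon ∨ C.IsInFamilyG) := by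
      intro x hx C hC
      obtain ⟨c1, c2, c3, c4, c5, c6, c7⟩ := hends.class_spec hU hEE hG hF hMF hM (hmaxp _) hC
      have hcon : C.IsConnected := by
        rw [← hcls] at hC
        exact (isComponentOf_iff.2 ⟨x, by rw [hVdel]; exact hx, hC⟩).prop.2
      have hCd : C.deficit = clsDeficit p q (E \ F) U (rep p q (E \ F) x) := by
        rw [deficit, c5, c6, clsDeficit]
      rw [← two_mul_sub_f₂_eq_iff c1 c2 c3 hcon c4 (by
        rw [hCd]; exact hdef _ (Finset.mem_image_of_mem _ hx)) (by
        rw [c6, c7]; exact hthird _), hCd, c5, c7]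
    constructor
    · intro h C hC
      obtain ⟨x, hx, hCx⟩ := isComponentOf_iff.1 hC
      rw [hcls] at hCx
      rw [hVdel] at hx
      exact (key x hx C hCx).1 (h _ (Finset.mem_image_of_mem _ hx))
    · intro h r hr
      obtain ⟨x, hx, rfl⟩ := Finset.mem_image.1 hr
      refine (key x hx _ rfl).2 (h _ (isComponentOf_iff.2 ⟨x, by rw [hVdel]; exact hx, ?_⟩))
      rw [hcls]
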